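/- Define $S(T)$ for real $T$ as follows. If $T$ is not the ordinate of any zero of the Riemann zeta function $\zeta$, let $S(T)=\frac1\pi\arg\zeta\left(\frac12+iT\right)$, where the argument is obtained by continuous variation along the straight lines connecting $2$, $2+iT$ and $\frac12+iT$, starting with the value $0$; if $T$ is the ordinate of a zero of $\zeta$, let $S(T)=\frac12\{S(T+0)+S(T-0)\}$. Put $S_0=S$ and, for every integer $m\ge1$, $$S_m(T)=\int_0^T S_{m-1}(t)\,dt+C_m$$ when $T$ is not the ordinate of a zero of $\zeta$, and $S_m(T)=\frac12\{S_m(T+0)+S_m(T-0)\}$ otherwise. Here, for every integer $k\ge1$, $$C_{2k-1}=\frac{(-1)^{k-1}}{\pi}L_{2k-1}\left(\tfrac12\right),\qquad C_{2k}=\frac{(-1)^{k-1}}{(2k)!\,2^{2k}},$$ where $L_0(\sigma)=\log|\zeta(\sigma)|$ and $L_{n+1}(\sigma)=\int_\sigma^\infty L_n(u)\,du$ for real $\sigma$. Assume the Riemann Hypothesis, let $m\ge1$ be an integer, and put $\kappa=\frac1e\left(1+\frac1e\right)$. If $m$ is odd, then, as $t\to\infty$, $$|S_m(t)|\le\frac{\log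 t}{(\log\log t)^{m+1}}\cdot\frac1{2\pi\,m!}\left\{\frac1{1-\kappa}\sum_{j=0}^m\frac{m!}{(m-j)!}\left(\frac1e+\frac1{2^{j+1}e^2}\right)+\frac1{m+1}\cdot\frac{\kappa}{1-\kappa}+\frac1{m(m+1)}\cdot\frac1{1-\kappa}\right\}+O\left(\frac{\log t}{(\log\log t)^{m+2}}\right).$$ If $m$ is even, then, as $t\to\infty$, $$|S_m(t)|\le\frac{\log t}{(\log\log t)^{m+1}}\cdot\frac1{2\pi\,m!}\left\{\frac1{1-\kappa}\sum_{j=0}^m\frac{m!}{(m-j)!}\left(\frac1e+\frac1{2^{j+1}e^2}\right)+\frac1{m+1}\cdot\frac{\kappa}{1-\kappa}+\frac{\pi}{2}\cdot\frac1{1-\kappa}\right\}+O\left(\frac{\log t}{(\log\log t)^{m+2}}\right).$$ The implied constants may depend on $m$. -/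

import Mathlib

noncomputable section

/-- `ArgContinuation f a b α β`: starting from the value `α` at `a`, continuous variation of the
argument of `f` along the straight segment from `a` to `b` ends with the value `β` at `b`.
(If `f` is continuous and zero-free on the segment and `α` is an argument of `f a`,
exactly one such `β` exists.) -/
def ArgContinuation (f : ℂ → ℂ) (a b : ℂ) (α β : ℝ) : Prop :=
  ∃ φ : ℝ → ℝ, ContinuousOn φ (Set.Icc 0 1) ∧ φ 0 = α ∧ φ 1 = β ∧
    ∀ u ∈ Set.Icc (0 : ℝ) 1,
      f (AffineMap.lineMap a b u) =
        (‖f (AffineMap.lineMap a b u)‖ : ℂ) * Complex.exp ((φ u : ℂ) * Complex.I)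

/-- `θ` is the value of `arg ζ(1/2 + iT)` obtained by continuous variation along the straight
lines connecting `2`, `2 + iT` and `1/2 + iT`, starting with the value zero. -/
def IsArgZeta (T θ : ℝ) : Prop :=
  ∃ β : ℝ, ArgContinuation riemannZeta 2 (2 + T * Complex.I) 0 β ∧
    ArgContinuation riemannZeta (2 + T * Complex.I) (1 / 2 + T * Complex.I) β θ

open Classical in
/-- `arg ζ(1/2 + iT)`; meaningful when `T ≠ 0` is not the ordinate of a zero of `ζ`. -/
def argZeta (T : ℝ) : ℝ :=
  if h : ∃ θ, IsArgZeta T θ then h.choose else 0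

/-- `T` is the ordinate of some zero of the Riemann zeta function. -/
def IsZetaOrdinate (T : ℝ) : Prop :=
  ∃ σ : ℝ, riemannZeta (σ + T * Complex.I) = 0

open Classical in
/-- The function that agrees with `f` off the ordinates of the zeros of `ζ` and is
`(f(T+0) + f(T-0)) / 2` when `T` is such an ordinate. -/
def averageAtOrdinates (f : ℝ → ℝ) (T : ℝ) : ℝ :=
  if IsZetaOrdinate T then (Function.rightLim f T + Function.leftLim f T) / 2 else f T

/-- The iterated tail integrals of `log |ζ|` on the real axis:
`logZetaTail 0 σ = log |ζ(σ)|` and `logZetaTail (n+1) σ = ∫_σ^∞ logZetaTail n u du`. -/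
def logZetaTail : ℕ → ℝ → ℝ
  | 0, σ => Real.log ‖riemannZeta (σ : ℂ)‖
  | n + 1, σ => ∫ u in Set.Ioi σ, logZetaTail n u

/-- The constants of integration, for `m ≥ 1`: for `m = 2k - 1` it is `(-1)^(k-1) / π` times the
`m`-fold integral of `log |ζ|` from `1/2`; for `m = 2k` it is `(-1)^(k-1) / ((2k)! 2^(2k))`.
In both cases `k - 1 = (m - 1) / 2`, rounded down. -/
def integrationConst (m : ℕ) : ℝ :=
  if Odd m then 1 / Real.pi * (-1) ^ ((m - 1) / 2) * logZetaTail m (1 / 2)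
  else (-1) ^ ((m - 1) / 2) / ((m.factorial : ℝ) * 2 ^ m)

/-- `zetaS 0 = S` is the argument function of `ζ` and
`zetaS m = S_m` is its `m`-fold repeated integral. -/
def zetaS : ℕ → ℝ → ℝ
  | 0 => averageAtOrdinates fun T => 1 / Real.pi * argZeta T
  | m + 1 => averageAtOrdinates fun T =>
      (∫ t in (0 : ℝ)..T, zetaS m t) + integrationConst (m + 1)

/-- The number `(1/e)(1 + 1/e)`. -/
def kappa : ℝ := 1 / Real.exp 1 * (1 + 1 / Real.exp 1)

end

/-! Let F_0 = log ζ to the right of the critical line, where the Riemann hypothesis makes it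
available, and let F_m(s) be its m-fold iterated integral along the horizontal ray going right from
s. By Cauchy's theorem a vertical increment of F_{m+1} is -i times the vertical integral of F_m
(`iterLogZeta_sub`), and the constants C_m are the values of π⁻¹ Im(i^m F_m) at 1/2, taken on the
upper edge of the cut (`tendsto_integrationConst`). Hence π S_m(t) is the limit of Im(i^m F_m(σ +
it)) as σ → 1/2+ (`isBoundaryValue`): up to sign, the real part of F_m for odd m and the imaginary
part for even m. Integration by parts gives m! F_m(σ + it) = -∫_0^∞ a^m (ζ'/ζ)(σ + a + it) da
(`iterLogZeta_eq`), so it is enough to bound ζ'/ζ uniformly as σ → 1/2.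

That bound is obtained without a sum over zeros. Phragmén–Lindelöf gives |ξ(s - a)| ≤ |ξ(s + a)|
(`norm_xi_sub_le_norm_xi_add`), hence Re ξ'/ξ ≥ 0 (`re_xiLogDeriv_nonneg`), and Re ξ'/ξ is the
Poisson integral of its values on a vertical line. A contour integral of ζ'/ζ against `smoothKernel`
reproduces ζ'/ζ(σ₀ + a + it). On the left line ζ'/ζ may be replaced by twice its real part, and that
by 2 Re ξ'/ξ up to a slowly varying archimedean term. Positivity then yields |ζ'/ζ| ≤ (e^{-aℓ} +
e^{-2aℓ})/(aℓ) · Re ξ'/ξ + error at that point (`norm_logDeriv_riemannZeta₁_le_of_re_xiLogDeriv`).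
Since Re ζ'/ζ = Re ξ'/ξ - (log t)/2 + O(1), and the weight is at most κ < 1 when aℓ ≥ 1, the
inequality bounds Re ξ'/ξ by about (log t)/(2(1 - κ)) for a ≥ δ = 1/ℓ. For a < δ, monotonicity of a
Re ξ'/ξ takes over. All this is collected in `exists_segmentBounds`, with ℓ = (1 - θ) log log t.

The integral over a is split at δ and slightly beyond 1/2. The far part gives an incomplete Gamma
integral, the tail is O(1), and the near part is treated through the real part when m is odd and
through the modulus when m is even (`exists_iterLogZeta_le`).

The far part of this argument produces the Gamma sum of index m - 1, strictly smaller than the sum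
of index m in the theorem. The difference pays for the powers of 1 - θ and for every lower order
term, so the final inequality holds for large t with error term zero. -/

namespace ZetaArg

section

open Complex MeasureTheory Filter Topology Set

/-! ### Growth of `(s - 1) ζ(s)` in the right half-plane -/

/-- The fractional part, cut off to `(1, ∞)`. -/
noncomputable def cutFract (x : ℝ) : ℂ := (Ioi (1 : ℝ)).indicator (fun x => ((Int.fract x : ℝ) : ℂ)) x

lemma norm_cutFract_le (x : ℝ) : ‖cutFract x‖ ≤ 1 := by
  unfold cutFract
  by_cases h : x ∈ Ioi (1 : ℝ)
  · rw [indicator_of_mem h, Complex.norm_real, Real.norm_eq_abs, abs_of_nonneg (Int.fract_nonneg x)]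
    exact (Int.fract_lt_one x).le
  · simp [indicator_of_notMem h]

lemma measurable_cutFract : Measurable cutFract := by
  unfold cutFract
  exact (Complex.measurable_ofReal.comp measurable_fract).indicator measurableSet_Ioi

lemma locallyIntegrableOn_cutFract : LocallyIntegrableOn cutFract (Ioi 0) := by
  apply LocallyIntegrable.locallyIntegrableOn
  refine (locallyIntegrable_const (1 : ℂ)).mono measurable_cutFract.aestronglyMeasurable ?_
  exact Eventually.of_forall fun x => by simpa using norm_cutFract_le x

lemma differentiableAt_mellin_cutFract {s : ℂ} (hs : 0 < s.re) :
    DifferentiableAt ℂ (fun s => mellin cutFract (-s)) s := by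
  have h : DifferentiableAt ℂ (mellin cutFract) (-s) := by
    refine mellin_differentiableAt_of_isBigO_rpow (a := 0) (b := -s.re - 1)
      locallyIntegrableOn_cutFract ?_ (by simpa using hs) ?_ (by simp)
    · refine Asymptotics.IsBigO.of_bound 1 (Eventually.of_forall fun x => ?_)
      simpa using norm_cutFract_le x
    · refine Asymptotics.IsBigO.of_bound 1 ?_
      have : Iio (1 : ℝ) ∈ 𝓝[>] (0 : ℝ) :=
        mem_nhdsWithin_of_mem_nhds (Iio_mem_nhds one_pos)
      filter_upwards [this] with x hx
      have : cutFract x = 0 := by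
        unfold cutFract; rw [indicator_of_notMem]; simpa using (le_of_lt hx)
      rw [this]; simp
  exact DifferentiableAt.comp (g := mellin cutFract) (f := fun s => -s) s h (by fun_prop)

lemma mellin_cutFract_neg (s : ℂ) :
    mellin cutFract (-s) = ∫ x in Ioi (1 : ℝ), (x : ℂ) ^ (-s - 1) * ((Int.fract x : ℝ) : ℂ) := by
  rw [mellin]
  have : ∀ x : ℝ, (x : ℂ) ^ (-s - 1) • cutFract x =
      (Ioi (1 : ℝ)).indicator (fun x : ℝ => (x : ℂ) ^ (-s - 1) * ((Int.fract x : ℝ) : ℂ)) x := by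
    intro x
    unfold cutFract
    by_cases h : x ∈ Ioi (1 : ℝ)
    · rw [indicator_of_mem h, indicator_of_mem h]; rfl
    · rw [indicator_of_notMem h, indicator_of_notMem h]; simp
  simp_rw [this]
  rw [setIntegral_indicator measurableSet_Ioi]
  congr 2
  ext x; simp

lemma norm_mellin_cutFract_le {s : ℂ} (hs : 0 < s.re) :
    ‖mellin cutFract (-s)‖ ≤ 1 / s.re := by
  rw [mellin_cutFract_neg]
  have hint : ∫ x in Ioi (1 : ℝ), x ^ (-s.re - 1) = 1 / s.re := by
    rw [integral_Ioi_rpow_of_lt (by linarith) one_pos]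
    simp
  rw [← hint]
  refine norm_integral_le_of_norm_le
    (integrableOn_Ioi_rpow_of_lt (by linarith) one_pos) ?_
  filter_upwards [ae_restrict_mem measurableSet_Ioi] with x hx
  have hx0 : 0 < x := lt_trans one_pos hx
  rw [norm_mul, Complex.norm_cpow_eq_rpow_re_of_pos hx0, Complex.norm_real, Real.norm_eq_abs,
    abs_of_nonneg (Int.fract_nonneg x)]
  simp only [sub_re, neg_re, one_re]
  exact mul_le_of_le_one_right (by positivity) (Int.fract_lt_one x).le

lemma riemannZeta₁_eq_mul {s : ℂ} (hs : s ≠ 1) : riemannZeta₁ s = (s - 1) * riemannZeta s := by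
  rw [riemannZeta_eq_inv_sub_mul hs, mul_inv_cancel_left₀ (sub_ne_zero.mpr hs)]

/-- Partial summation gives ζ(s) = s ∫_1^∞ ⌊t⌋ t^{-s-1} dt; writing ⌊t⌋ = t - {t} isolates the pole
from an integral that converges for Re s > 0. -/
lemma riemannZeta₁_eq_mellin_of_one_lt_re {s : ℂ} (hs : 1 < s.re) :
    riemannZeta₁ s = s - s * (s - 1) * mellin cutFract (-s) := by
  have hs1 : s ≠ 1 := by rintro rfl; simp at hs
  have hs0 : s - 1 ≠ 0 := sub_ne_zero.mpr hs1
  have h1 : LSeries 1 s = s * ∫ t in Ioi (1 : ℝ), (∑ k ∈ Finset.Icc 1 ⌊t⌋₊, (1 : ℕ → ℂ) k) *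
      (t : ℂ) ^ (-(s + 1)) := by
    refine LSeries_eq_mul_integral' 1 zero_le_one hs ?_
    refine Asymptotics.IsBigO.of_bound 1 (Eventually.of_forall fun n => ?_)
    simp
  have h2 : ∀ t ∈ Ioi (1 : ℝ), (∑ k ∈ Finset.Icc 1 ⌊t⌋₊, (1 : ℕ → ℂ) k) * (t : ℂ) ^ (-(s + 1)) =
      (t : ℂ) ^ (-s) - (t : ℂ) ^ (-s - 1) * ((Int.fract t : ℝ) : ℂ) := by
    intro t ht
    have ht0 : (0 : ℝ) < t := lt_trans one_pos ht
    have htc : (t : ℂ) ≠ 0 := by exact_mod_cast ht0.ne'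
    have hfl : ((⌊t⌋₊ : ℕ) : ℂ) = (t : ℂ) - ((Int.fract t : ℝ) : ℂ) := by
      have : ((⌊t⌋₊ : ℕ) : ℝ) = t - Int.fract t := by
        rw [natCast_floor_eq_intCast_floor ht0.le, ← Int.self_sub_floor]; ring
      exact_mod_cast congrArg (Complex.ofReal) this
    have hsum : (∑ k ∈ Finset.Icc 1 ⌊t⌋₊, (1 : ℕ → ℂ) k) = ((⌊t⌋₊ : ℕ) : ℂ) := by simp
    have hpow : (t : ℂ) ^ (-s) = t * (t : ℂ) ^ (-s - 1) := by
      rw [Complex.cpow_sub _ _ htc, Complex.cpow_one]; field_simp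
    rw [hsum, hfl, hpow, show -(s + 1) = -s - 1 by ring]; ring
  have hi1 : IntegrableOn (fun t : ℝ => (t : ℂ) ^ (-s)) (Ioi 1) :=
    integrableOn_Ioi_cpow_of_lt (by simpa using hs) one_pos
  have hi2 : IntegrableOn (fun t : ℝ => (t : ℂ) ^ (-s - 1) * ((Int.fract t : ℝ) : ℂ)) (Ioi 1) := by
    have : IntegrableOn (fun t : ℝ => (t : ℂ) ^ (-s - 1)) (Ioi 1) :=
      integrableOn_Ioi_cpow_of_lt (by simp; linarith) one_pos
    refine this.mul_bdd (c := 1)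
      (Complex.measurable_ofReal.comp measurable_fract).aestronglyMeasurable ?_
    refine Eventually.of_forall fun x => ?_
    rw [Complex.norm_real, Real.norm_eq_abs, abs_of_nonneg (Int.fract_nonneg x)]
    exact (Int.fract_lt_one x).le
  rw [setIntegral_congr_fun measurableSet_Ioi h2, integral_sub hi1 hi2, ← mellin_cutFract_neg,
    integral_Ioi_cpow_of_lt (by simpa using hs) one_pos, LSeries_one_eq_riemannZeta hs] at h1
  rw [riemannZeta₁_eq_mul hs1, h1]
  have : -s + 1 ≠ 0 := by intro h; apply hs0; linear_combination -h
  simp only [ofReal_one, one_cpow]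
  field_simp
  ring

lemma isPreconnected_re_gt (c : ℝ) : IsPreconnected {s : ℂ | c < s.re} :=
  (convex_halfSpace_re_gt c).isPreconnected

lemma isOpen_re_gt (c : ℝ) : IsOpen {s : ℂ | c < s.re} := isOpen_lt continuous_const continuous_re

lemma riemannZeta₁_eq_mellin {s : ℂ} (hs : 0 < s.re) :
    riemannZeta₁ s = s - s * (s - 1) * mellin cutFract (-s) := by
  have hopen := isOpen_re_gt 0
  have h1 : AnalyticOnNhd ℂ riemannZeta₁ {s | 0 < s.re} :=
    differentiable_riemannZeta₁.differentiableOn.analyticOnNhd hopen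
  have h2 : AnalyticOnNhd ℂ (fun s : ℂ => s - s * (s - 1) * mellin cutFract (-s))
      {s | 0 < s.re} := by
    refine DifferentiableOn.analyticOnNhd (fun s hs => ?_) hopen
    have := differentiableAt_mellin_cutFract hs
    exact DifferentiableAt.differentiableWithinAt (by fun_prop)
  refine h1.eqOn_of_preconnected_of_eventuallyEq h2 (isPreconnected_re_gt 0) (z₀ := 2)
    (by simp) ?_ hs
  filter_upwards [(isOpen_re_gt 1).mem_nhds (show (2 : ℂ) ∈ {s : ℂ | 1 < s.re} by simp)] with z hz
  exact riemannZeta₁_eq_mellin_of_one_lt_re hz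

/-- The half-plane reaches left of the critical line because ξ(s - a) is later needed at points with
real part below 1/2. -/
lemma norm_riemannZeta₁_le {s : ℂ} (hs : 1 / 4 ≤ s.re) :
    ‖riemannZeta₁ s‖ ≤ 9 * (1 + ‖s‖) ^ 2 := by
  have hs0 : 0 < s.re := by linarith
  rw [riemannZeta₁_eq_mellin hs0]
  have h1 : ‖mellin cutFract (-s)‖ ≤ 4 := by
    refine (norm_mellin_cutFract_le hs0).trans ?_
    rw [div_le_iff₀ hs0]; linarith
  have h2 : ‖s - 1‖ ≤ 1 + ‖s‖ := by
    refine (norm_sub_le _ _).trans ?_; simp [add_comm]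
  calc ‖s - s * (s - 1) * mellin cutFract (-s)‖
      ≤ ‖s‖ + ‖s‖ * ‖s - 1‖ * ‖mellin cutFract (-s)‖ := by
        refine (norm_sub_le _ _).trans ?_; rw [norm_mul, norm_mul]
    _ ≤ ‖s‖ + ‖s‖ * (1 + ‖s‖) * 4 := by gcongr
    _ ≤ 9 * (1 + ‖s‖) ^ 2 := by nlinarith [norm_nonneg s]

/-! ### Continuous logarithms -/

/-- Two continuous logarithms of the same function on a preconnected set differ by a constant. -/
lemma sub_eq_sub_of_exp_eq {X : Type*} [TopologicalSpace X] {U : Set X} (hU : IsPreconnected U)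
    {f g : X → ℂ} (hf : ContinuousOn f U) (hg : ContinuousOn g U)
    (h : ∀ x ∈ U, exp (f x) = exp (g x)) {x y : X} (hx : x ∈ U) (hy : y ∈ U) :
    f x - g x = f y - g y := by
  have hk : ∀ x ∈ U, ∃ n : ℤ, f x - g x = n * (2 * Real.pi * I) := by
    intro x hx
    obtain ⟨n, hn⟩ := Complex.exp_eq_exp_iff_exists_int.mp (h x hx)
    exact ⟨n, by rw [hn]; ring⟩
  have hc : ContinuousOn (fun x => ((f x - g x) / (2 * Real.pi * I)).re) U :=
    continuous_re.comp_continuousOn ((hf.sub hg).div_const _)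
  have h2pi : (2 * Real.pi * I : ℂ) ≠ 0 := by simp [Real.pi_ne_zero]
  have hval : ∀ x ∈ U, ((f x - g x) / (2 * Real.pi * I)).re ∈ range ((↑) : ℤ → ℝ) := by
    intro x hx
    obtain ⟨n, hn⟩ := hk x hx
    exact ⟨n, by rw [hn, mul_div_cancel_right₀ _ h2pi]; simp⟩
  have hsub := hU.image _ hc
  have key : ((f x - g x) / (2 * Real.pi * I)).re = ((f y - g y) / (2 * Real.pi * I)).re := by
    have hd : IsTotallyDisconnected (range ((↑) : ℤ → ℝ)) :=
      (countable_range _).isTotallyDisconnected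
    exact hd _ (by rintro _ ⟨z, hz, rfl⟩; exact hval z hz) hsub ⟨x, hx, rfl⟩ ⟨y, hy, rfl⟩
  obtain ⟨n, hn⟩ := hk x hx
  obtain ⟨k, hk⟩ := hk y hy
  rw [hn, hk, mul_div_cancel_right₀ _ h2pi, mul_div_cancel_right₀ _ h2pi] at key
  simp only [intCast_re, Int.cast_inj] at key
  rw [hn, hk, key]

/-- A continuous logarithm of a differentiable function is differentiable. -/
lemma hasDerivAt_of_exp_eq {U : Set ℂ} (hU : IsOpen U) {f g : ℂ → ℂ} (hf : ContinuousOn f U)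
    (h : ∀ x ∈ U, exp (f x) = g x) {x : ℂ} (hx : x ∈ U) (hg : DifferentiableAt ℂ g x) :
    HasDerivAt f (deriv g x / g x) x := by
  have hfx : ContinuousAt f x := hf.continuousAt (hU.mem_nhds hx)
  have h0 : g x ≠ 0 := by rw [← h x hx]; exact exp_ne_zero _
  -- Near x, continuity confines f y - f x to the strip |Im| < π, where the principal logarithm
  -- inverts `exp`.
  have hev : f =ᶠ[𝓝 x] fun y => f x + Complex.log (g y / g x) := by
    have h1 : ∀ᶠ y in 𝓝 x, ‖f y - f x‖ < Real.pi := by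
      have : Tendsto (fun y => ‖f y - f x‖) (𝓝 x) (𝓝 0) := by
        have := (hfx.sub (continuousAt_const (y := f x))).norm
        simpa [ContinuousAt] using this
      exact this.eventually_lt_const Real.pi_pos
    filter_upwards [h1, hU.mem_nhds hx] with y hy hyU
    have him := (abs_im_le_norm (f y - f x)).trans_lt hy
    rw [abs_lt] at him
    rw [← h x hx, ← h y hyU, ← exp_sub, Complex.log_exp him.1 him.2.le]
    ring
  refine HasDerivAt.congr_of_eventuallyEq ?_ hev
  have h2 : HasDerivAt (fun y => g y / g x) (deriv g x / g x) x := hg.hasDerivAt.div_const _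
  have h3 := h2.clog (by rw [div_self h0]; exact one_mem_slitPlane)
  rw [div_self h0, div_one] at h3
  simpa using h3.const_add (f x)

lemma _root_.Convex.isSimplyConnected {E : Type*} [NormedAddCommGroup E] [NormedSpace ℝ E]
    {s : Set E} (hs : Convex ℝ s) (hne : s.Nonempty) : IsSimplyConnected s := by
  have := hs.contractibleSpace hne
  exact SimplyConnectedSpace.ofContractible s

/-! ### The logarithm of zeta to the right of the critical line -/

/-- The open half-plane to the right of the critical line. -/
def rightHalf : Set ℂ := {s | 1 / 2 < s.re}

lemma isOpen_rightHalf : IsOpen rightHalf := isOpen_re_gt _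

lemma convex_rightHalf : Convex ℝ rightHalf := convex_halfSpace_re_gt _

lemma riemannZeta₁_ne_zero (hRH : RiemannHypothesis) {s : ℂ} (hs : 1 / 2 < s.re) :
    riemannZeta₁ s ≠ 0 := by
  by_cases h1 : s = 1
  · simp [h1]
  rw [riemannZeta₁_eq_mul h1]
  refine mul_ne_zero (sub_ne_zero.mpr h1) fun h => ?_
  have := hRH s h (by
    rintro ⟨n, rfl⟩
    simp at hs
    have : (0 : ℝ) ≤ n := n.cast_nonneg
    linarith) h1
  linarith

/-- A logarithm of `(s - 1) ζ(s)` on `rightHalf`, real at `2`; it exists under the Riemann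
hypothesis. -/
noncomputable def logZetaOne : ℂ → ℂ :=
  Classical.epsilon fun g => ContinuousOn g rightHalf ∧
    (∀ s ∈ rightHalf, exp (g s) = riemannZeta₁ s) ∧ g 2 = Complex.log (riemannZeta₁ 2)

lemma logZetaOne_spec (hRH : RiemannHypothesis) :
    ContinuousOn logZetaOne rightHalf ∧
    (∀ s ∈ rightHalf, exp (logZetaOne s) = riemannZeta₁ s) ∧
      logZetaOne 2 = Complex.log (riemannZeta₁ 2) := by
  have h2 : (2 : ℂ) ∈ rightHalf := by simp only [rightHalf, mem_ofPred_eq, re_ofNat]; norm_num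
  apply Classical.epsilon_spec (p := fun g : ℂ → ℂ => ContinuousOn g rightHalf ∧
    (∀ s ∈ rightHalf, exp (g s) = riemannZeta₁ s) ∧ g 2 = Complex.log (riemannZeta₁ 2))
  obtain ⟨f, hf, hfe⟩ := exists_continuousOn_eqOn_exp_comp
    (convex_rightHalf.isSimplyConnected ⟨2, h2⟩) isOpen_rightHalf
    (differentiable_riemannZeta₁.continuous.continuousOn) (by
      rintro ⟨s, hs, h0⟩; exact riemannZeta₁_ne_zero hRH hs h0)
  refine ⟨fun s => f s - f 2 + Complex.log (riemannZeta₁ 2), ?_, ?_, by simp⟩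
  · exact (hf.sub continuousOn_const).add continuousOn_const
  · intro s hs
    rw [exp_add, exp_sub, exp_log (riemannZeta₁_ne_zero hRH h2)]
    have e1 : exp (f s) = riemannZeta₁ s := hfe hs
    have e2 : exp (f 2) = riemannZeta₁ 2 := hfe h2
    rw [e1, e2, div_mul_cancel₀ _ (riemannZeta₁_ne_zero hRH h2)]

lemma hasDerivAt_logZetaOne (hRH : RiemannHypothesis) {s : ℂ} (hs : 1 / 2 < s.re) :
    HasDerivAt logZetaOne (logDeriv riemannZeta₁ s) s :=
  hasDerivAt_of_exp_eq isOpen_rightHalf (logZetaOne_spec hRH).1 (logZetaOne_spec hRH).2.1 hs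
    differentiable_riemannZeta₁.differentiableAt

lemma differentiableAt_logDeriv_riemannZeta₁ (hRH : RiemannHypothesis) {s : ℂ}
    (hs : 1 / 2 < s.re) : DifferentiableAt ℂ (logDeriv riemannZeta₁) s := by
  unfold logDeriv
  refine DifferentiableAt.div ?_ differentiable_riemannZeta₁.differentiableAt
    (riemannZeta₁_ne_zero hRH hs)
  exact (differentiable_riemannZeta₁.analyticAt s).deriv.differentiableAt

/-- `log ζ(s)` to the right of the critical line, continued from above onto the cut `(1/2, 1)`. -/
noncomputable def logZeta (s : ℂ) : ℂ :=
  if 1 / 2 < s.re then logZetaOne s - Complex.log (s - 1) else 0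

lemma logZeta_eq {s : ℂ} (hs : 1 / 2 < s.re) :
    logZeta s = logZetaOne s - Complex.log (s - 1) := if_pos hs

lemma exp_logZeta (hRH : RiemannHypothesis) {s : ℂ} (hs : 1 / 2 < s.re) (h1 : s ≠ 1) :
    exp (logZeta s) = riemannZeta s := by
  rw [logZeta_eq hs, exp_sub, (logZetaOne_spec hRH).2.1 s hs, exp_log (sub_ne_zero.mpr h1),
    riemannZeta₁_eq_mul h1, mul_div_cancel_left₀ _ (sub_ne_zero.mpr h1)]

/-! ### Bounds far to the right -/

lemma summable_two_rpow_tail : Summable fun n : ℕ => 1 / ((n : ℝ) + 2) ^ 2 := by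
  have := (summable_nat_add_iff 2).mpr hasSum_zeta_two.summable
  simpa using this

/-- The value is π²/6 - 1 ≈ 0.645. Being below 1, it keeps ζ in the slit plane for Re s ≥ 2. -/
lemma tsum_two_rpow_tail_le : ∑' n : ℕ, 1 / ((n : ℝ) + 2) ^ 2 ≤ 0.66 := by
  have h := hasSum_zeta_two.summable.sum_add_tsum_nat_add 2
  rw [hasSum_zeta_two.tsum_eq] at h
  simp [Finset.sum_range_succ] at h
  have hpi : Real.pi ^ 2 ≤ 9.9225 := by nlinarith [Real.pi_lt_d2, Real.pi_pos]
  simp only [one_div]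
  linarith

lemma norm_riemannZeta_sub_one_le {s : ℂ} (hs : 2 ≤ s.re) :
    ‖riemannZeta s - 1‖ ≤ 0.66 * (4 * (2 : ℝ) ^ (-s.re)) := by
  have hsum : Summable fun n : ℕ => 1 / ((n : ℂ) + 1) ^ s := by
    have := (Complex.summable_one_div_nat_cpow (p := s)).mpr (by linarith)
    simpa using (summable_nat_add_iff 1).mpr this
  rw [zeta_eq_tsum_one_div_nat_add_one_cpow (by linarith), hsum.tsum_eq_zero_add]
  simp only [Nat.cast_zero, zero_add, one_cpow, div_one, add_sub_cancel_left]
  have hb : ∀ n : ℕ, ‖1 / (((n + 1 : ℕ) : ℂ) + 1) ^ s‖ ≤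
      (4 * (2 : ℝ) ^ (-s.re)) * (1 / ((n : ℝ) + 2) ^ 2) := by
    intro n
    have hpos : (0 : ℝ) < (n : ℝ) + 2 := by positivity
    have : (((n + 1 : ℕ) : ℂ) + 1) = (((n : ℝ) + 2 : ℝ) : ℂ) := by push_cast; ring
    rw [this, norm_div, norm_one, norm_cpow_eq_rpow_re_of_pos hpos]
    have h1 : ((n : ℝ) + 2) ^ s.re = ((n : ℝ) + 2) ^ 2 * ((n : ℝ) + 2) ^ (s.re - 2) := by
      rw [← Real.rpow_natCast, ← Real.rpow_add hpos]; norm_num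
    have h2 : (2 : ℝ) ^ (s.re - 2) ≤ ((n : ℝ) + 2) ^ (s.re - 2) :=
      Real.rpow_le_rpow (by norm_num) (by linarith [n.cast_nonneg (α := ℝ)]) (by linarith)
    have h3 : 4 * (2 : ℝ) ^ (-s.re) = 1 / (2 : ℝ) ^ (s.re - 2) := by
      rw [Real.rpow_sub two_pos, Real.rpow_neg two_pos.le]; norm_num; ring
    rw [h1, h3, div_mul_div_comm, mul_comm]
    simp only [one_mul]
    gcongr
  calc _ ≤ ∑' n : ℕ, (4 * (2 : ℝ) ^ (-s.re)) * (1 / ((n : ℝ) + 2) ^ 2) :=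
        tsum_of_norm_bounded (summable_two_rpow_tail.mul_left _).hasSum hb
    _ = (4 * (2 : ℝ) ^ (-s.re)) * ∑' n : ℕ, (1 / ((n : ℝ) + 2) ^ 2) := tsum_mul_left
    _ ≤ _ := by
      rw [mul_comm]; gcongr; exact tsum_two_rpow_tail_le

lemma four_mul_two_rpow_le_one {x : ℝ} (hx : 2 ≤ x) : 4 * (2 : ℝ) ^ (-x) ≤ 1 := by
  have : (2 : ℝ) ^ (-x) ≤ (2 : ℝ) ^ (-2 : ℝ) :=
    Real.rpow_le_rpow_of_exponent_le (by norm_num) (by linarith)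
  have h2 : (2 : ℝ) ^ (-2 : ℝ) = 1 / 4 := by
    rw [Real.rpow_neg two_pos.le]; norm_num
  rw [h2] at this
  linarith

lemma norm_riemannZeta_sub_one_le' {s : ℂ} (hs : 2 ≤ s.re) : ‖riemannZeta s - 1‖ ≤ 0.66 := by
  have := norm_riemannZeta_sub_one_le hs
  have := four_mul_two_rpow_le_one hs
  linarith

lemma riemannZeta_mem_slitPlane {s : ℂ} (hs : 2 ≤ s.re) : riemannZeta s ∈ slitPlane := by
  have h := norm_riemannZeta_sub_one_le' hs
  have := mem_slitPlane_of_norm_lt_one (z := riemannZeta s - 1) (by linarith)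
  simpa using this

lemma norm_log_riemannZeta_le {s : ℂ} (hs : 2 ≤ s.re) :
    ‖Complex.log (riemannZeta s)‖ ≤ 6 * (2 : ℝ) ^ (-s.re) := by
  have h1 := norm_riemannZeta_sub_one_le hs
  have h2 := norm_riemannZeta_sub_one_le' hs
  have h := norm_log_one_add_le (z := riemannZeta s - 1) (by linarith)
  rw [add_sub_cancel] at h
  set x := ‖riemannZeta s - 1‖ with hx
  have hx0 : 0 ≤ x := norm_nonneg _
  have h3 : (1 - x)⁻¹ ≤ 3 := by
    rw [inv_le_comm₀ (by linarith) (by norm_num)]; linarith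
  have h4 : x ^ 2 * (1 - x)⁻¹ / 2 ≤ x := by
    have : x ^ 2 * (1 - x)⁻¹ ≤ x ^ 2 * 3 := by gcongr
    nlinarith
  have : (0 : ℝ) < 2 ^ (-s.re) := by positivity
  linarith

lemma continuousOn_riemannZeta_re_ge : ContinuousOn riemannZeta {s : ℂ | 2 ≤ s.re} := by
  intro s hs
  refine (differentiableAt_riemannZeta ?_).continuousAt.continuousWithinAt
  rintro rfl
  have : (2 : ℝ) ≤ (1 : ℂ).re := hs
  norm_num at this

/-- Two continuous logarithms on the connected half-plane Re s ≥ 2 differ by a constant, which the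
normalisation at 2 makes zero. -/
lemma logZeta_eq_log (hRH : RiemannHypothesis) {s : ℂ} (hs : 2 ≤ s.re) :
    logZeta s = Complex.log (riemannZeta s) := by
  have hsub : ∀ z ∈ {z : ℂ | 2 ≤ z.re}, 1 / 2 < z.re := fun z hz => by
    have : (2 : ℝ) ≤ z.re := hz
    linarith
  have hne : ∀ z ∈ {z : ℂ | 2 ≤ z.re}, z ≠ 1 := by
    rintro z hz rfl
    have : (2 : ℝ) ≤ (1 : ℂ).re := hz
    norm_num at this
  have hzn : ∀ z ∈ {z : ℂ | 2 ≤ z.re}, riemannZeta z ≠ 0 := fun z hz =>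
    slitPlane_ne_zero (riemannZeta_mem_slitPlane hz)
  have hlogs : ∀ z ∈ {z : ℂ | 2 ≤ z.re}, z - 1 ∈ slitPlane := fun z hz => by
    left
    have : (2 : ℝ) ≤ z.re := hz
    simp; linarith
  have hpre : IsPreconnected {z : ℂ | 2 ≤ z.re} := (convex_halfSpace_re_ge 2).isPreconnected
  have h2 : (2 : ℂ) ∈ {z : ℂ | 2 ≤ z.re} := by simp
  have key := sub_eq_sub_of_exp_eq hpre (f := logZetaOne)
    (g := fun z => Complex.log (z - 1) + Complex.log (riemannZeta z))
    ((logZetaOne_spec hRH).1.mono hsub)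
    (((continuousOn_id.sub continuousOn_const).clog hlogs).add
      (continuousOn_riemannZeta_re_ge.clog fun z hz => riemannZeta_mem_slitPlane hz))
    (fun z hz => by
      rw [(logZetaOne_spec hRH).2.1 z (hsub z hz), exp_add, exp_log (hzn z hz),
        exp_log (sub_ne_zero.mpr (hne z hz)), riemannZeta₁_eq_mul (hne z hz)])
    (x := s) (y := 2) hs h2
  have e2 : logZetaOne 2 - (Complex.log (2 - 1) + Complex.log (riemannZeta 2)) = 0 := by
    rw [(logZetaOne_spec hRH).2.2, riemannZeta₁_eq_mul (hne 2 h2)]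
    norm_num
  rw [e2] at key
  rw [logZeta_eq (hsub s hs)]
  linear_combination key

lemma norm_logZeta_le (hRH : RiemannHypothesis) {s : ℂ} (hs : 2 ≤ s.re) :
    ‖logZeta s‖ ≤ 6 * (2 : ℝ) ^ (-s.re) := by
  rw [logZeta_eq_log hRH hs]; exact norm_log_riemannZeta_le hs

/-- The logarithmic derivative of zeta decays exponentially to the right of any vertical line
`Re s = σ > 1`. -/
lemma exists_norm_logDeriv_riemannZeta_le {σ₁ : ℝ} (h1 : 1 < σ₁) :
    ∃ C : ℝ, 0 < C ∧ ∀ s : ℂ, σ₁ ≤ s.re → ‖logDeriv riemannZeta s‖ ≤ C * (2 : ℝ) ^ (-s.re) := by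
  have hsum := ArithmeticFunction.LSeriesSummable_vonMangoldt (s := (σ₁ : ℂ)) (by simpa using h1)
  refine ⟨(2 : ℝ) ^ σ₁ * (∑' n, ‖LSeries.term (fun n => (ArithmeticFunction.vonMangoldt n : ℂ))
    σ₁ n‖ + 1), ?_, ?_⟩
  · have : 0 ≤ ∑' n, ‖LSeries.term (fun n => (ArithmeticFunction.vonMangoldt n : ℂ)) σ₁ n‖ :=
      tsum_nonneg fun _ => norm_nonneg _
    positivity
  intro s hs
  have hs1 : 1 < s.re := by linarith
  have e : logDeriv riemannZeta s =
      -LSeries (fun n => (ArithmeticFunction.vonMangoldt n : ℂ)) s := by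
    rw [ArithmeticFunction.LSeries_vonMangoldt_eq_deriv_riemannZeta_div hs1, logDeriv_apply]
    ring
  have hb : ∀ n, ‖LSeries.term (fun n => (ArithmeticFunction.vonMangoldt n : ℂ)) s n‖ ≤
      (2 : ℝ) ^ σ₁ * (2 : ℝ) ^ (-s.re) *
        ‖LSeries.term (fun n => (ArithmeticFunction.vonMangoldt n : ℂ)) σ₁ n‖ := by
    intro n
    rcases Nat.lt_or_ge n 2 with hn | hn
    · interval_cases n <;> simp [LSeries.term]
    · have hn0 : n ≠ 0 := by omega
      have hnpos : (0 : ℝ) < n := by positivity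
      have hn2 : (2 : ℝ) ≤ n := by exact_mod_cast hn
      rw [LSeries.norm_term_eq, LSeries.norm_term_eq, if_neg hn0, if_neg hn0]
      simp only [ofReal_re]
      have h3 : (n : ℝ) ^ s.re = (n : ℝ) ^ σ₁ * (n : ℝ) ^ (s.re - σ₁) := by
        rw [← Real.rpow_add hnpos]; ring_nf
      have h4 : (2 : ℝ) ^ (s.re - σ₁) ≤ (n : ℝ) ^ (s.re - σ₁) :=
        Real.rpow_le_rpow (by norm_num) hn2 (by linarith)
      have h5 : (2 : ℝ) ^ σ₁ * (2 : ℝ) ^ (-s.re) = 1 / (2 : ℝ) ^ (s.re - σ₁) := by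
        rw [one_div, ← Real.rpow_neg two_pos.le, ← Real.rpow_add two_pos]; ring_nf
      rw [h3, h5, div_mul_div_comm, one_mul, mul_comm ((n : ℝ) ^ σ₁)]
      gcongr
  rw [e, norm_neg]
  refine (tsum_of_norm_bounded (hsum.norm.mul_left _).hasSum hb).trans ?_
  rw [tsum_mul_left]
  have : (0 : ℝ) < 2 ^ (-s.re) := by positivity
  have : (0 : ℝ) < 2 ^ σ₁ := by positivity
  nlinarith [mul_pos ‹(0 : ℝ) < 2 ^ σ₁› ‹(0 : ℝ) < 2 ^ (-s.re)›]

lemma logDeriv_riemannZeta₁ {s : ℂ} (h1 : s ≠ 1) (h0 : riemannZeta s ≠ 0) :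
    logDeriv riemannZeta₁ s = logDeriv riemannZeta s + 1 / (s - 1) := by
  have hev : riemannZeta₁ =ᶠ[𝓝 s] fun z => (z - 1) * riemannZeta z := by
    filter_upwards [isOpen_ne.mem_nhds h1] with z hz using riemannZeta₁_eq_mul hz
  rw [logDeriv_apply, hev.deriv_eq, hev.self_of_nhds, ← logDeriv_apply,
    logDeriv_mul (f := fun z => z - 1) (g := riemannZeta) s (sub_ne_zero.mpr h1) h0 (by fun_prop) (differentiableAt_riemannZeta h1)]
  rw [logDeriv_apply (fun z => z - 1)]
  simp [add_comm]

/-! ### Growth in vertical strips -/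

/-- The size is chosen so that 3 · 1.6 exceeds 3/2 + π, the constant terms to be absorbed in
`norm_logZetaOne_two_add_le`. -/
lemma log_five_ge : 1.6 ≤ Real.log 5 := by
  rw [Real.le_log_iff_exp_le (by norm_num)]
  have : Real.exp 1.6 = Real.exp 1 * Real.exp 0.6 := by rw [← Real.exp_add]; norm_num
  have h1 := Real.exp_one_lt_d9
  have h2 : Real.exp 0.6 ≤ 1.83 := by
    have := Real.exp_bound' (x := 0.6) (by norm_num) (by norm_num) (n := 5) (by norm_num)
    refine this.trans ?_
    norm_num [Finset.sum_range_succ, Nat.factorial]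
  rw [this]
  nlinarith [Real.exp_pos 1, Real.exp_pos 0.6]

lemma log_five_le_log_abs (t : ℝ) : 1.6 ≤ Real.log (|t| + 5) :=
  log_five_ge.trans (Real.log_le_log (by norm_num) (by linarith [abs_nonneg t]))

lemma norm_log_le {z : ℂ} : ‖Complex.log z‖ ≤ |Real.log ‖z‖| + Real.pi := by
  refine (norm_le_abs_re_add_abs_im _).trans ?_
  rw [log_re, log_im]
  gcongr
  exact abs_arg_le_pi z

lemma norm_logZetaOne_two_add_le (hRH : RiemannHypothesis) (t : ℝ) :
    ‖logZetaOne (2 + t * I)‖ ≤ 4 * Real.log (|t| + 5) := by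
  have hre : (2 + t * I : ℂ).re = 2 := by simp
  have h1 := norm_logZeta_le hRH (s := 2 + t * I) (by rw [hre])
  have h2 := four_mul_two_rpow_le_one (x := (2 + t * I : ℂ).re) (by rw [hre])
  have e : logZetaOne (2 + t * I) = logZeta (2 + t * I) + Complex.log (2 + t * I - 1) := by
    rw [logZeta_eq (by rw [hre]; norm_num)]; ring
  have h3 := log_five_le_log_abs t
  have hge : 1 ≤ ‖(2 + t * I - 1 : ℂ)‖ := by
    have := abs_re_le_norm (2 + t * I - 1 : ℂ)
    simp at this
    norm_num at this
    exact this
  have hle : ‖(2 + t * I - 1 : ℂ)‖ ≤ |t| + 5 := by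
    have : (2 + t * I - 1 : ℂ) = 1 + t * I := by ring
    rw [this]
    refine (norm_add_le _ _).trans ?_
    simp; linarith
  have h4 : ‖Complex.log (2 + t * I - 1)‖ ≤ Real.log (|t| + 5) + Real.pi := by
    refine norm_log_le.trans ?_
    rw [abs_of_nonneg (Real.log_nonneg hge)]
    gcongr
  have := Real.pi_lt_d2
  rw [e]
  refine (norm_add_le _ _).trans ?_
  linarith

lemma re_logZetaOne (hRH : RiemannHypothesis) {s : ℂ} (hs : 1 / 2 < s.re) :
    (logZetaOne s).re = Real.log ‖riemannZeta₁ s‖ := by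
  rw [← (logZetaOne_spec hRH).2.1 s hs, norm_exp, Real.log_exp]

/-- Borel–Carathéodory on the disc of radius 3/2 about 2 + it, which is tangent to the critical
line: only an upper bound for the real part log |ζ₁| is needed, and polynomial growth supplies it.
The constant is 24 = 2·4·(3/2) + 4·3. -/
lemma norm_logZetaOne_le (hRH : RiemannHypothesis) {σ₀ : ℝ} (h0 : 1 / 2 < σ₀) (h1 : σ₀ ≤ 1)
    {s : ℂ} (hs : σ₀ ≤ s.re) (hs3 : s.re ≤ 3) :
    ‖logZetaOne s‖ ≤ 24 / (σ₀ - 1 / 2) * Real.log (|s.im| + 5) := by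
  set t := s.im with ht
  set c : ℂ := 2 + t * I with hc
  set x : ℝ := s.re - 2 with hx
  have hlog := log_five_le_log_abs t
  have hmem : ∀ z ∈ Metric.ball (0 : ℂ) (3 / 2), 1 / 2 < (c + z).re := by
    intro z hz
    have h2 : ‖z‖ < 3 / 2 := by simpa using hz
    have h3 := (abs_le.mp (abs_re_le_norm z)).1
    simp [hc]; linarith
  have hb := borelCaratheodory (f := fun z => logZetaOne (c + z)) (M := 4 * Real.log (|t| + 5))
    (R := 3 / 2) (z := x) (by linarith) (by
      intro z hz
      have : DifferentiableAt ℂ logZetaOne (c + z) :=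
        (hasDerivAt_logZetaOne hRH (hmem z hz)).differentiableAt
      exact (DifferentiableAt.comp z this (by fun_prop)).differentiableWithinAt)
    (by
      intro z hz
      have h2 : ‖z‖ < 3 / 2 := by simpa using hz
      have hz' := hmem z hz
      simp only [mem_ofPred_eq]
      rw [re_logZetaOne hRH hz']
      have h3 := norm_riemannZeta₁_le (s := c + z) (by linarith)
      have h4 : 1 + ‖c + z‖ ≤ |t| + 5 := by
        have : ‖c‖ ≤ 2 + |t| := by
          rw [hc]; refine (norm_add_le _ _).trans ?_; simp
        linarith [norm_add_le c z]
      have h5 : 0 < ‖riemannZeta₁ (c + z)‖ := norm_pos_iff.mpr (riemannZeta₁_ne_zero hRH hz')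
      have h6 : ‖riemannZeta₁ (c + z)‖ ≤ (|t| + 5) ^ 4 := by
        have h7 : (1 + ‖c + z‖) ^ 2 ≤ (|t| + 5) ^ 2 := by gcongr
        have h8 : 9 ≤ (|t| + 5) ^ 2 := by nlinarith [abs_nonneg t]
        calc _ ≤ 9 * (1 + ‖c + z‖) ^ 2 := h3
          _ ≤ (|t| + 5) ^ 2 * (|t| + 5) ^ 2 := by gcongr
          _ = _ := by ring
      calc Real.log ‖riemannZeta₁ (c + z)‖ ≤ Real.log ((|t| + 5) ^ 4) := Real.log_le_log h5 h6
        _ = 4 * Real.log (|t| + 5) := by rw [Real.log_pow]; norm_num)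
    (by norm_num) (by
      simp only [Metric.mem_ball, dist_zero_right, norm_real, Real.norm_eq_abs, abs_lt]
      constructor <;> linarith)
  have e : c + (x : ℂ) = s := by
    rw [hc, hx]; apply Complex.ext <;> simp [ht]
  simp only [e, add_zero, norm_real, Real.norm_eq_abs] at hb
  have hcb := norm_logZetaOne_two_add_le hRH t
  have hr : |x| ≤ 3 / 2 - (σ₀ - 1 / 2) := by
    rw [abs_le]; constructor <;> linarith
  have hpos : 0 < 3 / 2 - |x| := by linarith
  set Lg := Real.log (|t| + 5)
  calc ‖logZetaOne s‖ ≤ 2 * (4 * Lg) * |x| / (3 / 2 - |x|) + ‖logZetaOne c‖ * (3 / 2 + |x|) /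
        (3 / 2 - |x|) := hb
    _ ≤ 2 * (4 * Lg) * (3 / 2) / (3 / 2 - |x|) + (4 * Lg) * (3 / 2 + 3 / 2) / (3 / 2 - |x|) := by
        gcongr <;> linarith
    _ = 24 * Lg / (3 / 2 - |x|) := by ring
    _ ≤ 24 * Lg / (σ₀ - 1 / 2) := by
        have : 0 ≤ 24 * Lg := by linarith
        exact div_le_div_of_nonneg_left this (by linarith) (by linarith)
    _ = _ := by ring

/-- Cauchy's estimate for the logarithm on a circle whose radius is half the distance from σ₀ to the
critical line; for Re s ≥ 2 the Dirichlet series suffices. -/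
lemma exists_norm_logDeriv_riemannZeta₁_le (hRH : RiemannHypothesis) {σ₀ : ℝ} (h0 : 1 / 2 < σ₀) :
    ∃ C : ℝ, 0 < C ∧ ∀ s : ℂ, σ₀ ≤ s.re →
      ‖logDeriv riemannZeta₁ s‖ ≤ C * Real.log (|s.im| + 5) := by
  wlog h1 : σ₀ ≤ 1 generalizing σ₀
  · obtain ⟨C, hC, h⟩ := this (σ₀ := 1) (by norm_num) le_rfl
    exact ⟨C, hC, fun s hs => h s (by linarith)⟩
  obtain ⟨C₁, hC₁, hb₁⟩ := exists_norm_logDeriv_riemannZeta_le (σ₁ := 2) (by norm_num)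
  set ρ := (σ₀ - 1 / 2) / 2 with hρ
  have hρ0 : 0 < ρ := by rw [hρ]; linarith
  refine ⟨48 / ρ / ρ + (C₁ + 1), by positivity, fun s hs => ?_⟩
  have hlog := log_five_le_log_abs s.im
  rcases le_total s.re 2 with h2 | h2
  · have : ‖deriv logZetaOne s‖ ≤ (24 / (σ₀ - ρ - 1 / 2) * (2 * Real.log (|s.im| + 5))) / ρ := by
      refine norm_deriv_le_of_forall_mem_sphere_norm_le hρ0 ?_ fun z hz => ?_
      · refine DifferentiableOn.diffContOnCl fun z hz => ?_
        rw [closure_ball _ hρ0.ne'] at hz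
        have h3 : ‖z - s‖ ≤ ρ := by simpa [dist_eq_norm] using hz
        have h4 := (abs_le.mp ((abs_re_le_norm _).trans h3)).1
        simp only [sub_re] at h4
        exact (hasDerivAt_logZetaOne hRH (by linarith)).differentiableAt.differentiableWithinAt
      · have h3 : ‖z - s‖ = ρ := by simpa [dist_eq_norm] using hz
        have h4 := abs_le.mp ((abs_re_le_norm _).trans h3.le)
        have h5 := (abs_im_le_norm _).trans h3.le
        simp only [sub_re] at h4
        simp only [sub_im] at h5
        refine (norm_logZetaOne_le hRH (σ₀ := σ₀ - ρ) (by linarith) (by linarith)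
          (by linarith) (by linarith)).trans ?_
        have h6 : |z.im| ≤ |s.im| + 1 := by
          have := abs_sub_abs_le_abs_sub z.im s.im
          linarith
        have h7 : Real.log (|z.im| + 5) ≤ 2 * Real.log (|s.im| + 5) := by
          calc Real.log (|z.im| + 5) ≤ Real.log ((|s.im| + 5) ^ 2) := by
                apply Real.log_le_log (by positivity)
                nlinarith [abs_nonneg s.im]
            _ = _ := by rw [Real.log_pow]; norm_num
        have : 0 ≤ 24 / (σ₀ - ρ - 1 / 2) := div_nonneg (by norm_num) (by linarith)
        gcongr
    rw [(hasDerivAt_logZetaOne hRH (by linarith)).deriv] at this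
    refine this.trans ?_
    have e : σ₀ - ρ - 1 / 2 = ρ := by rw [hρ]; ring
    rw [e]
    have e2 : 24 / ρ * (2 * Real.log (|s.im| + 5)) / ρ = 48 / ρ / ρ * Real.log (|s.im| + 5) := by
      ring
    rw [e2]
    gcongr
    linarith
  · have hne : s ≠ 1 := by rintro rfl; norm_num at h2
    rw [logDeriv_riemannZeta₁ hne (slitPlane_ne_zero (riemannZeta_mem_slitPlane h2))]
    have h3 := hb₁ s h2
    have h4 := four_mul_two_rpow_le_one h2
    have h5 : ‖1 / (s - 1)‖ ≤ 1 := by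
      rw [norm_div, norm_one]
      have : 1 ≤ ‖s - 1‖ := by
        have := abs_re_le_norm (s - 1)
        simp only [sub_re, one_re] at this
        linarith [le_abs_self (s.re - 1)]
      exact div_le_one_of_le₀ this (by positivity)
    have h6 : ‖logDeriv riemannZeta s‖ ≤ C₁ := by
      have : (0 : ℝ) < 2 ^ (-s.re) := by positivity
      nlinarith
    have h7 : 0 < 48 / ρ / ρ := by positivity
    calc _ ≤ C₁ + 1 := (norm_add_le _ _).trans (by linarith)
      _ ≤ (48 / ρ / ρ + (C₁ + 1)) * 1 := by linarith
      _ ≤ _ := by gcongr; linarith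

/-! ### The digamma function in the right half-plane -/

/-- Since |s + j| ≥ Re s + j, the modulus is largest on the real axis, where log-convexity of Γ
bounds the Gauss product by Γ itself. This provides the domination in `tendsto_deriv_GammaSeq`. -/
lemma norm_GammaSeq_le {s : ℂ} (hs : 0 < s.re) {n : ℕ} (hn : n ≠ 0) :
    ‖GammaSeq s n‖ ≤ Real.Gamma s.re := by
  have h1 := Real.BohrMollerup.ge_logGammaSeq (f := Real.log ∘ Real.Gamma) (x := s.re) (n := n)
    Real.convexOn_log_Gamma (fun {y} hy => by
      simp only [Function.comp]
      rw [Real.Gamma_add_one hy.ne', Real.log_mul hy.ne' (Real.Gamma_pos_of_pos hy).ne', add_comm])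
    hs hn
  simp only [Function.comp, Real.Gamma_one, Real.log_one, zero_add] at h1
  have hn0 : (0 : ℝ) < n := by positivity
  have hprod : 0 < ∏ j ∈ Finset.range (n + 1), (s.re + (j : ℝ)) :=
    Finset.prod_pos fun j _ => by positivity
  have h2 : Real.exp (Real.BohrMollerup.logGammaSeq s.re n) =
      (n : ℝ) ^ s.re * n.factorial / ∏ j ∈ Finset.range (n + 1), (s.re + (j : ℝ)) := by
    rw [Real.BohrMollerup.logGammaSeq, ← Real.log_prod (fun j _ => by positivity), Real.exp_sub,
      Real.exp_add, Real.exp_log hprod, Real.exp_log (by positivity), mul_comm s.re,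
      Real.rpow_def_of_pos hn0]
  have h3 : ∏ j ∈ Finset.range (n + 1), (s.re + (j : ℝ)) ≤
      ∏ j ∈ Finset.range (n + 1), ‖s + (j : ℂ)‖ := by
    refine Finset.prod_le_prod (fun j _ => by positivity) fun j _ => ?_
    have := re_le_norm (s + (j : ℂ))
    simpa using this
  rw [GammaSeq, norm_div, norm_mul, norm_prod, norm_natCast_cpow_of_pos (Nat.pos_of_ne_zero hn)]
  calc _ ≤ (n : ℝ) ^ s.re * n.factorial / ∏ j ∈ Finset.range (n + 1), (s.re + (j : ℝ)) := by
        simp only [norm_natCast]; gcongr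
    _ = Real.exp (Real.BohrMollerup.logGammaSeq s.re n) := h2.symm
    _ ≤ Real.exp (Real.log (Real.Gamma s.re)) := Real.exp_le_exp.mpr h1
    _ = _ := Real.exp_log (Real.Gamma_pos_of_pos hs)

lemma natCast_add_ne_zero {z : ℂ} (hz : 0 < z.re) (j : ℕ) : z + j ≠ 0 := by
  intro h
  have := congrArg re h
  simp at this
  have : (0 : ℝ) ≤ j := j.cast_nonneg
  linarith

lemma differentiableAt_GammaSeq {z : ℂ} (hz : 0 < z.re) {n : ℕ} (hn : n ≠ 0) :
    DifferentiableAt ℂ (fun s => GammaSeq s n) z := by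
  unfold GammaSeq
  refine DifferentiableAt.div ?_ (by fun_prop) ?_
  · refine DifferentiableAt.mul_const ?_ _
    exact DifferentiableAt.const_cpow differentiableAt_id (Or.inl (by exact_mod_cast hn))
  · exact Finset.prod_ne_zero_iff.mpr fun j _ => natCast_add_ne_zero hz j

/-- Cauchy's formula for the derivative on a small circle, followed by dominated convergence. -/
lemma tendsto_deriv_GammaSeq {z : ℂ} (hz : 0 < z.re) :
    Tendsto (fun n : ℕ => deriv (fun s => GammaSeq s n) z) atTop (𝓝 (deriv Gamma z)) := by
  set r := z.re / 2 with hr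
  have hr0 : 0 < r := by positivity
  have hre : ∀ w ∈ Metric.closedBall z r, 0 < w.re := by
    intro w hw
    have h1 : ‖w - z‖ ≤ r := by simpa [dist_eq_norm] using hw
    have h2 := (abs_le.mp ((abs_re_le_norm _).trans h1)).1
    simp at h2; linarith
  have hcirc : ∀ θ, 0 < (circleMap z r θ).re := fun θ =>
    hre _ (Metric.sphere_subset_closedBall (circleMap_mem_sphere z hr0.le θ))
  have h2pi : (2 * Real.pi * I : ℂ) ≠ 0 := by simp [Real.pi_ne_zero]
  have hdG : deriv Gamma z =
      (2 * Real.pi * I : ℂ)⁻¹ • ∮ w in C(z, r), (1 / (w - z) ^ 2) • Gamma w := by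
    rw [eq_inv_smul_iff₀ h2pi]
    refine (DifferentiableOn.deriv_eq_smul_circleIntegral hr0 fun w hw => ?_).symm
    refine (differentiableAt_Gamma w fun m h => ?_).differentiableWithinAt
    have := hre w hw
    rw [h] at this
    simp at this
    have h0 : (0 : ℝ) ≤ m := m.cast_nonneg
    linarith
  have hdS : ∀ n : ℕ, n ≠ 0 → deriv (fun s => GammaSeq s n) z =
      (2 * Real.pi * I : ℂ)⁻¹ • ∮ w in C(z, r), (1 / (w - z) ^ 2) • GammaSeq w n := by
    intro n hn
    rw [eq_inv_smul_iff₀ h2pi]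
    refine (DifferentiableOn.deriv_eq_smul_circleIntegral hr0 fun w hw => ?_).symm
    exact (differentiableAt_GammaSeq (hre w hw) hn).differentiableWithinAt
  rw [hdG]
  refine Tendsto.congr' (f₁ := fun n : ℕ => (2 * Real.pi * I : ℂ)⁻¹ •
    ∮ w in C(z, r), (1 / (w - z) ^ 2) • GammaSeq w n) ?_ ?_
  · filter_upwards [eventually_ne_atTop 0] with n hn using (hdS n hn).symm
  refine Tendsto.const_smul ?_ _
  simp only [circleIntegral]
  have hne : ∀ θ : ℝ, circleMap z r θ - z ≠ 0 := fun θ => by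
    rw [circleMap_sub_center]; exact circleMap_ne_center hr0.ne'
  have hcont : Continuous fun θ : ℝ => Real.Gamma (circleMap z r θ).re := by
    refine continuous_iff_continuousAt.mpr fun θ => ?_
    have h1 : ContinuousAt Real.Gamma (circleMap z r θ).re :=
      (Real.differentiableAt_Gamma fun m h => by
        have := hcirc θ
        rw [h] at this
        have h0 : (0 : ℝ) ≤ m := m.cast_nonneg
        linarith).continuousAt
    exact ContinuousAt.comp (f := fun θ => (circleMap z r θ).re) h1
      (continuous_re.comp (continuous_circleMap z r)).continuousAt
  refine intervalIntegral.tendsto_integral_filter_of_dominated_convergence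
    (fun θ => ‖deriv (circleMap z r) θ‖ * (‖(1 / (circleMap z r θ - z) ^ 2)‖ *
      Real.Gamma (circleMap z r θ).re)) ?_ ?_ ?_ ?_
  · filter_upwards [eventually_ne_atTop 0] with n hn
    refine Continuous.aestronglyMeasurable ?_
    have h1 : Continuous fun θ : ℝ => GammaSeq (circleMap z r θ) n :=
      continuous_iff_continuousAt.mpr fun θ =>
        ContinuousAt.comp (f := circleMap z r) (g := fun s => GammaSeq s n)
          (differentiableAt_GammaSeq (hcirc θ) hn).continuousAt (continuous_circleMap z r).continuousAt
    have h2 : Continuous fun θ : ℝ => (1 / (circleMap z r θ - z) ^ 2) :=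
      continuous_const.div (((continuous_circleMap z r).sub continuous_const).pow 2)
        fun θ => pow_ne_zero 2 (hne θ)
    simp only [deriv_circleMap]
    exact ((continuous_circleMap 0 r).mul continuous_const).smul (h2.smul h1)
  · filter_upwards [eventually_ne_atTop 0] with n hn
    refine Eventually.of_forall fun θ _ => ?_
    rw [norm_smul, norm_smul]
    gcongr
    exact norm_GammaSeq_le (hcirc θ) hn
  · refine Continuous.intervalIntegrable ?_ _ _
    have h2 : Continuous fun θ : ℝ => (1 / (circleMap z r θ - z) ^ 2) :=
      continuous_const.div (((continuous_circleMap z r).sub continuous_const).pow 2)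
        fun θ => pow_ne_zero 2 (hne θ)
    simp only [deriv_circleMap]
    exact ((continuous_circleMap 0 r).mul continuous_const).norm.mul (h2.norm.mul hcont)
  · refine Eventually.of_forall fun θ _ => ?_
    exact ((GammaSeq_tendsto_Gamma _).const_smul _).const_smul _

lemma logDeriv_GammaSeq {z : ℂ} (hz : 0 < z.re) {n : ℕ} (hn : n ≠ 0) :
    logDeriv (fun s => GammaSeq s n) z =
      Real.log n - ∑ j ∈ Finset.range (n + 1), 1 / (z + j) := by
  have hn' : (n : ℂ) ≠ 0 := by exact_mod_cast hn
  unfold GammaSeq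
  have hd : DifferentiableAt ℂ (fun s : ℂ => (n : ℂ) ^ s) z :=
    DifferentiableAt.const_cpow differentiableAt_id (Or.inl hn')
  have hp : ∏ j ∈ Finset.range (n + 1), (z + (j : ℂ)) ≠ 0 :=
    Finset.prod_ne_zero_iff.mpr fun j _ => natCast_add_ne_zero hz j
  have hc0 : (n : ℂ) ^ z ≠ 0 := by simp [cpow_eq_zero_iff, hn']
  rw [logDeriv_div z (f := fun s : ℂ => (n : ℂ) ^ s * (n.factorial : ℂ))
    (g := fun s => ∏ j ∈ Finset.range (n + 1), (s + (j : ℂ)))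
    (mul_ne_zero hc0 (by exact_mod_cast n.factorial_ne_zero)) hp (hd.mul_const _) (by fun_prop),
    logDeriv_mul_const z _ (by exact_mod_cast n.factorial_ne_zero)]
  congr 1
  · rw [logDeriv_apply]
    have : HasDerivAt (fun s : ℂ => (n : ℂ) ^ s) ((n : ℂ) ^ z * Complex.log n * 1) z :=
      (hasDerivAt_id z).const_cpow (Or.inl hn')
    rw [this.deriv, mul_one, mul_div_cancel_left₀ _ hc0, ← natCast_log]
  · rw [logDeriv_prod (fun j _ => natCast_add_ne_zero hz j) (fun j _ => by fun_prop)]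
    refine Finset.sum_congr rfl fun j _ => ?_
    rw [logDeriv_apply]
    simp

lemma tendsto_digamma {z : ℂ} (hz : 0 < z.re) :
    Tendsto (fun n : ℕ => (Real.log n : ℂ) - ∑ j ∈ Finset.range (n + 1), 1 / (z + j)) atTop
      (𝓝 (digamma z)) := by
  have h0 : Gamma z ≠ 0 := Gamma_ne_zero_of_re_pos hz
  have h1 := (tendsto_deriv_GammaSeq hz).div (GammaSeq_tendsto_Gamma z) h0
  rw [digamma_def, logDeriv_apply]
  refine h1.congr' ?_
  filter_upwards [eventually_ne_atTop 0] with n hn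
  rw [← logDeriv_GammaSeq hz hn, logDeriv_apply]
  rfl

/-- Mean value inequality for log(w + x) - x/w on [0, 1]: its derivative is -x/(w(w + x)), and |w +
x| ≥ |w| because Re w > 0. -/
lemma norm_log_add_one_sub_le {w : ℂ} (hw : 0 < w.re) :
    ‖Complex.log (w + 1) - Complex.log w - 1 / w‖ ≤ 1 / ‖w‖ ^ 2 := by
  have hw0 : w ≠ 0 := by rintro rfl; simp at hw
  have hderiv : ∀ x ∈ Icc (0 : ℝ) 1, HasDerivWithinAt
      (fun x : ℝ => Complex.log (w + x) - x / w) (1 / (w + x) - 1 / w) (Icc 0 1) x := by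
    intro x hx
    have h1 : HasDerivAt (fun x : ℝ => w + (x : ℂ)) 1 x := by
      simpa using (ofRealCLM.hasDerivAt (x := x)).const_add w
    have h2 : HasDerivAt (fun x : ℝ => Complex.log (w + x)) (1 / (w + x)) x := by
      refine h1.clog_real (Or.inl ?_)
      simp; linarith [hx.1]
    have h3 : HasDerivAt (fun x : ℝ => (x : ℂ) / w) (1 / w) x := by
      simpa using (ofRealCLM.hasDerivAt (x := x)).div_const w
    exact (h2.sub h3).hasDerivWithinAt
  have := norm_image_sub_le_of_norm_deriv_le_segment_01' (C := 1 / ‖w‖ ^ 2) hderiv (by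
    intro x hx
    have hx0 : w + x ≠ 0 := by
      intro h
      have := congrArg re h
      simp at this; linarith [hx.1]
    have e : 1 / (w + x) - 1 / w = -(x / (w * (w + x))) := by field_simp; ring
    have hle : ‖w‖ ≤ ‖w + x‖ := by
      rw [← sq_le_sq₀ (norm_nonneg _) (norm_nonneg _), Complex.sq_norm, Complex.sq_norm, normSq_apply, normSq_apply]
      simp; nlinarith [hx.1]
    have hwp : 0 < ‖w‖ := norm_pos_iff.mpr hw0
    rw [e, norm_neg, norm_div, norm_mul, norm_real, Real.norm_eq_abs, abs_of_nonneg hx.1, sq]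
    gcongr
    exact hx.2.le)
  simp only [ofReal_one, ofReal_zero, add_zero, zero_div, sub_zero] at this
  rwa [sub_right_comm]

/-- As Re z > 0, |z + j|² ≥ |z|² + j² ≥ (|z| + j)²/2, and the resulting sum is majorised by a
telescoping one. -/
lemma sum_inv_norm_sq_le {z : ℂ} (hz : 0 < z.re) (h4 : 1 / 4 ≤ ‖z‖) (n : ℕ) :
    ∑ j ∈ Finset.range (n + 1), 1 / ‖z + j‖ ^ 2 ≤ 10 / ‖z‖ := by
  set r := ‖z‖ with hr
  have hr0 : 0 < r := by linarith
  have hb : ∀ j : ℕ, 1 / ‖z + j‖ ^ 2 ≤ 2 / (r + j) ^ 2 := by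
    intro j
    have hj : (0 : ℝ) ≤ j := j.cast_nonneg
    have h1 : (r + j) ^ 2 ≤ 2 * ‖z + j‖ ^ 2 := by
      have e1 : ‖z + j‖ ^ 2 = r ^ 2 + 2 * z.re * j + j ^ 2 := by
        rw [hr, Complex.sq_norm, Complex.sq_norm, normSq_apply, normSq_apply]; simp; ring
      rw [e1]; nlinarith [sq_nonneg (r - j), mul_nonneg hz.le hj]
    have hp : 0 < ‖z + j‖ ^ 2 := by
      have := norm_pos_iff.mpr (natCast_add_ne_zero hz j); positivity
    rw [div_le_div_iff₀ hp (by positivity)]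
    linarith
  have hs : ∀ n : ℕ, ∑ j ∈ Finset.range (n + 1), 2 / (r + j) ^ 2 ≤
      2 / r ^ 2 + 2 / r - 2 / (r + n) := by
    intro n
    induction n with
    | zero => simp
    | succ k ih =>
      rw [Finset.sum_range_succ]
      have hk : (0 : ℝ) ≤ k := k.cast_nonneg
      have h1 : 2 / (r + ((k + 1 : ℕ) : ℝ)) ^ 2 ≤ 2 / (r + k) - 2 / (r + ((k + 1 : ℕ) : ℝ)) := by
        push_cast
        rw [div_sub_div _ _ (by positivity) (by positivity), div_le_div_iff₀ (by positivity)
          (by positivity)]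
        have : 0 < r + k := by positivity
        nlinarith
      linarith
  calc _ ≤ ∑ j ∈ Finset.range (n + 1), 2 / (r + (j : ℝ)) ^ 2 := Finset.sum_le_sum fun j _ => hb j
    _ ≤ 2 / r ^ 2 + 2 / r - 2 / (r + n) := hs n
    _ ≤ 2 / r ^ 2 + 2 / r := by
        have : 0 ≤ 2 / (r + n) := by positivity
        linarith
    _ ≤ 10 / r := by
        rw [div_add_div _ _ (by positivity) (by positivity), div_le_div_iff₀ (by positivity) hr0]
        nlinarith [mul_pos hr0 hr0, mul_pos (mul_pos hr0 hr0) hr0]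

lemma norm_digamma_sub_log_le {z : ℂ} (hz : 0 < z.re) (h4 : 1 / 4 ≤ ‖z‖) :
    ‖digamma z - Complex.log z‖ ≤ 10 / ‖z‖ := by
  -- Adding this vanishing term replaces log n by log(z + n + 1), after which the partial sums
  -- telescope into differences of logarithms.
  have hlim : Tendsto (fun n : ℕ => Complex.log (1 + (z + 1) / n)) atTop (𝓝 0) := by
    have h1 : Tendsto (fun n : ℕ => 1 + (z + 1) / (n : ℂ)) atTop (𝓝 (1 + 0)) :=
      (tendsto_const_div_atTop_nhds_zero_nat (z + 1)).const_add 1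
    rw [add_zero] at h1
    have h2 := h1.clog one_mem_slitPlane
    rwa [log_one] at h2
  have h1 : Tendsto (fun n : ℕ => ‖((Real.log n : ℂ) - ∑ j ∈ Finset.range (n + 1), 1 / (z + j) -
      Complex.log z) + Complex.log (1 + (z + 1) / n)‖) atTop (𝓝 ‖digamma z - Complex.log z‖) := by
    have := (((tendsto_digamma hz).sub_const (Complex.log z)).add hlim).norm
    simpa using this
  refine le_of_tendsto h1 ?_
  filter_upwards [eventually_ne_atTop 0] with n hn
  have hn0 : (0 : ℝ) < n := by positivity
  have hnc : (n : ℂ) ≠ 0 := by exact_mod_cast hn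
  have e1 : Complex.log (z + (n + 1 : ℕ)) = Real.log n + Complex.log (1 + (z + 1) / n) := by
    have e2 : z + (n + 1 : ℕ) = ((n : ℝ) : ℂ) * (1 + (z + 1) / n) := by
      push_cast; field_simp; ring
    rw [e2, log_ofReal_mul hn0]
    intro h
    rw [h, mul_zero] at e2
    exact natCast_add_ne_zero hz _ e2
  have e3 : ((Real.log n : ℂ) - ∑ j ∈ Finset.range (n + 1), 1 / (z + j) -
      Complex.log z) + Complex.log (1 + (z + 1) / n) =
      ∑ j ∈ Finset.range (n + 1),
        (Complex.log (z + j + 1) - Complex.log (z + j) - 1 / (z + j)) := by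
    have tele := Finset.sum_range_sub (fun j : ℕ => Complex.log (z + j)) (n + 1)
    rw [Finset.sum_sub_distrib]
    have e4 : ∑ j ∈ Finset.range (n + 1), (Complex.log (z + j + 1) - Complex.log (z + j)) =
        Complex.log (z + (n + 1 : ℕ)) - Complex.log z := by
      rw [Nat.cast_zero, add_zero] at tele
      rw [← tele]
      refine Finset.sum_congr rfl fun j _ => ?_
      push_cast; simp [add_assoc]
    rw [e4, e1]; ring
  rw [e3]
  refine (norm_sum_le _ _).trans ((Finset.sum_le_sum fun j _ => ?_).trans
    (sum_inv_norm_sq_le hz h4 n))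
  exact norm_log_add_one_sub_le (by simp; positivity)

/-! ### The archimedean factor -/

/-- The logarithmic derivative of `s π^(-s/2) Γ(s/2)`. -/
noncomputable def archFactor (s : ℂ) : ℂ :=
  digamma (s / 2) / 2 - Real.log Real.pi / 2 + 1 / s

lemma norm_archFactor_sub_le {s : ℂ} (hs : 1 / 2 ≤ s.re) :
    ‖archFactor s - (Complex.log s / 2 - Real.log (2 * Real.pi) / 2)‖ ≤ 11 / ‖s‖ := by
  have hs0 : s ≠ 0 := by rintro rfl; norm_num at hs
  have hn : 1 / 2 ≤ ‖s‖ := hs.trans (re_le_norm s)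
  have hn2 : ‖s / 2‖ = ‖s‖ / 2 := by simp
  have h1 := norm_digamma_sub_log_le (z := s / 2) (by simp; linarith) (by rw [hn2]; linarith)
  have e1 : Complex.log (s / 2) = Complex.log s - Real.log 2 := by
    have : s / 2 = ((1 / 2 : ℝ) : ℂ) * s := by push_cast; ring
    rw [this, log_ofReal_mul (by norm_num) hs0, one_div, Real.log_inv]; push_cast; ring
  have e2 : archFactor s - (Complex.log s / 2 - Real.log (2 * Real.pi) / 2) =
      (digamma (s / 2) - Complex.log (s / 2)) / 2 + 1 / s := by
    rw [archFactor, e1, Real.log_mul two_ne_zero Real.pi_ne_zero]; push_cast; ring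
  rw [e2]
  refine (norm_add_le _ _).trans ?_
  rw [norm_div, norm_div, norm_one, Complex.norm_ofNat]
  rw [hn2] at h1
  have : 0 < ‖s‖ := by linarith
  calc _ ≤ 10 / (‖s‖ / 2) / 2 + 1 / ‖s‖ := by gcongr
    _ = 11 / ‖s‖ := by field_simp; norm_num

/-! ### Monotonicity of `|ξ|` to the right of the critical line -/

/-- The function `s (s - 1) π^(-s/2) Γ(s/2) ζ(s)`, for `Re s > 0`. -/
noncomputable def xi (s : ℂ) : ℂ := s * riemannZeta₁ s * Gammaℝ s

lemma Gammaℝ_ne_zero {s : ℂ} (hs : 0 < s.re) : Gammaℝ s ≠ 0 := Gammaℝ_ne_zero_of_re_pos hs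

lemma differentiableAt_Gammaℝ {s : ℂ} (hs : 0 < s.re) : DifferentiableAt ℂ Gammaℝ s := by
  unfold Gammaℝ
  have hpi : (Real.pi : ℂ) ≠ 0 := by exact_mod_cast Real.pi_ne_zero
  refine DifferentiableAt.mul ?_ ?_
  · exact DifferentiableAt.const_cpow (by fun_prop) (Or.inl hpi)
  · have : DifferentiableAt ℂ Gamma (s / 2) := differentiableAt_Gamma _ fun m h => by
      have := congrArg re h
      simp at this
      have h0 : (0 : ℝ) ≤ m := m.cast_nonneg
      linarith
    exact DifferentiableAt.comp s this (by fun_prop)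

lemma differentiableAt_xi {s : ℂ} (hs : 0 < s.re) : DifferentiableAt ℂ xi s := by
  unfold xi
  have h1 := differentiable_riemannZeta₁ s
  have h2 := differentiableAt_Gammaℝ hs
  fun_prop

lemma xi_ne_zero (hRH : RiemannHypothesis) {s : ℂ} (hs : 1 / 2 < s.re) : xi s ≠ 0 := by
  refine mul_ne_zero (mul_ne_zero ?_ (riemannZeta₁_ne_zero hRH hs)) (Gammaℝ_ne_zero (by linarith))
  rintro rfl; norm_num at hs

lemma xi_eq {s : ℂ} (hs : 0 < s.re) (h1 : s ≠ 1) :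
    xi s = s * (s - 1) * completedRiemannZeta s := by
  have h0 : s ≠ 0 := by rintro rfl; simp at hs
  have := Gammaℝ_ne_zero hs
  rw [xi, riemannZeta₁_eq_mul h1, riemannZeta_def_of_ne_zero h0]
  field_simp

lemma xi_one_sub {s : ℂ} (h0 : 0 < s.re) (h1 : s.re < 1) : xi (1 - s) = xi s := by
  have hs1 : s ≠ 1 := by rintro rfl; simp at h1
  have hs0 : (1 - s) ≠ 1 := by
    intro h
    have : s = 0 := by linear_combination -h
    rw [this] at h0; simp at h0
  rw [xi_eq (by simpa using h1) hs0, xi_eq h0 hs1, completedRiemannZeta_one_sub]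
  ring

lemma norm_xi_conj {s : ℂ} (h1 : s ≠ 1) : ‖xi (starRingEnd ℂ s)‖ = ‖xi s‖ := by
  have h1' : starRingEnd ℂ s ≠ 1 := by
    intro h; apply h1; simpa using congrArg (starRingEnd ℂ) h
  have hz : ‖riemannZeta₁ (starRingEnd ℂ s)‖ = ‖riemannZeta₁ s‖ := by
    rw [riemannZeta₁_eq_mul h1, riemannZeta₁_eq_mul h1', riemannZeta_conj, norm_mul, norm_mul,
      RCLike.norm_conj, ← RCLike.norm_conj (s - 1)]
    simp
  have hg : ‖Gammaℝ (starRingEnd ℂ s)‖ = ‖Gammaℝ s‖ := by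
    simp only [Gammaℝ_def, norm_mul]
    rw [norm_cpow_eq_rpow_re_of_pos Real.pi_pos, norm_cpow_eq_rpow_re_of_pos Real.pi_pos,
      show starRingEnd ℂ s / 2 = starRingEnd ℂ (s / 2) by
        rw [map_div₀, map_ofNat (starRingEnd ℂ) 2], Gamma_conj, RCLike.norm_conj]
    simp
  rw [xi, xi, norm_mul, norm_mul, norm_mul, norm_mul, hz, hg, RCLike.norm_conj]

/-- The functional equation combined with complex conjugation is the reflection in the critical
line, so |ξ| is symmetric about it. -/
lemma norm_xi_critical (a τ : ℝ) (ha : |a| < 1 / 2) :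
    ‖xi (1 / 2 + τ * I - a)‖ = ‖xi (1 / 2 + τ * I + a)‖ := by
  rw [abs_lt] at ha
  have e : (1 / 2 + τ * I - a : ℂ) = 1 - starRingEnd ℂ (1 / 2 + τ * I + a) := by
    apply Complex.ext <;> simp <;> ring
  rw [e, xi_one_sub (by simp; linarith) (by simp; linarith), norm_xi_conj]
  intro h
  have := congrArg re h
  simp at this; linarith

/-- A shift to the right cannot make the Gamma function much smaller. -/
lemma exists_norm_Gamma_le {c a : ℝ} (hc : 0 < c) (ha : 0 < a) :
    ∃ C : ℝ, 0 < C ∧ ∀ u : ℂ, c ≤ u.re → ‖Gamma u‖ ≤ C * ‖Gamma (u + a)‖ := by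
  -- B dominates |B(u, a)| for every Re u ≥ c, since x^{Re u - 1} ≤ x^{c - 1} on (0, 1]; then
  -- Γ(u)Γ(a) = Γ(u + a)B(u, a) gives the claim.
  set B : ℝ := ∫ x in (0 : ℝ)..1, ‖(x : ℂ) ^ ((c : ℂ) - 1) * (1 - (x : ℂ)) ^ ((a : ℂ) - 1)‖ with hB
  have hB0 : 0 ≤ B := intervalIntegral.integral_nonneg zero_le_one fun x _ => norm_nonneg _
  have hconv := (betaIntegral_convergent (u := (c : ℂ)) (v := (a : ℂ)) (by simpa) (by simpa)).norm
  have hGa : 0 < ‖Gamma (a : ℂ)‖ := norm_pos_iff.mpr (Gamma_ne_zero_of_re_pos (by simpa))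
  refine ⟨(B + 1) / ‖Gamma (a : ℂ)‖, by positivity, fun u hu => ?_⟩
  have h1 := Gamma_mul_Gamma_eq_betaIntegral (s := u) (t := (a : ℂ)) (by linarith) (by simpa)
  have h2 : ‖betaIntegral u a‖ ≤ B := by
    rw [betaIntegral]
    refine intervalIntegral.norm_integral_le_of_norm_le zero_le_one ?_ hconv
    refine Eventually.of_forall fun x hx => ?_
    rw [norm_mul, norm_mul]
    gcongr
    rw [norm_cpow_eq_rpow_re_of_pos hx.1, norm_cpow_eq_rpow_re_of_pos hx.1]
    exact Real.rpow_le_rpow_of_exponent_ge hx.1 hx.2 (by simpa using hu)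
  have h3 : ‖Gamma u‖ * ‖Gamma (a : ℂ)‖ ≤ ‖Gamma (u + a)‖ * B := by
    rw [← norm_mul, h1, norm_mul]; gcongr
  rw [div_mul_eq_mul_div, le_div_iff₀ hGa]
  nlinarith [norm_nonneg (Gamma (u + a))]

lemma exists_norm_Gammaℝ_le {a : ℝ} (ha : 0 < a) :
    ∃ C : ℝ, 0 < C ∧ ∀ s : ℂ, 1 / 4 ≤ s.re → ‖Gammaℝ s‖ ≤ C * ‖Gammaℝ (s + 2 * a)‖ := by
  obtain ⟨C, hC, h⟩ := exists_norm_Gamma_le (c := 1 / 8) (by norm_num) ha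
  refine ⟨C * Real.pi ^ a, by have := Real.pi_pos; positivity, fun s hs => ?_⟩
  have h1 := h (s / 2) (by simp; linarith)
  have e : (s + 2 * a) / 2 = s / 2 + a := by ring
  simp only [Gammaℝ_def, norm_mul]
  rw [norm_cpow_eq_rpow_re_of_pos Real.pi_pos, norm_cpow_eq_rpow_re_of_pos Real.pi_pos, e]
  have e2 : Real.pi ^ (-s / 2).re = Real.pi ^ a * Real.pi ^ (-(s + 2 * a) / 2).re := by
    rw [← Real.rpow_add Real.pi_pos]; congr 1; simp; ring
  rw [e2]
  have : 0 < Real.pi ^ a * Real.pi ^ (-(s + 2 * a) / 2).re := by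
    have := Real.pi_pos; positivity
  calc _ ≤ Real.pi ^ a * Real.pi ^ (-(s + 2 * a) / 2).re * (C * ‖Gamma (s / 2 + a)‖) := by gcongr
    _ = _ := by ring

lemma inv_norm_riemannZeta₁_le_of_two_le {s : ℂ} (hs : 2 ≤ s.re) : ‖riemannZeta₁ s‖⁻¹ ≤ 3 := by
  have hne : s ≠ 1 := by rintro rfl; norm_num at hs
  have h1 := norm_riemannZeta_sub_one_le' hs
  have h2 : 0.34 ≤ ‖riemannZeta s‖ := by
    have := norm_sub_norm_le (1 : ℂ) (riemannZeta s)
    rw [norm_one, norm_sub_rev] at this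
    linarith
  have h3 : 1 ≤ ‖s - 1‖ := by
    have := re_le_norm (s - 1)
    simp only [sub_re, one_re] at this
    linarith
  rw [riemannZeta₁_eq_mul hne, norm_mul, inv_le_comm₀ (by positivity) (by norm_num)]
  nlinarith

/-- Deliberately crude: growth of exponential order one is all that Phragmén–Lindelöf in a
half-plane requires, any order below 2 being allowed. -/
lemma inv_norm_riemannZeta₁_le (hRH : RiemannHypothesis) {a : ℝ} (ha : 0 < a) (ha' : a ≤ 1 / 2)
    {s : ℂ} (hs : 1 / 2 + a ≤ s.re) :
    ‖riemannZeta₁ s‖⁻¹ ≤ 3 * Real.exp (24 / a * (‖s‖ + 4)) := by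
  have hexp : 1 ≤ Real.exp (24 / a * (‖s‖ + 4)) := Real.one_le_exp (by positivity)
  rcases le_total 2 s.re with h2 | h2
  · have := inv_norm_riemannZeta₁_le_of_two_le h2
    linarith
  · have h3 := norm_logZetaOne_le hRH (σ₀ := 1 / 2 + a) (by linarith) (by linarith) hs (by linarith)
    have hs' : s ∈ rightHalf := show 1 / 2 < s.re by linarith
    have h4 : Real.log (|s.im| + 5) ≤ ‖s‖ + 4 := by
      have := Real.log_le_sub_one_of_pos (show 0 < |s.im| + 5 by positivity)
      linarith [abs_im_le_norm s]
    have h5 : -(logZetaOne s).re ≤ 24 / a * (‖s‖ + 4) := by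
      calc _ ≤ ‖logZetaOne s‖ := (neg_le_abs _).trans (abs_re_le_norm _)
        _ ≤ 24 / (1 / 2 + a - 1 / 2) * Real.log (|s.im| + 5) := h3
        _ = 24 / a * Real.log (|s.im| + 5) := by ring_nf
        _ ≤ _ := by gcongr
    rw [← (logZetaOne_spec hRH).2.1 s hs', norm_exp, ← Real.exp_neg]
    have := Real.exp_le_exp.mpr h5
    linarith

/-- The quotient ξ(1/2 + z - a)/ξ(1/2 + z + a) is holomorphic for Re z ≥ 0 because RH keeps the
zeros out of the denominator. It is bounded by 1 on the imaginary axis by the reflection symmetry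
and bounded far out on the positive real axis, so Phragmén–Lindelöf gives the bound 1 throughout.
This replaces the product over zeros. -/
lemma norm_xi_sub_le_norm_xi_add (hRH : RiemannHypothesis) {a : ℝ} (ha : 0 < a) (ha' : a ≤ 1 / 8)
    {s : ℂ} (hs : 1 / 2 ≤ s.re) : ‖xi (s - a)‖ ≤ ‖xi (s + a)‖ := by
  obtain ⟨C, hC, hG⟩ := exists_norm_Gammaℝ_le ha
  set Q : ℂ → ℂ := fun z => xi (1 / 2 + z - a) / xi (1 / 2 + z + a) with hQ
  have hden : ∀ z : ℂ, 0 ≤ z.re → 1 / 2 < (1 / 2 + z + a : ℂ).re := fun z hz => by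
    simp; linarith
  have hnum : ∀ z : ℂ, 0 ≤ z.re → 1 / 4 < (1 / 2 + z - a : ℂ).re := fun z hz => by
    simp; norm_num; linarith
  have hdiff : ∀ z : ℂ, 0 ≤ z.re → DifferentiableAt ℂ Q z := by
    intro z hz
    refine DifferentiableAt.div ?_ ?_ (xi_ne_zero hRH (hden z hz))
    · exact DifferentiableAt.comp z (differentiableAt_xi (by linarith [hnum z hz])) (by fun_prop)
    · exact DifferentiableAt.comp z (differentiableAt_xi (by linarith [hden z hz])) (by fun_prop)
  -- the factorwise estimate
  have hbound : ∀ z : ℂ, 0 ≤ z.re → ‖Q z‖ ≤ C * (‖riemannZeta₁ (1 / 2 + z - a)‖ *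
      ‖riemannZeta₁ (1 / 2 + z + a)‖⁻¹) := by
    intro z hz
    have h1 := hG (1 / 2 + z - a) (hnum z hz).le
    rw [show (1 / 2 + z - a + 2 * a : ℂ) = 1 / 2 + z + a by ring] at h1
    have h2 : ‖(1 / 2 + z - a : ℂ)‖ ≤ ‖(1 / 2 + z + a : ℂ)‖ := by
      rw [← sq_le_sq₀ (norm_nonneg _) (norm_nonneg _), Complex.sq_norm, Complex.sq_norm,
        normSq_apply, normSq_apply]
      simp; nlinarith
    have hp1 : 0 < ‖(1 / 2 + z + a : ℂ)‖ := by
      linarith [re_le_norm (1 / 2 + z + a : ℂ), hden z hz]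
    have hp2 : 0 < ‖riemannZeta₁ (1 / 2 + z + a)‖ :=
      norm_pos_iff.mpr (riemannZeta₁_ne_zero hRH (hden z hz))
    have hp3 : 0 < ‖Gammaℝ (1 / 2 + z + a)‖ :=
      norm_pos_iff.mpr (Gammaℝ_ne_zero (by linarith [hden z hz]))
    rw [hQ]
    simp only [xi, norm_div, norm_mul]
    rw [div_le_iff₀ (by positivity)]
    calc _ ≤ ‖(1 / 2 + z + a : ℂ)‖ * ‖riemannZeta₁ (1 / 2 + z - a)‖ *
          (C * ‖Gammaℝ (1 / 2 + z + a)‖) := by gcongr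
      _ = _ := by
        linear_combination (-(‖(1 / 2 + z + a : ℂ)‖ * ‖riemannZeta₁ (1 / 2 + z - a)‖ *
          (C * ‖Gammaℝ (1 / 2 + z + a)‖))) * inv_mul_cancel₀ hp2.ne'
  have key := PhragmenLindelof.right_half_plane_of_bounded_on_real (f := Q) (C := 1)
    (z := s - 1 / 2) ?_ ?_ ?_ ?_ (by simp; linarith)
  · have e1 : (1 / 2 + (s - 1 / 2) - a : ℂ) = s - a := by ring
    have e2 : (1 / 2 + (s - 1 / 2) + a : ℂ) = s + a := by ring
    rw [hQ] at key
    simp only [e1, e2, norm_div] at key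
    rwa [div_le_one (norm_pos_iff.mpr (xi_ne_zero hRH (by simp; linarith)))] at key
  · refine DifferentiableOn.diffContOnCl fun z hz => ?_
    rw [closure_setOfPred_lt_re] at hz
    exact (hdiff z hz).differentiableWithinAt
  · refine ⟨1, by norm_num, 24 / a + 2, ?_⟩
    refine Asymptotics.IsBigO.of_bound (C * (9 * Real.exp 4 * (3 * Real.exp (24 / a * 5)))) ?_
    rw [eventually_inf_principal]
    refine Eventually.of_forall fun z hz => ?_
    have hz0 : 0 ≤ z.re := le_of_lt hz
    have h1 := norm_riemannZeta₁_le (s := 1 / 2 + z - a) (hnum z hz0).le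
    have h2 := inv_norm_riemannZeta₁_le hRH ha (by linarith) (s := 1 / 2 + z + a)
      (by simp; linarith)
    have hn1 : ‖(1 / 2 + z - a : ℂ)‖ ≤ ‖z‖ + 1 := by
      calc ‖(1 / 2 + z - a : ℂ)‖ = ‖z + ((1 / 2 - a : ℝ) : ℂ)‖ := by congr 1; push_cast; ring
        _ ≤ ‖z‖ + |1 / 2 - a| := by
          refine (norm_add_le _ _).trans ?_; rw [norm_real, Real.norm_eq_abs]
        _ ≤ _ := by gcongr; rw [abs_le]; constructor <;> linarith
    have hn2 : ‖(1 / 2 + z + a : ℂ)‖ ≤ ‖z‖ + 1 := by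
      calc ‖(1 / 2 + z + a : ℂ)‖ = ‖z + ((1 / 2 + a : ℝ) : ℂ)‖ := by congr 1; push_cast; ring
        _ ≤ ‖z‖ + |1 / 2 + a| := by
          refine (norm_add_le _ _).trans ?_; rw [norm_real, Real.norm_eq_abs]
        _ ≤ _ := by gcongr; rw [abs_le]; constructor <;> linarith
    have h3 : (1 + ‖(1 / 2 + z - a : ℂ)‖) ^ 2 ≤ Real.exp 4 * Real.exp (2 * ‖z‖) := by
      have : 1 + ‖(1 / 2 + z - a : ℂ)‖ ≤ Real.exp (‖z‖ + 2) := by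
        linarith [Real.add_one_le_exp (‖z‖ + 2)]
      calc _ ≤ (Real.exp (‖z‖ + 2)) ^ 2 := by gcongr
        _ = _ := by rw [← Real.exp_nat_mul, ← Real.exp_add]; congr 1; push_cast; ring
    have h4 : Real.exp (24 / a * (‖(1 / 2 + z + a : ℂ)‖ + 4)) ≤
        Real.exp (24 / a * 5) * Real.exp (24 / a * ‖z‖) := by
      rw [← Real.exp_add, ← mul_add]
      have : ‖(1 / 2 + z + a : ℂ)‖ + 4 ≤ 5 + ‖z‖ := by linarith
      exact Real.exp_le_exp.mpr (mul_le_mul_of_nonneg_left this (by positivity))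
    calc ‖Q z‖ ≤ C * (‖riemannZeta₁ (1 / 2 + z - a)‖ * ‖riemannZeta₁ (1 / 2 + z + a)‖⁻¹) :=
          hbound z hz0
      _ ≤ C * ((9 * (Real.exp 4 * Real.exp (2 * ‖z‖))) *
          (3 * (Real.exp (24 / a * 5) * Real.exp (24 / a * ‖z‖)))) := by
          gcongr
          · exact h1.trans (by gcongr)
          · exact h2.trans (by gcongr)
      _ = C * (9 * Real.exp 4 * (3 * Real.exp (24 / a * 5))) *
          ‖Real.exp ((24 / a + 2) * ‖z‖ ^ (1 : ℝ))‖ := by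
          rw [Real.norm_eq_abs, abs_of_pos (Real.exp_pos _), Real.rpow_one, add_mul, Real.exp_add]
          ring
  -- Far out on the real axis both zeta values lie within 0.66 of 1, hence the factors 1.66 and 1/(1
  -- - 0.66) ≤ 3.
  · refine ⟨C * (1.66 * 3), ?_⟩
    rw [eventually_map]
    filter_upwards [eventually_ge_atTop 3] with x hx
    refine (hbound x (by simp; linarith)).trans ?_
    have hs1 : (2 : ℝ) ≤ (1 / 2 + (x : ℂ) - a).re := by simp; norm_num; linarith
    have hs2 : (2 : ℝ) ≤ (1 / 2 + (x : ℂ) + a).re := by simp; linarith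
    have hne1 : (1 / 2 + (x : ℂ) - a) ≠ 1 := by
      intro h; rw [h] at hs1; norm_num at hs1
    have hne2 : (1 / 2 + (x : ℂ) + a) ≠ 1 := by
      intro h; rw [h] at hs2; norm_num at hs2
    have h1 := norm_riemannZeta_sub_one_le' hs1
    have h2 := norm_riemannZeta_sub_one_le' hs2
    have h3 : ‖riemannZeta (1 / 2 + x - a)‖ ≤ 1.66 := by
      have := norm_sub_norm_le (riemannZeta (1 / 2 + x - a)) 1
      rw [norm_one] at this; linarith
    have h4 : ‖riemannZeta (1 / 2 + x + a)‖⁻¹ ≤ 3 := by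
      have := norm_sub_norm_le (1 : ℂ) (riemannZeta (1 / 2 + x + a))
      rw [norm_one, norm_sub_rev] at this
      rw [inv_le_comm₀ (by linarith) (by norm_num)]
      linarith
    have h5 : ‖(1 / 2 + (x : ℂ) - a - 1)‖ * ‖(1 / 2 + (x : ℂ) + a - 1)‖⁻¹ ≤ 1 := by
      have e1 : (1 / 2 + (x : ℂ) - a - 1) = ((x - a - 1 / 2 : ℝ) : ℂ) := by push_cast; ring
      have e2 : (1 / 2 + (x : ℂ) + a - 1) = ((x + a - 1 / 2 : ℝ) : ℂ) := by push_cast; ring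
      rw [e1, e2, norm_real, norm_real, Real.norm_eq_abs, Real.norm_eq_abs,
        abs_of_pos (by linarith), abs_of_pos (by linarith), ← div_eq_mul_inv,
        div_le_one (by linarith)]
      linarith
    rw [riemannZeta₁_eq_mul hne1, riemannZeta₁_eq_mul hne2, norm_mul, norm_mul, mul_inv]
    refine mul_le_mul_of_nonneg_left ?_ hC.le
    calc _ = (‖(1 / 2 + (x : ℂ) - a - 1)‖ * ‖(1 / 2 + (x : ℂ) + a - 1)‖⁻¹) *
          (‖riemannZeta (1 / 2 + x - a)‖ * ‖riemannZeta (1 / 2 + x + a)‖⁻¹) := by ring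
      _ ≤ 1 * (1.66 * 3) := by gcongr
      _ = _ := one_mul _
  · intro τ
    have h0 : 0 ≤ ((τ : ℂ) * I).re := by simp
    simp only [hQ, norm_div]
    rw [norm_xi_critical a τ (by rw [abs_lt]; constructor <;> linarith)]
    exact div_self_le_one _

/-- The logarithmic derivative of `ξ`. -/
noncomputable def xiLogDeriv (s : ℂ) : ℂ := logDeriv riemannZeta₁ s + archFactor s

lemma logDeriv_xi (hRH : RiemannHypothesis) {s : ℂ} (hs : 1 / 2 < s.re) :
    logDeriv xi s = xiLogDeriv s := by
  have hs0 : s ≠ 0 := by rintro rfl; norm_num at hs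
  have hpi : (Real.pi : ℂ) ≠ 0 := by exact_mod_cast Real.pi_ne_zero
  have hG0 := Gammaℝ_ne_zero (s := s) (by linarith)
  have hz0 := riemannZeta₁_ne_zero hRH hs
  have hdz := differentiable_riemannZeta₁ s
  have hGd : DifferentiableAt ℂ Gamma (s / 2) := differentiableAt_Gamma _ fun m h => by
    have := congrArg re h
    simp at this
    have h0 : (0 : ℝ) ≤ m := m.cast_nonneg
    linarith
  have hG : logDeriv Gammaℝ s = digamma (s / 2) / 2 - Real.log Real.pi / 2 := by
    have hp : HasDerivAt (fun s : ℂ => (Real.pi : ℂ) ^ (-s / 2))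
        ((Real.pi : ℂ) ^ (-s / 2) * Complex.log Real.pi * (-1 / 2)) s :=
      ((hasDerivAt_neg s).div_const 2).const_cpow (Or.inl hpi)
    have hg : HasDerivAt (fun s : ℂ => Gamma (s / 2)) (deriv Gamma (s / 2) * (1 / 2)) s :=
      HasDerivAt.comp s hGd.hasDerivAt ((hasDerivAt_id s).div_const 2)
    have hp0 : (Real.pi : ℂ) ^ (-s / 2) ≠ 0 := by simp [cpow_eq_zero_iff, hpi]
    have hg0 : Gamma (s / 2) ≠ 0 := Gamma_ne_zero_of_re_pos (by simp; linarith)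
    have := logDeriv_mul (f := fun s : ℂ => (Real.pi : ℂ) ^ (-s / 2))
      (g := fun s : ℂ => Gamma (s / 2)) s hp0 hg0 hp.differentiableAt hg.differentiableAt
    rw [show Gammaℝ = fun s : ℂ => (Real.pi : ℂ) ^ (-s / 2) * Gamma (s / 2) from
      funext Gammaℝ_def, this, logDeriv_apply, logDeriv_apply, hp.deriv, hg.deriv, digamma_def,
      logDeriv_apply, ofReal_log Real.pi_pos.le]
    field_simp
    ring
  have e1 := logDeriv_mul (f := fun s : ℂ => s * riemannZeta₁ s) (g := Gammaℝ) s
    (mul_ne_zero hs0 hz0) hG0 (by fun_prop) (differentiableAt_Gammaℝ (by linarith))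
  have e2 := logDeriv_mul (f := fun s : ℂ => s) (g := riemannZeta₁) s hs0 hz0 (by fun_prop) hdz
  rw [show xi = fun s => s * riemannZeta₁ s * Gammaℝ s from rfl, e1, e2, hG, xiLogDeriv, archFactor,
    logDeriv_apply (fun s : ℂ => s)]
  simp
  ring

/-- Under the Riemann hypothesis, `Re ξ'/ξ ≥ 0` to the right of the critical line. -/
lemma re_xiLogDeriv_nonneg (hRH : RiemannHypothesis) {s : ℂ} (hs : 1 / 2 < s.re) :
    0 ≤ (xiLogDeriv s).re := by
  have hd := (differentiableAt_xi (s := s) (by linarith)).hasDerivAt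
  have h0 := xi_ne_zero hRH hs
  have h1 : HasDerivAt (fun x : ℝ => xi (s + x)) (deriv xi s) 0 := by
    have h2 : HasDerivAt (fun x : ℝ => s + (x : ℂ)) 1 0 := by
      simpa using (ofRealCLM.hasDerivAt (x := (0 : ℝ))).const_add s
    have h3 : HasDerivAt xi (deriv xi s) ((fun x : ℝ => s + (x : ℂ)) 0) := by simpa using hd
    have h4 := HasDerivAt.comp (0 : ℝ) h3 h2
    rw [mul_one] at h4
    exact h4
  have h2 : HasDerivAt (fun x : ℝ => xi (s - x)) (-deriv xi s) 0 := by
    have h2 : HasDerivAt (fun x : ℝ => s - (x : ℂ)) (-1) 0 := by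
      simpa using (ofRealCLM.hasDerivAt (x := (0 : ℝ))).const_sub s
    have h3 : HasDerivAt xi (deriv xi s) ((fun x : ℝ => s - (x : ℂ)) 0) := by simpa using hd
    have h4 := HasDerivAt.comp (0 : ℝ) h3 h2
    rw [mul_neg_one] at h4
    exact h4
  have h3 := h1.norm_sq.sub h2.norm_sq
  simp only [ofReal_zero, add_zero, sub_zero, Complex.inner] at h3
  -- The function |ξ(s + x)|² - |ξ(s - x)|² vanishes at 0 and is nonnegative for small x > 0, so its
  -- derivative there, which is 4 Re(ξ' ξ̄), is nonnegative.
  have h4 : 0 ≤ 2 * (deriv xi s * starRingEnd ℂ (xi s)).re -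
      2 * (-deriv xi s * starRingEnd ℂ (xi s)).re := by
    refine ge_of_tendsto (h3.tendsto_slope_zero_right) ?_
    have : Ioo (0 : ℝ) (1 / 8) ∈ 𝓝[>] (0 : ℝ) := Ioo_mem_nhdsGT (by norm_num)
    filter_upwards [this] with x hx
    have h5 := norm_xi_sub_le_norm_xi_add hRH hx.1 hx.2.le (s := s) hs.le
    have h6 : ‖xi (s - x)‖ ^ 2 ≤ ‖xi (s + x)‖ ^ 2 := by gcongr
    have hx0 : 0 < x := hx.1
    simp only [Pi.sub_apply, zero_add, ofReal_zero, add_zero, sub_zero, sub_self, smul_eq_mul]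
    exact mul_nonneg (by positivity) (by linarith)
  rw [← logDeriv_xi hRH hs, logDeriv_apply]
  have h5 : 0 ≤ (deriv xi s * starRingEnd ℂ (xi s)).re := by
    rw [neg_mul, neg_re] at h4; linarith
  rw [div_eq_mul_inv, inv_def, ← mul_assoc, re_mul_ofReal]
  exact mul_nonneg h5 (inv_nonneg.mpr (normSq_nonneg _))

/-! ### Integrals along vertical lines -/

lemma sqrt_div_sq_eq {x : ℝ} (hx : 0 < x) : √x / x ^ 2 = x ^ (-(3 / 2) : ℝ) := by
  rw [Real.sqrt_eq_rpow, ← Real.rpow_natCast x 2, ← Real.rpow_sub hx]; norm_num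

lemma integrable_of_decay {g : ℝ → ℂ} (hg : Continuous g) {C T : ℝ}
    (hb : ∀ τ, T ≤ |τ| → ‖g τ‖ ≤ C * |τ| ^ (-(3 / 2) : ℝ)) : Integrable g := by
  have hint : Integrable fun x : ℝ => (1 + ‖x‖) ^ (-(3 / 2) : ℝ) :=
    integrable_one_add_norm (by simp; norm_num)
  refine hg.locallyIntegrable.integrable_of_isBigO_cocompact
    (g := fun x : ℝ => (1 + ‖x‖) ^ (-(3 / 2) : ℝ)) ?_ (hint.integrableAtFilter _)
  refine Asymptotics.IsBigO.of_bound (|C| * 2 ^ (3 / 2 : ℝ)) ?_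
  filter_upwards [(tendsto_norm_cocompact_atTop (E := ℝ)).eventually_ge_atTop (max T 1)] with τ hτ
  have h1 : 1 ≤ |τ| := (le_max_right _ _).trans hτ
  refine (hb τ ((le_max_left _ _).trans hτ)).trans ?_
  have h2 : (2 * |τ|) ^ (-(3 / 2) : ℝ) ≤ (1 + |τ|) ^ (-(3 / 2) : ℝ) :=
    Real.rpow_le_rpow_of_nonpos (by linarith) (by linarith) (by norm_num)
  have h3 : |τ| ^ (-(3 / 2) : ℝ) = 2 ^ (3 / 2 : ℝ) * (2 * |τ|) ^ (-(3 / 2) : ℝ) := by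
    rw [Real.mul_rpow two_pos.le (abs_nonneg _), ← mul_assoc, ← Real.rpow_add two_pos]
    norm_num
  rw [h3, Real.norm_eq_abs, Real.norm_eq_abs, abs_of_nonneg (by positivity :
    (0 : ℝ) ≤ (1 + |τ|) ^ (-(3 / 2) : ℝ)), mul_assoc]
  gcongr
  exact le_abs_self C

lemma abs_im_le_norm_line (σ τ : ℝ) : |τ| ≤ ‖(σ + τ * I : ℂ)‖ := by
  simpa using abs_im_le_norm (σ + τ * I : ℂ)

lemma decay_of_norm_decay {G : ℂ → ℂ} {σ C T : ℝ} (hC : 0 ≤ C) (hT : 0 < T)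
    (hb : ∀ w : ℂ, w.re = σ → T ≤ ‖w‖ → ‖G w‖ ≤ C * ‖w‖ ^ (-(3 / 2) : ℝ)) (τ : ℝ) (hτ : T ≤ |τ|) :
    ‖G (σ + τ * I)‖ ≤ C * |τ| ^ (-(3 / 2) : ℝ) := by
  have h1 := abs_im_le_norm_line σ τ
  refine (hb _ (by simp) (hτ.trans h1)).trans ?_
  gcongr ?_ * ?_
  exact Real.rpow_le_rpow_of_nonpos (by linarith) h1 (by norm_num)

lemma continuous_line {G : ℂ → ℂ} {σ : ℝ} (hd : ∀ w : ℂ, w.re = σ → DifferentiableAt ℂ G w) :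
    Continuous fun τ : ℝ => G (σ + τ * I) := by
  refine continuous_iff_continuousAt.mpr fun τ => ?_
  exact ContinuousAt.comp (f := fun τ : ℝ => (σ + τ * I : ℂ)) (hd _ (by simp)).continuousAt
    (by fun_prop)

lemma integrable_line {G : ℂ → ℂ} {σ C T : ℝ} (hC : 0 ≤ C) (hT : 0 < T)
    (hd : ∀ w : ℂ, w.re = σ → DifferentiableAt ℂ G w)
    (hb : ∀ w : ℂ, w.re = σ → T ≤ ‖w‖ → ‖G w‖ ≤ C * ‖w‖ ^ (-(3 / 2) : ℝ)) :
    Integrable fun τ : ℝ => G (σ + τ * I) :=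
  integrable_of_decay (continuous_line hd) fun τ hτ => decay_of_norm_decay hC hT hb τ hτ

/-- Shifting a vertical line of integration. -/
lemma integral_line_eq {G : ℂ → ℂ} {σ₁ σ₂ C T : ℝ} (h12 : σ₁ ≤ σ₂) (hC : 0 ≤ C) (hT : 0 < T)
    (hd : ∀ w : ℂ, σ₁ ≤ w.re → w.re ≤ σ₂ → DifferentiableAt ℂ G w)
    (hb : ∀ w : ℂ, σ₁ ≤ w.re → w.re ≤ σ₂ → T ≤ ‖w‖ → ‖G w‖ ≤ C * ‖w‖ ^ (-(3 / 2) : ℝ)) :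
    ∫ τ : ℝ, G (σ₁ + τ * I) = ∫ τ : ℝ, G (σ₂ + τ * I) := by
  have hi1 : Integrable fun τ : ℝ => G (σ₁ + τ * I) :=
    integrable_line hC hT (fun w hw => hd w hw.ge (hw.le.trans h12))
      (fun w hw => hb w hw.ge (hw.le.trans h12))
  have hi2 : Integrable fun τ : ℝ => G (σ₂ + τ * I) :=
    integrable_line hC hT (fun w hw => hd w (h12.trans hw.ge) hw.le)
      (fun w hw => hb w (h12.trans hw.ge) hw.le)
  have hl1 := intervalIntegral_tendsto_integral hi1 tendsto_neg_atTop_atBot tendsto_id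
  have hl2 := intervalIntegral_tendsto_integral hi2 tendsto_neg_atTop_atBot tendsto_id
  have hrect : ∀ R : ℝ, (∫ τ in (-R)..R, G (σ₂ + τ * I)) - ∫ τ in (-R)..R, G (σ₁ + τ * I) =
      I * ((∫ x in σ₁..σ₂, G (x + (-R : ℝ) * I)) - ∫ x in σ₁..σ₂, G (x + R * I)) := by
    intro R
    have h := integral_boundary_rect_eq_zero_of_differentiableOn G (σ₁ + (-R : ℝ) * I)
      (σ₂ + R * I) (fun w hw => by
        have h1 := hw.1
        simp only [add_re, ofReal_re, mul_re, I_re, mul_zero, ofReal_im, I_im, mul_one, sub_self,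
          add_zero, mem_preimage, uIcc_of_le h12] at h1
        exact (hd w h1.1 h1.2).differentiableWithinAt)
    simp only [add_re, ofReal_re, mul_re, I_re, mul_zero, ofReal_im, I_im, mul_one, sub_self,
      add_zero, add_im, mul_im, zero_add, smul_eq_mul] at h
    have hI : I * I = -1 := I_mul_I
    linear_combination (-I) * h + ((∫ τ in (-R)..R, G (σ₂ + τ * I)) -
      ∫ τ in (-R)..R, G (σ₁ + τ * I)) * hI
  have hside : ∀ R : ℝ, T ≤ R → ‖(∫ x in σ₁..σ₂, G (x + (-R : ℝ) * I)) -
      ∫ x in σ₁..σ₂, G (x + R * I)‖ ≤ 2 * (C * |σ₂ - σ₁|) * R ^ (-(3 / 2) : ℝ) := by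
    intro R hR
    have hR0 : 0 < R := hT.trans_le hR
    have hone : ∀ R' : ℝ, |R'| = R → ‖∫ x in σ₁..σ₂, G (x + R' * I)‖ ≤
        C * R ^ (-(3 / 2) : ℝ) * |σ₂ - σ₁| := by
      intro R' hR'
      refine intervalIntegral.norm_integral_le_of_norm_le_const fun x hx => ?_
      rw [uIoc_of_le h12] at hx
      have h1 : R ≤ ‖(x + R' * I : ℂ)‖ := hR' ▸ abs_im_le_norm_line x R'
      refine (hb _ (by simpa using hx.1.le) (by simpa using hx.2) (hR.trans h1)).trans ?_
      gcongr ?_ * ?_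
      exact Real.rpow_le_rpow_of_nonpos hR0 h1 (by norm_num)
    refine (norm_sub_le _ _).trans ?_
    have h1 := hone (-R) (by rw [abs_neg, abs_of_pos hR0])
    have h2 := hone R (abs_of_pos hR0)
    linarith
  have hzero : Tendsto (fun R : ℝ => (∫ τ in (-R)..R, G (σ₂ + τ * I)) -
      ∫ τ in (-R)..R, G (σ₁ + τ * I)) atTop (𝓝 0) := by
    rw [tendsto_zero_iff_norm_tendsto_zero]
    have hlim : Tendsto (fun R : ℝ => 2 * (C * |σ₂ - σ₁|) * R ^ (-(3 / 2) : ℝ)) atTop (𝓝 0) := by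
      simpa using (tendsto_rpow_neg_atTop (by norm_num : (0 : ℝ) < 3 / 2)).const_mul
        (2 * (C * |σ₂ - σ₁|))
    refine squeeze_zero' (Eventually.of_forall fun _ => norm_nonneg _) ?_ hlim
    filter_upwards [eventually_ge_atTop T] with R hR
    rw [hrect R, norm_mul, norm_I, one_mul]
    exact hside R hR
  have hdiff := hl2.sub hl1
  exact (sub_eq_zero.mp (tendsto_nhds_unique hdiff hzero)).symm

/-- The integral along a vertical line vanishes if the integrand extends holomorphically to the
right, with sufficient decay. -/
lemma integral_line_eq_zero {G : ℂ → ℂ} {σ₀ C T : ℝ} (hC : 0 ≤ C) (hT : 0 < T)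
    (hd : ∀ w : ℂ, σ₀ ≤ w.re → DifferentiableAt ℂ G w)
    (hb : ∀ w : ℂ, σ₀ ≤ w.re → T ≤ ‖w‖ → ‖G w‖ ≤ C * ‖w‖ ^ (-(3 / 2) : ℝ)) :
    ∫ τ : ℝ, G (σ₀ + τ * I) = 0 := by
  have hint : Integrable fun x : ℝ => (1 + ‖x‖) ^ (-(5 / 4) : ℝ) :=
    integrable_one_add_norm (by simp; norm_num)
  set J := ∫ x : ℝ, (1 + ‖x‖) ^ (-(5 / 4) : ℝ) with hJ
  have hle : ∀ᶠ σ : ℝ in atTop, ‖∫ τ : ℝ, G (σ₀ + τ * I)‖ ≤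
      C * 2 ^ (5 / 4 : ℝ) * J * σ ^ (-(1 / 4) : ℝ) := by
    filter_upwards [eventually_ge_atTop (max (max σ₀ T) 1)] with σ hσ
    have h1 : σ₀ ≤ σ := ((le_max_left _ _).trans (le_max_left _ _)).trans hσ
    have h2 : T ≤ σ := ((le_max_right _ _).trans (le_max_left _ _)).trans hσ
    have h3 : 1 ≤ σ := (le_max_right _ _).trans hσ
    rw [integral_line_eq h1 hC hT (fun w hw _ => hd w hw) (fun w hw _ => hb w hw)]
    have e : C * 2 ^ (5 / 4 : ℝ) * J * σ ^ (-(1 / 4) : ℝ) =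
        ∫ x : ℝ, C * 2 ^ (5 / 4 : ℝ) * σ ^ (-(1 / 4) : ℝ) * (1 + ‖x‖) ^ (-(5 / 4) : ℝ) := by
      rw [integral_const_mul, ← hJ]; ring
    rw [e]
    refine norm_integral_le_of_norm_le (hint.const_mul _) (Eventually.of_forall fun τ => ?_)
    set w : ℂ := σ + τ * I with hw
    have hwre : w.re = σ := by simp [hw]
    have h4 : σ ≤ ‖w‖ := hwre ▸ re_le_norm w
    have h5 : |τ| ≤ ‖w‖ := abs_im_le_norm_line σ τ
    have hw0 : 0 < ‖w‖ := by linarith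
    refine (hb w (by rw [hwre]; exact h1) (h2.trans h4)).trans ?_
    -- The exponent 3/2 is split as 1/4 + 5/4: the first factor tends to zero as the line moves
    -- right, the second is still integrable along it.
    have h6 : ‖w‖ ^ (-(3 / 2) : ℝ) = ‖w‖ ^ (-(1 / 4) : ℝ) * ‖w‖ ^ (-(5 / 4) : ℝ) := by
      rw [← Real.rpow_add hw0]; norm_num
    have h7 : ‖w‖ ^ (-(1 / 4) : ℝ) ≤ σ ^ (-(1 / 4) : ℝ) :=
      Real.rpow_le_rpow_of_nonpos (by linarith) h4 (by norm_num)
    have h8 : ‖w‖ ^ (-(5 / 4) : ℝ) ≤ 2 ^ (5 / 4 : ℝ) * (1 + ‖τ‖) ^ (-(5 / 4) : ℝ) := by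
      have h9 : (1 + ‖τ‖) / 2 ≤ ‖w‖ := by rw [Real.norm_eq_abs]; linarith
      calc _ ≤ ((1 + ‖τ‖) / 2) ^ (-(5 / 4) : ℝ) :=
            Real.rpow_le_rpow_of_nonpos (by positivity) h9 (by norm_num)
        _ = _ := by
            rw [Real.div_rpow (by positivity) two_pos.le, Real.rpow_neg two_pos.le, div_inv_eq_mul,
              mul_comm]
    rw [h6]
    calc _ ≤ C * (σ ^ (-(1 / 4) : ℝ) * (2 ^ (5 / 4 : ℝ) * (1 + ‖τ‖) ^ (-(5 / 4) : ℝ))) := by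
          gcongr
      _ = _ := by ring
  have hlim : Tendsto (fun σ : ℝ => C * 2 ^ (5 / 4 : ℝ) * J * σ ^ (-(1 / 4) : ℝ)) atTop (𝓝 0) := by
    simpa using (tendsto_rpow_neg_atTop (by norm_num : (0 : ℝ) < 1 / 4)).const_mul
      (C * 2 ^ (5 / 4 : ℝ) * J)
  exact norm_le_zero_iff.mp (ge_of_tendsto hlim hle)

lemma half_norm_le_norm_sub {w p : ℂ} (h : 2 * ‖p‖ ≤ ‖w‖) : ‖w‖ / 2 ≤ ‖w - p‖ := by
  have := norm_sub_norm_le w p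
  linarith

lemma sqrt_mul_decay {x : ℝ} (hx : 0 < x) (A : ℝ) :
    A * √x / (x / 2 * (x / 2)) = 4 * A * x ^ (-(3 / 2) : ℝ) := by
  rw [← sqrt_div_sq_eq hx]; field_simp; ring

lemma integrable_lorentz {a : ℝ} (ha : 0 < a) (t : ℝ) :
    Integrable fun τ : ℝ => 1 / (a ^ 2 + (τ - t) ^ 2) := by
  have h1 := ((integrable_inv_one_add_sq.comp_div ha.ne').comp_sub_right t).const_mul (1 / a ^ 2)
  refine h1.congr (Eventually.of_forall fun τ => ?_)
  simp only
  field_simp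

lemma integral_lorentz {a : ℝ} (ha : 0 < a) (t : ℝ) :
    ∫ τ : ℝ, 1 / (a ^ 2 + (τ - t) ^ 2) = Real.pi / a := by
  have e : ∀ τ : ℝ, 1 / (a ^ 2 + (τ - t) ^ 2) = 1 / a ^ 2 * (1 + ((τ - t) / a) ^ 2)⁻¹ := by
    intro τ; field_simp
  simp_rw [e]
  rw [integral_const_mul, integral_sub_right_eq_self (fun τ : ℝ => (1 + (τ / a) ^ 2)⁻¹) t,
    Measure.integral_comp_div (fun τ : ℝ => (1 + τ ^ 2)⁻¹) a, integral_univ_inv_one_add_sq,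
    abs_of_pos ha, smul_eq_mul]
  field_simp

/-- Poisson's formula for a half-plane. -/
lemma integral_poisson {f : ℂ → ℂ} {σ' σ₀ C : ℝ} (hσ : σ' < σ₀)
    (hf : DifferentiableOn ℂ f {w | σ' < w.re}) (hC : 0 ≤ C)
    (hb : ∀ w : ℂ, σ₀ ≤ w.re → ‖f w‖ ≤ C * √‖w‖) {a : ℝ} (ha : 0 < a) (t : ℝ) :
    Integrable (fun τ : ℝ => f (σ₀ + τ * I) * ((1 / (a ^ 2 + (τ - t) ^ 2) : ℝ) : ℂ)) ∧
    ∫ τ : ℝ, f (σ₀ + τ * I) * ((1 / (a ^ 2 + (τ - t) ^ 2) : ℝ) : ℂ) =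
      f (σ₀ + a + t * I) * (Real.pi / a) := by
  set s : ℂ := σ₀ + a + t * I with hs
  set s' : ℂ := σ₀ - a + t * I with hs'
  have hopen := isOpen_re_gt σ'
  have hsmem : s ∈ {w : ℂ | σ' < w.re} := by simp [hs]; linarith
  -- With s' the mirror image of s in the line, (w - s)(w - s') equals -(a² + (τ - t)²) there. The
  -- function (f(w) - f(s))/((w - s)(w - s')) has no pole to the right of the line, so its integral
  -- vanishes and f may be replaced by f(s) under the Poisson kernel.
  set G : ℂ → ℂ := fun w => dslope f s w / (w - s') with hG
  have hds : DifferentiableOn ℂ (dslope f s) {w | σ' < w.re} :=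
    (differentiableOn_dslope (hopen.mem_nhds hsmem)).mpr hf
  have hd : ∀ w : ℂ, σ₀ ≤ w.re → DifferentiableAt ℂ G w := by
    intro w hw
    refine DifferentiableAt.div (hds.differentiableAt (hopen.mem_nhds (by
      show σ' < w.re; linarith))) (by fun_prop) ?_
    intro h
    have := congrArg re h
    simp [hs'] at this; linarith
  set T : ℝ := 2 * (‖s‖ + ‖s'‖) + 1 with hT
  have hdecay : ∀ w : ℂ, σ₀ ≤ w.re → T ≤ ‖w‖ →
      ‖G w‖ ≤ (4 * (C + ‖f s‖)) * ‖w‖ ^ (-(3 / 2) : ℝ) := by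
    intro w hw hTw
    have hw1 : 1 ≤ ‖w‖ := by linarith [norm_nonneg s, norm_nonneg s']
    have hws : ‖w‖ / 2 ≤ ‖w - s‖ := half_norm_le_norm_sub (by linarith [norm_nonneg s'])
    have hws' : ‖w‖ / 2 ≤ ‖w - s'‖ := half_norm_le_norm_sub (by linarith [norm_nonneg s])
    have hne : w ≠ s := by
      rintro rfl; simp at hws; linarith
    have hsq : 1 ≤ √‖w‖ := Real.one_le_sqrt.mpr hw1
    have h1 : ‖f w - f s‖ ≤ (C + ‖f s‖) * √‖w‖ := by
      refine (norm_sub_le _ _).trans ?_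
      have := hb w hw
      nlinarith [norm_nonneg (f s)]
    rw [hG]
    simp only
    rw [dslope_of_ne _ hne, slope_def_field, norm_div, norm_div, div_div,
      ← sqrt_mul_decay (by linarith)]
    gcongr
  have hpos : 0 < T := by rw [hT]; positivity
  have hint := integrable_line (σ := σ₀) (by positivity) hpos (fun w hw => hd w hw.ge)
    (fun w hw => hdecay w hw.ge)
  have hzero := integral_line_eq_zero (by positivity) hpos hd hdecay
  have e : ∀ τ : ℝ, f (σ₀ + τ * I) * ((1 / (a ^ 2 + (τ - t) ^ 2) : ℝ) : ℂ) =
      f s * ((1 / (a ^ 2 + (τ - t) ^ 2) : ℝ) : ℂ) - G (σ₀ + τ * I) := by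
    intro τ
    have hne : (σ₀ + τ * I : ℂ) ≠ s := by
      intro h
      have := congrArg re h
      simp [hs] at this; linarith
    have hp : (0 : ℝ) < a ^ 2 + (τ - t) ^ 2 := by positivity
    have hpc : (a : ℂ) ^ 2 + ((τ : ℂ) - t) ^ 2 ≠ 0 := by exact_mod_cast hp.ne'
    simp only [hG]
    rw [dslope_of_ne _ hne, slope_def_field, div_div,
      show (σ₀ + τ * I - s) * (σ₀ + τ * I - s') = -((a : ℂ) ^ 2 + ((τ : ℂ) - t) ^ 2) by
        rw [hs, hs']; linear_combination (τ - t) ^ 2 * I_mul_I]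
    push_cast
    field_simp
    ring
  have hl : Integrable fun τ : ℝ => f s * ((1 / (a ^ 2 + (τ - t) ^ 2) : ℝ) : ℂ) :=
    (integrable_lorentz ha t).ofReal.const_mul _
  simp_rw [e]
  refine ⟨hl.sub hint, ?_⟩
  rw [integral_sub hl hint, hzero, sub_zero, integral_const_mul, integral_complex_ofReal,
    integral_lorentz ha t]
  push_cast
  rfl

/-! ### The smoothing kernel -/

/-- The kernel `(e^{2ℓz} - e^{ℓz}) / (ℓ z²)`; it has a simple pole with residue `1` at `0`. -/
noncomputable def smoothKernel (ℓ : ℝ) (z : ℂ) : ℂ :=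
  (exp (2 * ℓ * z) - exp (ℓ * z)) / (ℓ * z ^ 2)

lemma norm_smoothKernel_le {ℓ : ℝ} (hℓ : 0 < ℓ) (z : ℂ) :
    ‖smoothKernel ℓ z‖ ≤ (Real.exp (2 * ℓ * z.re) + Real.exp (ℓ * z.re)) / (ℓ * ‖z‖ ^ 2) := by
  rw [smoothKernel, norm_div, norm_mul, norm_pow, norm_real, Real.norm_eq_abs, abs_of_pos hℓ]
  gcongr
  refine (norm_sub_le _ _).trans (le_of_eq ?_)
  rw [norm_exp, norm_exp]
  simp [mul_re]

lemma norm_smoothKernel_le_of_re_nonpos {ℓ : ℝ} (hℓ : 0 < ℓ) {z : ℂ} (hz : z.re ≤ 0) :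
    ‖smoothKernel ℓ z‖ ≤ 2 / ℓ / ‖z‖ ^ 2 := by
  refine (norm_smoothKernel_le hℓ z).trans ?_
  rw [div_div]
  gcongr
  have h1 : Real.exp (2 * ℓ * z.re) ≤ 1 := Real.exp_le_one_iff.mpr (by nlinarith)
  have h2 : Real.exp (ℓ * z.re) ≤ 1 := Real.exp_le_one_iff.mpr (by nlinarith)
  linarith

lemma norm_smoothKernel_le_of_re_le {ℓ b : ℝ} (hℓ : 0 < ℓ) (hb : 0 ≤ b) {z : ℂ} (hz : z.re ≤ b) :
    ‖smoothKernel ℓ z‖ ≤ 2 * Real.exp (2 * ℓ * b) / ℓ / ‖z‖ ^ 2 := by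
  refine (norm_smoothKernel_le hℓ z).trans ?_
  rw [div_div]
  gcongr
  have h1 : Real.exp (2 * ℓ * z.re) ≤ Real.exp (2 * ℓ * b) := by gcongr
  have h2 : Real.exp (ℓ * z.re) ≤ Real.exp (2 * ℓ * b) := by
    apply Real.exp_le_exp.mpr; nlinarith
  linarith

lemma differentiableAt_smoothKernel {ℓ : ℝ} (hℓ : 0 < ℓ) {z : ℂ} (hz : z ≠ 0) :
    DifferentiableAt ℂ (smoothKernel ℓ) z := by
  unfold smoothKernel
  have : (ℓ : ℂ) ≠ 0 := by exact_mod_cast hℓ.ne'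
  exact DifferentiableAt.div (by fun_prop) (by fun_prop) (mul_ne_zero this (pow_ne_zero 2 hz))

lemma smoothKernel_conj (ℓ : ℝ) (z : ℂ) :
    smoothKernel ℓ (starRingEnd ℂ z) = starRingEnd ℂ (smoothKernel ℓ z) := by
  simp only [smoothKernel, map_div₀, map_sub, ← exp_conj, map_mul, map_pow, conj_ofReal]
  rw [map_ofNat (starRingEnd ℂ) 2]

/-- The integral of the conjugate of `f` against the kernel vanishes. -/
lemma integral_conj_mul_smoothKernel {f : ℂ → ℂ} {σ₀ C : ℝ}
    (hf : ∀ w : ℂ, σ₀ ≤ w.re → DifferentiableAt ℂ f w) (hC : 0 ≤ C)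
    (hb : ∀ w : ℂ, σ₀ ≤ w.re → 1 ≤ ‖w‖ → ‖f w‖ ≤ C * √‖w‖) {a ℓ : ℝ} (ha : 0 < a) (hℓ : 0 < ℓ)
    (t : ℝ) :
    Integrable (fun τ : ℝ => starRingEnd ℂ (f (σ₀ + τ * I)) *
      smoothKernel ℓ (-a + (τ - t) * I)) ∧
    ∫ τ : ℝ, starRingEnd ℂ (f (σ₀ + τ * I)) * smoothKernel ℓ (-a + (τ - t) * I) = 0 := by
  set p : ℂ := σ₀ - a + t * I with hp
  -- On the line, p - w is the conjugate of w - s with s = σ₀ + a + it. Thus the integrand is the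
  -- conjugate of a function holomorphic further right, where Re(p - w) ≤ -a keeps the exponentials
  -- bounded.
  set G : ℂ → ℂ := fun w => f w * smoothKernel ℓ (p - w) with hG
  have hre : ∀ w : ℂ, σ₀ ≤ w.re → (p - w).re ≤ -a := fun w hw => by simp [hp]; linarith
  have hd : ∀ w : ℂ, σ₀ ≤ w.re → DifferentiableAt ℂ G w := by
    intro w hw
    have h0 : p - w ≠ 0 := by
      intro h
      have := hre w hw
      rw [h] at this
      simp at this; linarith
    have := differentiableAt_smoothKernel hℓ h0
    exact (hf w hw).mul (DifferentiableAt.comp w this (by fun_prop))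
  set T := 2 * ‖p‖ + 1 with hT
  have hT0 : 0 < T := by positivity
  have hdecay : ∀ w : ℂ, σ₀ ≤ w.re → T ≤ ‖w‖ →
      ‖G w‖ ≤ (4 * (C * (2 / ℓ))) * ‖w‖ ^ (-(3 / 2) : ℝ) := by
    intro w hw hTw
    have hw1 : 1 ≤ ‖w‖ := by linarith [norm_nonneg p]
    have h1 : ‖w‖ / 2 ≤ ‖p - w‖ := by
      rw [norm_sub_rev]; exact half_norm_le_norm_sub (by linarith)
    have h2 := norm_smoothKernel_le_of_re_nonpos hℓ (z := p - w) (by linarith [hre w hw])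
    rw [hG, ← sqrt_mul_decay (by linarith)]
    simp only
    rw [norm_mul]
    calc ‖f w‖ * ‖smoothKernel ℓ (p - w)‖ ≤ (C * √‖w‖) * (2 / ℓ / (‖w‖ / 2) ^ 2) := by
          gcongr
          · exact hb w hw hw1
          · exact h2.trans (by gcongr)
      _ = _ := by rw [sq]; ring
  have hint := integrable_line (σ := σ₀) (by positivity) hT0 (fun w hw => hd w hw.ge)
    (fun w hw => hdecay w hw.ge)
  have hzero := integral_line_eq_zero (by positivity) hT0 hd hdecay
  have e : ∀ τ : ℝ, starRingEnd ℂ (f (σ₀ + τ * I)) * smoothKernel ℓ (-a + (τ - t) * I) =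
      starRingEnd ℂ (G (σ₀ + τ * I)) := by
    intro τ
    simp only [hG]
    rw [map_mul, ← smoothKernel_conj]
    congr 2
    apply Complex.ext
    · simp [hp]
    · simp [hp]; ring
  simp_rw [e]
  refine ⟨(LinearIsometryEquiv.integrable_comp_iff conjLIE).mpr hint, ?_⟩
  rw [integral_conj, hzero, map_zero]

set_option maxHeartbeats 1000000 in
/-- The kernel reproduces `f` up to an integral over a line further to the right. -/
lemma integral_mul_smoothKernel {f : ℂ → ℂ} {σ' σ₀ σ₁ C : ℝ} (hσ : σ' < σ₀)
    (hf : DifferentiableOn ℂ f {w | σ' < w.re}) (hC : 0 ≤ C)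
    (hb : ∀ w : ℂ, σ₀ ≤ w.re → 1 ≤ ‖w‖ → ‖f w‖ ≤ C * √‖w‖) {a ℓ : ℝ} (ha : 0 < a) (hℓ : 0 < ℓ)
    (h1 : σ₀ + a < σ₁) (t : ℝ) :
    Integrable (fun τ : ℝ => f (σ₀ + τ * I) * smoothKernel ℓ (-a + (τ - t) * I)) ∧
    2 * Real.pi * f (σ₀ + a + t * I) =
      (∫ τ : ℝ, f (σ₁ + τ * I) * smoothKernel ℓ (σ₁ + τ * I - (σ₀ + a + t * I))) -
      ∫ τ : ℝ, f (σ₀ + τ * I) * smoothKernel ℓ (-a + (τ - t) * I) := by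
  set s : ℂ := σ₀ + a + t * I with hs
  set p : ℂ := σ₀ - a + t * I with hp
  have hps : p = s - 2 * a := by rw [hs, hp]; ring
  have hsre : s.re = σ₀ + a := by simp [hs]
  have hℓc : (ℓ : ℂ) ≠ 0 := by exact_mod_cast hℓ.ne'
  -- The kernel is E(z)/z with E the entire extension of E0(z)/z and E(0) = 1, which exhibits the
  -- residue.
  set E0 : ℂ → ℂ := fun z => (exp (2 * ℓ * z) - exp (ℓ * z)) / ℓ with hE0
  have hE0d : Differentiable ℂ E0 := by
    rw [hE0]; fun_prop
  have hE0' : HasDerivAt E0 1 0 := by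
    have e1 : HasDerivAt (fun z : ℂ => exp (2 * ℓ * z)) (exp (2 * ℓ * 0) * (2 * ℓ * 1)) 0 :=
      ((hasDerivAt_id (0 : ℂ)).const_mul (2 * (ℓ : ℂ))).cexp
    have e2 : HasDerivAt (fun z : ℂ => exp (ℓ * z)) (exp (ℓ * 0) * (ℓ * 1)) 0 :=
      ((hasDerivAt_id (0 : ℂ)).const_mul (ℓ : ℂ)).cexp
    have := (e1.sub e2).div_const (ℓ : ℂ)
    refine this.congr_deriv ?_
    simp only [mul_zero, exp_zero, one_mul, mul_one]
    field_simp; ring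
  set E : ℂ → ℂ := dslope E0 0 with hE
  have hEd : Differentiable ℂ E := by
    rw [← differentiableOn_univ]
    exact (differentiableOn_dslope univ_mem).mpr hE0d.differentiableOn
  have hE0eq : E 0 = 1 := by rw [hE, dslope_same, hE0'.deriv]
  have hEK : ∀ z : ℂ, z ≠ 0 → E z / z = smoothKernel ℓ z := by
    intro z hz
    rw [hE, dslope_of_ne _ hz, slope_def_field, smoothKernel, hE0]
    simp only [mul_zero, exp_zero, sub_self, zero_div, sub_zero]
    field_simp
  clear_value E
  set U : Set ℂ := {w : ℂ | max σ' (σ₀ - a) < w.re} with hU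
  have hUo : IsOpen U := isOpen_re_gt _
  have hsU : s ∈ U := by
    simp only [hU, mem_ofPred_eq, hsre, max_lt_iff]; constructor <;> linarith
  have hpU : ∀ w ∈ U, w - p ≠ 0 := by
    intro w hw h
    have h2 : σ₀ - a < w.re := (le_max_right _ _).trans_lt hw
    have := congrArg re h
    simp [hp] at this; linarith
  -- The rational function 2a f(s)/((w - s)(w - p)) has the same residue at s as the integrand.
  -- Subtracting it leaves a holomorphic function whose line can be shifted, so no residue theorem
  -- is needed: the rational part integrates to -2π f(s) on the left line and to 0 on the right one.
  set N : ℂ → ℂ := fun w => f w * E (w - s) - f s * (2 * a / (w - p)) with hN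
  have hNd : DifferentiableOn ℂ N U := by
    refine DifferentiableOn.sub (DifferentiableOn.mul (hf.mono fun w hw => ?_) ?_) ?_
    · exact (le_max_left σ' (σ₀ - a)).trans_lt hw
    · exact (hEd.comp (by fun_prop : Differentiable ℂ fun w : ℂ => w - s)).differentiableOn
    · exact DifferentiableOn.const_mul (DifferentiableOn.div (by fun_prop) (by fun_prop) hpU) _
  have hNs : N s = 0 := by
    have h2a : s - p = 2 * a := by rw [hps]; ring
    have h2a0 : (2 * a : ℂ) ≠ 0 := by simp [ha.ne']
    simp only [hN]
    rw [sub_self, hE0eq, h2a, div_self h2a0]; ring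
  set G : ℂ → ℂ := dslope N s with hG
  have hGd : DifferentiableOn ℂ G U := (differentiableOn_dslope (hUo.mem_nhds hsU)).mpr hNd
  have hGeq : ∀ w : ℂ, w ≠ s → w - p ≠ 0 →
      G w = f w * smoothKernel ℓ (w - s) - f s * (2 * a / ((w - s) * (w - p))) := by
    intro w hw hwp
    have hws : w - s ≠ 0 := sub_ne_zero.mpr hw
    rw [hG, dslope_of_ne _ hw, slope_def_field, hNs, ← hEK _ hws]
    simp only [hN]
    field_simp
    ring
  clear_value G
  have hd : ∀ w : ℂ, σ₀ ≤ w.re → w.re ≤ σ₁ → DifferentiableAt ℂ G w := fun w hw _ =>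
    hGd.differentiableAt (hUo.mem_nhds (by
      simp only [hU, mem_ofPred_eq, max_lt_iff]; constructor <;> linarith))
  set T := 2 * (‖s‖ + ‖p‖) + 1 with hT
  have hT0 : 0 < T := by positivity
  set B := 2 * Real.exp (2 * ℓ * (σ₁ - σ₀)) / ℓ with hB
  have hB0 : 0 ≤ B := by positivity
  clear_value B
  have hbig : ∀ w : ℂ, T ≤ ‖w‖ → 1 ≤ ‖w‖ ∧ ‖w‖ / 2 ≤ ‖w - s‖ ∧ ‖w‖ / 2 ≤ ‖w - p‖ := by
    intro w hTw
    refine ⟨by linarith [norm_nonneg s, norm_nonneg p], ?_, ?_⟩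
    · exact half_norm_le_norm_sub (by linarith [norm_nonneg p])
    · exact half_norm_le_norm_sub (by linarith [norm_nonneg s])
  have hKdecay : ∀ w : ℂ, σ₀ ≤ w.re → w.re ≤ σ₁ → T ≤ ‖w‖ →
      ‖f w * smoothKernel ℓ (w - s)‖ ≤ (4 * (C * B)) * ‖w‖ ^ (-(3 / 2) : ℝ) := by
    intro w hw hw' hTw
    obtain ⟨hw1, hws, -⟩ := hbig w hTw
    have h2 := norm_smoothKernel_le_of_re_le hℓ (b := σ₁ - σ₀) (by linarith) (z := w - s)
      (by simp only [sub_re, hsre]; linarith)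
    rw [← sqrt_mul_decay (by linarith), norm_mul]
    calc _ ≤ (C * √‖w‖) * (B / (‖w‖ / 2) ^ 2) := by
          gcongr
          · exact hb w hw hw1
          · rw [← hB] at h2; exact h2.trans (by gcongr)
      _ = _ := by rw [sq]; ring
  have hRdecay : ∀ w : ℂ, T ≤ ‖w‖ → ‖f s * (2 * a / ((w - s) * (w - p)))‖ ≤
      (4 * (‖f s‖ * (2 * a))) * ‖w‖ ^ (-(3 / 2) : ℝ) := by
    intro w hTw
    obtain ⟨hw1, hws, hwp⟩ := hbig w hTw
    have hsq : 1 ≤ √‖w‖ := Real.one_le_sqrt.mpr hw1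
    rw [← sqrt_mul_decay (by linarith), norm_mul, norm_div, norm_mul (w - s)]
    have h2a : ‖(2 * a : ℂ)‖ = 2 * a := by simp [abs_of_pos ha]
    rw [h2a, ← mul_div_assoc]
    have h3 : 0 ≤ ‖f s‖ * (2 * a) := by positivity
    have h4 : ‖f s‖ * (2 * a) ≤ ‖f s‖ * (2 * a) * √‖w‖ := le_mul_of_one_le_right h3 hsq
    have h5 : ‖w‖ / 2 * (‖w‖ / 2) ≤ ‖w - s‖ * ‖w - p‖ := by gcongr
    exact div_le_div₀ (by positivity) h4 (by positivity) h5
  have hne : ∀ w : ℂ, T ≤ ‖w‖ → w ≠ s ∧ w - p ≠ 0 := by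
    intro w hTw
    obtain ⟨hw1, hws, hwp⟩ := hbig w hTw
    constructor
    · rintro rfl; simp at hws; linarith
    · intro h; rw [h] at hwp; simp at hwp; linarith
  have hdecay : ∀ w : ℂ, σ₀ ≤ w.re → w.re ≤ σ₁ → T ≤ ‖w‖ →
      ‖G w‖ ≤ (4 * (C * B) + 4 * (‖f s‖ * (2 * a))) * ‖w‖ ^ (-(3 / 2) : ℝ) := by
    intro w hw hw' hTw
    obtain ⟨hns, hnp⟩ := hne w hTw
    rw [hGeq w hns hnp, add_mul]
    exact (norm_sub_le _ _).trans (add_le_add (hKdecay w hw hw' hTw) (hRdecay w hTw))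
  have hshift := integral_line_eq (by linarith : σ₀ ≤ σ₁) (by positivity) hT0 hd hdecay
  -- the four separate integrals
  have hdK : ∀ w : ℂ, σ₀ ≤ w.re → w ≠ s →
      DifferentiableAt ℂ (fun w => f w * smoothKernel ℓ (w - s)) w := by
    intro w hw hws
    refine (hf.differentiableAt ((isOpen_re_gt σ').mem_nhds (by
      show σ' < w.re; linarith))).mul ?_
    exact DifferentiableAt.comp (g := smoothKernel ℓ) (f := fun w => w - s) w
      (differentiableAt_smoothKernel hℓ (sub_ne_zero.mpr hws)) (by fun_prop)
  have hs_ne : ∀ w : ℂ, w.re ≠ σ₀ + a → w ≠ s := by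
    rintro w hw rfl; exact hw hsre
  have hiK0 := integrable_line (G := fun w => f w * smoothKernel ℓ (w - s)) (σ := σ₀)
    (by positivity : 0 ≤ 4 * (C * B)) hT0
    (fun w hw => hdK w hw.ge (hs_ne w (by rw [hw]; linarith)))
    (fun w hw => hKdecay w hw.ge (by rw [hw]; linarith))
  have hiK1 := integrable_line (G := fun w => f w * smoothKernel ℓ (w - s)) (σ := σ₁)
    (by positivity : 0 ≤ 4 * (C * B)) hT0
    (fun w hw => hdK w (by linarith) (hs_ne w (by rw [hw]; linarith)))
    (fun w hw => hKdecay w (by linarith) hw.le)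
  have hdR : ∀ w : ℂ, σ₀ ≤ w.re → w ≠ s →
      DifferentiableAt ℂ (fun w => f s * (2 * a / ((w - s) * (w - p)))) w := by
    intro w hw hws
    refine DifferentiableAt.const_mul (DifferentiableAt.div (c := fun _ => 2 * (a : ℂ))
      (d := fun w => (w - s) * (w - p)) (by fun_prop) (by fun_prop)
      (mul_ne_zero (sub_ne_zero.mpr hws) ?_)) _
    intro h
    have := congrArg re h
    simp [hp] at this; linarith
  have hiR0 := integrable_line (G := fun w => f s * (2 * a / ((w - s) * (w - p)))) (σ := σ₀)
    (by positivity : 0 ≤ 4 * (‖f s‖ * (2 * a))) hT0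
    (fun w hw => hdR w hw.ge (hs_ne w (by rw [hw]; linarith)))
    (fun w _ => hRdecay w)
  have hiR1 := integrable_line (G := fun w => f s * (2 * a / ((w - s) * (w - p)))) (σ := σ₁)
    (by positivity : 0 ≤ 4 * (‖f s‖ * (2 * a))) hT0
    (fun w hw => hdR w (by linarith) (hs_ne w (by rw [hw]; linarith)))
    (fun w _ => hRdecay w)
  have hzR1 := integral_line_eq_zero (G := fun w => f s * (2 * a / ((w - s) * (w - p)))) (σ₀ := σ₁)
    (by positivity : 0 ≤ 4 * (‖f s‖ * (2 * a))) hT0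
    (fun w hw => hdR w (by linarith) (hs_ne w (by linarith)))
    (fun w _ => hRdecay w)
  have hG0 : ∀ τ : ℝ, G (σ₀ + τ * I) = f (σ₀ + τ * I) * smoothKernel ℓ (σ₀ + τ * I - s) -
      f s * (2 * a / ((σ₀ + τ * I - s) * (σ₀ + τ * I - p))) := fun τ => by
    refine hGeq _ (hs_ne _ (by simp [ha.ne'])) fun h => ?_
    have := congrArg re h
    simp [hp] at this; linarith
  have hG1 : ∀ τ : ℝ, G (σ₁ + τ * I) = f (σ₁ + τ * I) * smoothKernel ℓ (σ₁ + τ * I - s) -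
      f s * (2 * a / ((σ₁ + τ * I - s) * (σ₁ + τ * I - p))) := fun τ => by
    refine hGeq _ (hs_ne _ (by simp; linarith)) fun h => ?_
    have := congrArg re h
    simp [hp] at this; linarith
  have hR0 : ∫ τ : ℝ, f s * (2 * a / ((σ₀ + τ * I - s) * (σ₀ + τ * I - p))) =
      -(2 * Real.pi * f s) := by
    have e : ∀ τ : ℝ, f s * (2 * a / ((σ₀ + τ * I - s) * (σ₀ + τ * I - p))) =
        -(2 * a * f s) * ((1 / (a ^ 2 + (τ - t) ^ 2) : ℝ) : ℂ) := by
      intro τ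
      have hpos : (0 : ℝ) < a ^ 2 + (τ - t) ^ 2 := by positivity
      have hpc : (a : ℂ) ^ 2 + ((τ : ℂ) - t) ^ 2 ≠ 0 := by exact_mod_cast hpos.ne'
      rw [show (σ₀ + τ * I - s) * (σ₀ + τ * I - p) = -((a : ℂ) ^ 2 + ((τ : ℂ) - t) ^ 2) by
        rw [hs, hp]; linear_combination (τ - t) ^ 2 * I_mul_I]
      push_cast
      field_simp
    simp_rw [e]
    rw [integral_const_mul, integral_complex_ofReal, integral_lorentz ha t]
    have : (a : ℂ) ≠ 0 := by exact_mod_cast ha.ne'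
    push_cast
    field_simp
  have ez : ∀ τ : ℝ, (σ₀ + τ * I - s : ℂ) = -a + (τ - t) * I := fun τ => by rw [hs]; ring
  simp_rw [hG0, hG1] at hshift
  rw [integral_sub hiK0 hiR0, integral_sub hiK1 hiR1, hzR1, hR0] at hshift
  simp_rw [ez] at hshift hiK0
  exact ⟨hiK0, by linear_combination hshift⟩

/-! ### Growth and variation of the archimedean factor -/

lemma log_le_two_mul_sqrt {x : ℝ} (hx : 0 < x) : Real.log x ≤ 2 * √x := by
  have h1 : Real.log x = 2 * Real.log (√x) := by rw [Real.log_sqrt hx.le]; ring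
  have := Real.log_le_sub_one_of_pos (Real.sqrt_pos.mpr hx)
  linarith

lemma log_abs_im_add_five_le {w : ℂ} (hw : 1 / 2 ≤ w.re) : Real.log (|w.im| + 5) ≤ 8 * √‖w‖ := by
  have h1 : 1 / 2 ≤ ‖w‖ := hw.trans (re_le_norm w)
  have h2 := abs_im_le_norm w
  calc Real.log (|w.im| + 5) ≤ 2 * √(|w.im| + 5) := log_le_two_mul_sqrt (by positivity)
    _ ≤ 2 * √(16 * ‖w‖) := by gcongr; linarith
    _ = 8 * √‖w‖ := by
      rw [Real.sqrt_mul (by norm_num), show (16 : ℝ) = 4 ^ 2 by norm_num,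
        Real.sqrt_sq (by norm_num)]; ring

lemma abs_log_le_of_half_le {x : ℝ} (hx : 1 / 2 ≤ x) : |Real.log x| ≤ 2 * √x := by
  have h0 : 0 < x := by linarith
  rw [abs_le]
  refine ⟨?_, log_le_two_mul_sqrt h0⟩
  have h1 := Real.log_le_log (by norm_num) hx
  rw [one_div, Real.log_inv] at h1
  have h2 : 1 / 2 ≤ √x := Real.le_sqrt_of_sq_le (by linarith)
  linarith [Real.log_two_lt_d9]

lemma exists_norm_archFactor_le :
    ∃ C : ℝ, 0 < C ∧ ∀ w : ℂ, 1 / 2 ≤ w.re → ‖archFactor w‖ ≤ C * √‖w‖ := by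
  have hl : 0 ≤ Real.log (2 * Real.pi) := Real.log_nonneg (by linarith [Real.pi_gt_three])
  refine ⟨1 + Real.pi + Real.log (2 * Real.pi) + 44, by positivity, fun w hw => ?_⟩
  have h1 : 1 / 2 ≤ ‖w‖ := hw.trans (re_le_norm w)
  have hq : 1 / 2 ≤ √‖w‖ := Real.le_sqrt_of_sq_le (by linarith)
  have h2 := norm_archFactor_sub_le hw
  have h3 : ‖Complex.log w‖ ≤ 2 * √‖w‖ + Real.pi :=
    norm_log_le.trans (by gcongr; exact abs_log_le_of_half_le h1)
  have h4 : 11 / ‖w‖ ≤ 22 := by rw [div_le_iff₀ (by linarith)]; linarith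
  have h5 : ‖(Complex.log w / 2 - Real.log (2 * Real.pi) / 2 : ℂ)‖ ≤
      (2 * √‖w‖ + Real.pi) / 2 + Real.log (2 * Real.pi) / 2 := by
    refine (norm_sub_le _ _).trans ?_
    rw [norm_div, norm_div, norm_real, Real.norm_eq_abs, abs_of_nonneg hl]
    simp only [Complex.norm_ofNat]
    gcongr
  have h6 := norm_sub_norm_le (archFactor w) (Complex.log w / 2 - Real.log (2 * Real.pi) / 2)
  nlinarith [Real.pi_pos, mul_le_mul_of_nonneg_left hq Real.pi_pos.le,
    mul_le_mul_of_nonneg_left hq hl]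

lemma differentiableAt_archFactor {s : ℂ} (hs : 0 < s.re) : DifferentiableAt ℂ archFactor s := by
  have hs0 : s ≠ 0 := by rintro rfl; simp at hs
  have hre : 0 < (s / 2).re := by simp; linarith
  have hdig : DifferentiableAt ℂ digamma (s / 2) := by
    rw [digamma_def]
    unfold logDeriv
    have hon : DifferentiableOn ℂ Gamma {z | 0 < z.re} := fun z hz =>
      (differentiableAt_Gamma z fun m h => by
        have : (0 : ℝ) < z.re := hz
        rw [h] at this
        simp at this
        have h0 : (0 : ℝ) ≤ m := m.cast_nonneg
        linarith).differentiableWithinAt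
    have hopen := isOpen_re_gt 0
    refine DifferentiableAt.div ?_ (hon.differentiableAt (hopen.mem_nhds hre))
      (Gamma_ne_zero_of_re_pos hre)
    exact (hon.deriv hopen).differentiableAt (hopen.mem_nhds hre)
  have hcomp : DifferentiableAt ℂ (fun s => digamma (s / 2)) s :=
    DifferentiableAt.comp (g := digamma) (f := fun s : ℂ => s / 2) s hdig (by fun_prop)
  unfold archFactor
  exact ((hcomp.div_const 2).sub_const _).add
    (DifferentiableAt.div (by fun_prop) (by fun_prop) hs0)

lemma abs_re_archFactor_sub_le_log {w : ℂ} (hw : 1 / 2 ≤ w.re) :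
    |(archFactor w).re - (Real.log ‖w‖ / 2 - Real.log (2 * Real.pi) / 2)| ≤ 11 / ‖w‖ := by
  have h := (abs_re_le_norm _).trans (norm_archFactor_sub_le hw)
  have e : (archFactor w - (Complex.log w / 2 - Real.log (2 * Real.pi) / 2)).re =
      (archFactor w).re - (Real.log ‖w‖ / 2 - Real.log (2 * Real.pi) / 2) := by
    rw [sub_re, sub_re]
    have e1 : (Complex.log w / 2).re = Real.log ‖w‖ / 2 := by
      rw [← log_re]; simp
    have e2 : ((Real.log (2 * Real.pi) : ℂ) / 2).re = Real.log (2 * Real.pi) / 2 := by simp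
    rw [e1, e2]
  rwa [e] at h

/-- X, Y, D stand for the fourth roots of |w|, |s|, |w - s|, so that all estimates become
polynomial. If |w - s| ≤ |s|/2 the logarithms differ by O(|w - s|/|s|); otherwise |w| and |s| are
both controlled by |w - s| and crude bounds suffice. -/
lemma abs_log_sub_log_add_le {X Y D : ℝ} (hX : 0 < X) (hY : 0 < Y) (hD : 0 ≤ D)
    (hX4 : 1 / 2 ≤ X ^ 4) (hY4 : 1 / 2 ≤ Y ^ 4) (hd : |X ^ 4 - Y ^ 4| ≤ D ^ 4) :
    |Real.log (X ^ 4) - Real.log (Y ^ 4)| / 2 + 11 / X ^ 4 + 11 / Y ^ 4 ≤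
      100 * ((1 + D ^ 2) / Y) := by
  have hYl : 0.8 ≤ Y := by
    by_contra h
    push Not at h
    have : Y ^ 4 < 0.8 ^ 4 := by gcongr
    norm_num at this; linarith
  have hXl : 0.8 ≤ X := by
    by_contra h
    push Not at h
    have : X ^ 4 < 0.8 ^ 4 := by gcongr
    norm_num at this; linarith
  rw [abs_le] at hd
  have hY2 : 0.64 ≤ Y ^ 2 := by nlinarith
  have hY3 : 0.5 ≤ Y ^ 3 := by nlinarith
  have hYpos4 : 0 < Y ^ 4 := by positivity
  have hXpos4 : 0 < X ^ 4 := by positivity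
  have hYY : 11 / Y ^ 4 ≤ 22 * (1 / Y) := by
    rw [mul_one_div, div_le_div_iff₀ hYpos4 hY]
    nlinarith [mul_le_mul_of_nonneg_right hY3 hY.le]
  rcases le_or_gt (D ^ 4) (Y ^ 4 / 2) with hcase | hcase
  · have hx : Y ^ 4 / 2 ≤ X ^ 4 := by linarith
    have hDY : D ^ 2 ≤ Y ^ 2 := by
      have : (D ^ 2) ^ 2 ≤ (Y ^ 2) ^ 2 := by nlinarith
      exact (sq_le_sq₀ (by positivity) (by positivity)).mp this
    have hlog : |Real.log (X ^ 4) - Real.log (Y ^ 4)| ≤ 2 * D ^ 4 / Y ^ 4 := by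
      rw [abs_le]
      constructor
      · have h1 := Real.log_le_sub_one_of_pos (show 0 < Y ^ 4 / X ^ 4 by positivity)
        rw [Real.log_div hYpos4.ne' hXpos4.ne'] at h1
        have h2 : Y ^ 4 / X ^ 4 - 1 ≤ 2 * D ^ 4 / Y ^ 4 := by
          rw [div_sub_one hXpos4.ne', div_le_div_iff₀ hXpos4 hYpos4]
          nlinarith [pow_nonneg hD 4]
        linarith
      · have h1 := Real.log_le_sub_one_of_pos (show 0 < X ^ 4 / Y ^ 4 by positivity)
        rw [Real.log_div hXpos4.ne' hYpos4.ne'] at h1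
        have h2 : X ^ 4 / Y ^ 4 - 1 ≤ 2 * D ^ 4 / Y ^ 4 := by
          rw [div_sub_one hYpos4.ne', div_le_div_iff₀ hYpos4 hYpos4]
          nlinarith [pow_nonneg hD 4]
        linarith
    have h3 : D ^ 4 / Y ^ 4 ≤ 2 * (D ^ 2 / Y) := by
      rw [← mul_div_assoc, div_le_div_iff₀ hYpos4 hY]
      have e1 : D ^ 4 * Y = D ^ 2 * (D ^ 2 * Y) := by ring
      have e2 : 2 * D ^ 2 * Y ^ 4 = D ^ 2 * (2 * Y ^ 4) := by ring
      rw [e1, e2]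
      have h4 : D ^ 2 * Y ≤ Y ^ 2 * Y := by gcongr
      have h5 : Y ^ 2 * Y ≤ 2 * Y ^ 4 := by nlinarith
      exact mul_le_mul_of_nonneg_left (h4.trans h5) (by positivity)
    have h6 : 11 / X ^ 4 ≤ 2 * (11 / Y ^ 4) := by
      rw [← mul_div_assoc, div_le_div_iff₀ hXpos4 hYpos4]; linarith
    have h7 : |Real.log (X ^ 4) - Real.log (Y ^ 4)| / 2 ≤ D ^ 4 / Y ^ 4 := by
      have : 2 * D ^ 4 / Y ^ 4 = 2 * (D ^ 4 / Y ^ 4) := by ring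
      linarith
    have h8 : (1 + D ^ 2) / Y = 1 / Y + D ^ 2 / Y := by rw [add_div]
    have h9 : 0 ≤ D ^ 2 / Y := by positivity
    have h10 : 0 ≤ 1 / Y := by positivity
    rw [h8]
    linarith
  · have hDpos : 0 < D := by
      rcases hD.eq_or_lt with h | h
      · rw [← h] at hcase; norm_num at hcase; linarith
      · exact h
    have hYD : Y ≤ 1.2 * D := by
      by_contra h
      push Not at h
      have : (1.2 * D) ^ 4 < Y ^ 4 := by gcongr
      have e : (1.2 * D) ^ 4 = 2.0736 * D ^ 4 := by ring
      rw [e] at this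
      linarith [pow_nonneg hD 4]
    have hXD : X ≤ 1.4 * D := by
      by_contra h
      push Not at h
      have : (1.4 * D) ^ 4 < X ^ 4 := by gcongr
      have e : (1.4 * D) ^ 4 = 3.8416 * D ^ 4 := by ring
      rw [e] at this
      linarith [pow_nonneg hD 4]
    have hlogX : ∀ Z : ℝ, 0.8 ≤ Z → |Real.log (Z ^ 4)| ≤ 4 * Z := by
      intro Z hZ
      have hZ0 : 0 < Z := by linarith
      rw [Real.log_pow, abs_le]
      have h1 := Real.log_le_sub_one_of_pos hZ0
      have h2 := Real.one_sub_inv_le_log_of_pos hZ0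
      have h3 : Z⁻¹ ≤ 1.25 := by
        rw [inv_le_comm₀ hZ0 (by norm_num)]; norm_num; linarith
      push_cast
      constructor <;> linarith
    have h1 : |Real.log (X ^ 4) - Real.log (Y ^ 4)| ≤ 4 * X + 4 * Y :=
      (abs_sub _ _).trans (add_le_add (hlogX X hXl) (hlogX Y hYl))
    have h2 : 11 / X ^ 4 ≤ 22 := by rw [div_le_iff₀ hXpos4]; linarith
    have h3 : 11 / Y ^ 4 ≤ 22 := by rw [div_le_iff₀ hYpos4]; linarith
    have h4 : |Real.log (X ^ 4) - Real.log (Y ^ 4)| / 2 + 11 / X ^ 4 + 11 / Y ^ 4 ≤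
        5.2 * D + 44 := by linarith
    refine h4.trans ?_
    rw [← mul_div_assoc, le_div_iff₀ hY]
    have hDl : 0.66 ≤ D := by linarith
    have h5 : (5.2 * D + 44) * Y ≤ (5.2 * D + 44) * (1.2 * D) := by gcongr
    nlinarith

/-- The archimedean factor varies slowly. -/
lemma abs_re_archFactor_sub_le {w s : ℂ} (hw : 1 / 2 ≤ w.re) (hs : 1 / 2 ≤ s.re) :
    |(archFactor w).re - (archFactor s).re| ≤ 100 * ((1 + √‖w - s‖) / √(√‖s‖)) := by
  have hw1 : 1 / 2 ≤ ‖w‖ := hw.trans (re_le_norm w)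
  have hs1 : 1 / 2 ≤ ‖s‖ := hs.trans (re_le_norm s)
  have e4 : ∀ x : ℝ, 0 ≤ x → √(√x) ^ 4 = x := fun x hx => by
    rw [show √(√x) ^ 4 = (√(√x) ^ 2) ^ 2 by ring, Real.sq_sqrt (Real.sqrt_nonneg _),
      Real.sq_sqrt hx]
  have h := abs_log_sub_log_add_le (X := √(√‖w‖)) (Y := √(√‖s‖)) (D := √(√‖w - s‖))
    (by positivity) (by positivity) (by positivity)
    (by rw [e4 _ (norm_nonneg _)]; exact hw1) (by rw [e4 _ (norm_nonneg _)]; exact hs1)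
    (by rw [e4 _ (norm_nonneg _), e4 _ (norm_nonneg _), e4 _ (norm_nonneg _)]
        exact abs_norm_sub_norm_le w s)
  rw [e4 _ (norm_nonneg _), e4 _ (norm_nonneg _), Real.sq_sqrt (Real.sqrt_nonneg _)] at h
  refine le_trans ?_ h
  have h1 := abs_le.mp (abs_re_archFactor_sub_le_log hw)
  have h2 := abs_le.mp (abs_re_archFactor_sub_le_log hs)
  have h3 := le_abs_self (Real.log ‖w‖ - Real.log ‖s‖)
  have h4 := neg_le_abs (Real.log ‖w‖ - Real.log ‖s‖)
  rw [abs_le]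
  constructor <;> linarith

/-! ### The Poisson representation of `Re ξ'/ξ` -/

lemma exists_norm_logDeriv_le_sqrt (hRH : RiemannHypothesis) {σ₀ : ℝ} (h0 : 1 / 2 < σ₀) :
    ∃ C : ℝ, 0 ≤ C ∧ ∀ w : ℂ, σ₀ ≤ w.re → ‖logDeriv riemannZeta₁ w‖ ≤ C * √‖w‖ := by
  obtain ⟨C, hC, h⟩ := exists_norm_logDeriv_riemannZeta₁_le hRH h0
  refine ⟨C * 8, by positivity, fun w hw => (h w hw).trans ?_⟩
  rw [mul_assoc]
  gcongr
  exact log_abs_im_add_five_le (by linarith)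

lemma exists_norm_xiLogDeriv_le_sqrt (hRH : RiemannHypothesis) {σ₀ : ℝ} (h0 : 1 / 2 < σ₀) :
    ∃ C : ℝ, 0 ≤ C ∧ ∀ w : ℂ, σ₀ ≤ w.re → ‖xiLogDeriv w‖ ≤ C * √‖w‖ := by
  obtain ⟨C, hC, h⟩ := exists_norm_logDeriv_le_sqrt hRH h0
  obtain ⟨C', hC', h'⟩ := exists_norm_archFactor_le
  refine ⟨C + C', by positivity, fun w hw => ?_⟩
  rw [add_mul]
  exact (norm_add_le _ _).trans (add_le_add (h w hw) (h' w (by linarith)))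

lemma differentiableAt_xiLogDeriv (hRH : RiemannHypothesis) {s : ℂ} (hs : 1 / 2 < s.re) :
    DifferentiableAt ℂ xiLogDeriv s :=
  (differentiableAt_logDeriv_riemannZeta₁ hRH hs).add (differentiableAt_archFactor (by linarith))

lemma integral_re_xiLogDeriv (hRH : RiemannHypothesis) {σ₀ a : ℝ} (h0 : 1 / 2 < σ₀) (ha : 0 < a)
    (t : ℝ) :
    Integrable (fun τ : ℝ => (xiLogDeriv (σ₀ + τ * I)).re * (1 / (a ^ 2 + (τ - t) ^ 2))) ∧
    ∫ τ : ℝ, (xiLogDeriv (σ₀ + τ * I)).re * (1 / (a ^ 2 + (τ - t) ^ 2)) =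
      (xiLogDeriv (σ₀ + a + t * I)).re * (Real.pi / a) := by
  obtain ⟨C, hC, hb⟩ := exists_norm_xiLogDeriv_le_sqrt hRH h0
  obtain ⟨h1, h2⟩ := integral_poisson (f := xiLogDeriv) h0
    (fun w hw => (differentiableAt_xiLogDeriv hRH hw).differentiableWithinAt) hC hb ha t
  have e : ∀ τ : ℝ, (xiLogDeriv (σ₀ + τ * I)).re * (1 / (a ^ 2 + (τ - t) ^ 2)) =
      reCLM (xiLogDeriv (σ₀ + τ * I) * ((1 / (a ^ 2 + (τ - t) ^ 2) : ℝ) : ℂ)) := fun τ => by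
    rw [reCLM_apply, re_mul_ofReal]
  simp_rw [e]
  refine ⟨h1.re, ?_⟩
  rw [ContinuousLinearMap.integral_comp_comm _ h1, h2, reCLM_apply,
    show (Real.pi : ℂ) / a = ((Real.pi / a : ℝ) : ℂ) by push_cast; rfl, re_mul_ofReal]

/-- `a Re ξ'/ξ(σ₀ + a + it)` is increasing in `a`. -/
lemma mul_re_xiLogDeriv_mono (hRH : RiemannHypothesis) {σ₀ a b : ℝ} (h0 : 1 / 2 < σ₀) (ha : 0 < a)
    (hab : a ≤ b) (t : ℝ) :
    a * (xiLogDeriv (σ₀ + a + t * I)).re ≤ b * (xiLogDeriv (σ₀ + b + t * I)).re := by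
  have hb : 0 < b := ha.trans_le hab
  obtain ⟨hi1, h1⟩ := integral_re_xiLogDeriv hRH h0 ha t
  obtain ⟨hi2, h2⟩ := integral_re_xiLogDeriv hRH h0 hb t
  have h3 := integral_mono (hi1.const_mul (a ^ 2)) (hi2.const_mul (b ^ 2)) fun τ => by
    have hn := re_xiLogDeriv_nonneg hRH (s := σ₀ + τ * I) (by simpa using h0)
    -- After multiplication by a², the Poisson kernel increases with a pointwise, and it is
    -- integrated against a nonnegative function.
    have h4 : a ^ 2 * (1 / (a ^ 2 + (τ - t) ^ 2)) ≤ b ^ 2 * (1 / (b ^ 2 + (τ - t) ^ 2)) := by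
      rw [mul_one_div, mul_one_div, div_le_div_iff₀ (by positivity) (by positivity)]
      have : a ^ 2 ≤ b ^ 2 := by gcongr
      nlinarith [sq_nonneg (τ - t)]
    calc _ = (xiLogDeriv (σ₀ + τ * I)).re * (a ^ 2 * (1 / (a ^ 2 + (τ - t) ^ 2))) := by ring
      _ ≤ (xiLogDeriv (σ₀ + τ * I)).re * (b ^ 2 * (1 / (b ^ 2 + (τ - t) ^ 2))) := by gcongr
      _ = _ := by ring
  rw [integral_const_mul, integral_const_mul, h1, h2] at h3
  have e1 : a ^ 2 * ((xiLogDeriv (σ₀ + a + t * I)).re * (Real.pi / a)) =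
      Real.pi * (a * (xiLogDeriv (σ₀ + a + t * I)).re) := by field_simp
  have e2 : b ^ 2 * ((xiLogDeriv (σ₀ + b + t * I)).re * (Real.pi / b)) =
      Real.pi * (b * (xiLogDeriv (σ₀ + b + t * I)).re) := by field_simp
  rw [e1, e2] at h3
  exact le_of_mul_le_mul_left h3 Real.pi_pos

/-! ### Selberg's inequality for `ζ₁'/ζ₁` -/

lemma integrable_one_add_abs_sub_rpow (t : ℝ) :
    Integrable (fun τ : ℝ => (1 + |τ - t|) ^ (-(3 / 2) : ℝ)) := by
  have h : Integrable (fun u : ℝ => (1 + ‖u‖) ^ (-(3 / 2) : ℝ)) :=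
    integrable_one_add_norm (by norm_num)
  exact h.comp_sub_right t

/-- Gives an integrable majorant for the variation of the archimedean factor against the kernel: √d
is at most 2 for d ≤ 4, and beyond that √d/d² = d^{-3/2} is comparable with (1 + |u|)^{-3/2}. -/
lemma one_add_sqrt_div_sq_le {a u d : ℝ} (ha : 0 < a) (hd : 0 ≤ d) (h : d ^ 2 = a ^ 2 + u ^ 2) :
    (1 + √d) * (1 / (a ^ 2 + u ^ 2)) ≤
      3 * (1 / (a ^ 2 + u ^ 2)) + 3 * (1 + |u|) ^ (-(3 / 2) : ℝ) := by
  have hpos : 0 < a ^ 2 + u ^ 2 := by positivity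
  have hdpos : 0 < d := by
    rcases hd.eq_or_lt with h' | h'
    · rw [← h'] at h; norm_num at h; linarith
    · exact h'
  have hr : 0 ≤ (1 + |u|) ^ (-(3 / 2) : ℝ) := by positivity
  rcases le_or_gt d 4 with h4 | h4
  · have : √d ≤ 2 := Real.sqrt_le_iff.mpr ⟨by norm_num, by linarith⟩
    have h1 : (1 + √d) * (1 / (a ^ 2 + u ^ 2)) ≤ 3 * (1 / (a ^ 2 + u ^ 2)) := by
      gcongr; linarith
    linarith
  · have hu : |u| ≤ d := abs_le_of_sq_le_sq (by nlinarith) hd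
    have e : √d * (1 / (a ^ 2 + u ^ 2)) = d ^ (-(3 / 2) : ℝ) := by
      have e1 : 1 / d ^ 2 = d ^ (-2 : ℝ) := by
        rw [Real.rpow_neg hd, one_div]; norm_cast
      rw [← h, Real.sqrt_eq_rpow, e1, ← Real.rpow_add hdpos]
      norm_num
    have h2 : d ^ (-(3 / 2) : ℝ) ≤ ((1 + |u|) / 2) ^ (-(3 / 2) : ℝ) :=
      Real.rpow_le_rpow_of_nonpos (by positivity) (by linarith) (by norm_num)
    have h3 : ((1 + |u|) / 2) ^ (-(3 / 2) : ℝ) ≤ 3 * (1 + |u|) ^ (-(3 / 2) : ℝ) := by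
      rw [Real.div_rpow (by positivity) (by norm_num), div_le_iff₀ (by positivity)]
      have h5 : 1 ≤ 3 * (2 : ℝ) ^ (-(3 / 2) : ℝ) := by
        have e1 : (2 : ℝ) ^ (-(3 / 2) : ℝ) = 1 / (2 * √2) := by
          rw [Real.sqrt_eq_rpow, Real.rpow_neg (by norm_num), one_div,
            show (3 / 2 : ℝ) = 1 + 1 / 2 by norm_num, Real.rpow_add (by norm_num), Real.rpow_one]
        have e2 : √2 ≤ 1.5 := Real.sqrt_le_iff.mpr ⟨by norm_num, by norm_num⟩
        rw [e1, mul_one_div, le_div_iff₀ (by positivity)]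
        linarith
      nlinarith
    have h6 : 0 ≤ 1 / (a ^ 2 + u ^ 2) := by positivity
    rw [add_mul, e]
    linarith

lemma norm_smoothKernel_line_le {a ℓ : ℝ} (hℓ : 0 < ℓ) (u : ℝ) :
    ‖smoothKernel ℓ (-a + u * I)‖ ≤
      (Real.exp (-(a * ℓ)) + Real.exp (-(2 * a * ℓ))) / ℓ * (1 / (a ^ 2 + u ^ 2)) := by
  refine (norm_smoothKernel_le hℓ _).trans (le_of_eq ?_)
  have e : ‖(-a + u * I : ℂ)‖ ^ 2 = a ^ 2 + u ^ 2 := by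
    rw [← normSq_eq_norm_sq, normSq_apply]; simp; ring
  rw [e]
  simp only [add_re, neg_re, ofReal_re, mul_re, I_re, mul_zero, ofReal_im, I_im, mul_one, sub_self,
    add_zero]
  rw [show 2 * ℓ * -a = -(2 * a * ℓ) by ring, show ℓ * -a = -(a * ℓ) by ring, div_mul_div_comm,
    mul_one, add_comm (Real.exp _)]

/-- On the left line the modulus of the kernel is bounded by a multiple of the Poisson kernel. Once
ζ₁'/ζ₁ has been exchanged for 2 Re ξ'/ξ, positivity lets the absolute value pass inside the integral
at no cost, and Poisson's formula evaluates the result. The number 1200 is 2·2·100·3. -/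
lemma norm_integral_re_logDeriv_mul_smoothKernel_le (hRH : RiemannHypothesis) {σ₀ a ℓ t : ℝ}
    (h0 : 1 / 2 < σ₀) (ha : 0 < a) (hℓ : 1 ≤ ℓ) (ht : 1 ≤ t) :
    ‖∫ τ : ℝ, logDeriv riemannZeta₁ (σ₀ + τ * I) * smoothKernel ℓ (-a + (τ - t) * I)‖ ≤
      2 * ((Real.exp (-(a * ℓ)) + Real.exp (-(2 * a * ℓ))) / ℓ *
        ((xiLogDeriv (σ₀ + a + t * I)).re * (Real.pi / a))) +
      1200 * (Real.pi / a + ∫ u : ℝ, (1 + |u|) ^ (-(3 / 2) : ℝ)) / √(√t) := by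
  obtain ⟨C, hC, hb⟩ := exists_norm_logDeriv_le_sqrt hRH h0
  have hℓ0 : 0 < ℓ := by linarith
  set s : ℂ := σ₀ + a + t * I with hs
  set E := (Real.exp (-(a * ℓ)) + Real.exp (-(2 * a * ℓ))) / ℓ with hE
  have hE0 : 0 ≤ E := by positivity
  have hE2 : E ≤ 2 := by
    rw [hE, div_le_iff₀ hℓ0]
    have h1 : Real.exp (-(a * ℓ)) ≤ 1 := Real.exp_le_one_iff.mpr (by nlinarith)
    have h2 : Real.exp (-(2 * a * ℓ)) ≤ 1 := Real.exp_le_one_iff.mpr (by nlinarith)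
    linarith
  obtain ⟨i1, -⟩ := integral_mul_smoothKernel (f := logDeriv riemannZeta₁) h0
    (fun w hw => (differentiableAt_logDeriv_riemannZeta₁ hRH hw).differentiableWithinAt) hC
    (fun w hw _ => hb w hw) ha hℓ0 (show σ₀ + a < σ₀ + a + 1 by linarith) t
  obtain ⟨i2, z2⟩ := integral_conj_mul_smoothKernel (f := logDeriv riemannZeta₁) (σ₀ := σ₀)
    (fun w hw => differentiableAt_logDeriv_riemannZeta₁ hRH (by linarith)) hC
    (fun w hw _ => hb w hw) ha hℓ0 t
  obtain ⟨i3, z3⟩ := integral_conj_mul_smoothKernel (f := fun _ => (1 : ℂ)) (σ₀ := σ₀) (C := 1)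
    (fun w hw => by fun_prop) zero_le_one
    (fun w hw h1 => by rw [norm_one, one_mul]; exact Real.one_le_sqrt.mpr h1) ha hℓ0 t
  simp only [map_one, one_mul] at i3 z3
  -- Adding the conjugate of ζ₁'/ζ₁ and a constant changes nothing, since both integrate to zero
  -- against the kernel. The constant 2 Re `archFactor s` is chosen so that only the variation of
  -- the archimedean factor around s remains.
  have key : ∫ τ : ℝ, logDeriv riemannZeta₁ (σ₀ + τ * I) * smoothKernel ℓ (-a + (τ - t) * I) =
      ∫ τ : ℝ, ((2 * ((xiLogDeriv (σ₀ + τ * I)).re - ((archFactor (σ₀ + τ * I)).re -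
        (archFactor s).re)) : ℝ) : ℂ) * smoothKernel ℓ (-a + (τ - t) * I) := by
    have := integral_add (i1.add i2) (i3.const_mul (2 * ((archFactor s).re : ℂ)))
    simp only [Pi.add_apply] at this
    rw [integral_add i1 i2, integral_const_mul, z2, z3, mul_zero, add_zero, add_zero] at this
    rw [← this]
    congr 1
    ext τ
    have e : (logDeriv riemannZeta₁ (σ₀ + τ * I)) +
        (starRingEnd ℂ) (logDeriv riemannZeta₁ (σ₀ + τ * I)) =
        ((2 * ((xiLogDeriv (σ₀ + τ * I)).re - (archFactor (σ₀ + τ * I)).re) : ℝ) : ℂ) := by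
      rw [add_conj, xiLogDeriv, add_re]; push_cast; ring
    rw [← add_mul, e, ← add_mul]
    push_cast; ring
  rw [key]
  have hsq : √(√t) ≤ √(√‖s‖) := by
    gcongr
    calc t ≤ |s.im| := by simp [hs]; exact le_abs_self t
      _ ≤ _ := abs_im_le_norm s
  have htp : 0 < √(√t) := by positivity
  obtain ⟨j1, v1⟩ := integral_re_xiLogDeriv hRH h0 ha t
  have j2 := integrable_lorentz ha t
  have j3 := integrable_one_add_abs_sub_rpow t
  have j4 : Integrable (fun τ : ℝ => 100 / √(√t) * (3 * (1 / (a ^ 2 + (τ - t) ^ 2)) +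
      3 * (1 + |τ - t|) ^ (-(3 / 2) : ℝ))) :=
    ((j2.const_mul 3).add (j3.const_mul 3)).const_mul (100 / √(√t))
  have hB := norm_integral_le_of_norm_le
    (f := fun τ : ℝ => ((2 * ((xiLogDeriv (σ₀ + τ * I)).re - ((archFactor (σ₀ + τ * I)).re -
        (archFactor s).re)) : ℝ) : ℂ) * smoothKernel ℓ (-a + (τ - t) * I))
    ((j1.add j4).const_mul (2 * E)) (Eventually.of_forall fun τ => by
    simp only [Pi.add_apply]
    have hn := re_xiLogDeriv_nonneg hRH (s := σ₀ + τ * I) (by simpa using h0)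
    have hk := norm_smoothKernel_line_le (a := a) hℓ0 (τ - t)
    rw [← hE] at hk
    push_cast at hk
    have hG := abs_re_archFactor_sub_le (w := σ₀ + τ * I) (s := s) (by simp; linarith)
      (by simp [hs]; linarith)
    set d := ‖(σ₀ + τ * I : ℂ) - s‖ with hd
    have hd2 : d ^ 2 = a ^ 2 + (τ - t) ^ 2 := by
      rw [hd, ← normSq_eq_norm_sq, normSq_apply]; simp [hs]; ring
    have hfin := one_add_sqrt_div_sq_le ha (norm_nonneg _) hd2
    have hG' : |(archFactor (σ₀ + τ * I)).re - (archFactor s).re| ≤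
        100 / √(√t) * (1 + √d) := by
      refine hG.trans ?_
      rw [← mul_div_assoc, div_mul_eq_mul_div]
      gcongr
    have hp : 0 ≤ 1 / (a ^ 2 + (τ - t) ^ 2) := by positivity
    rw [norm_mul, norm_real, Real.norm_eq_abs, abs_mul, abs_two]
    have h1 : |(xiLogDeriv (σ₀ + τ * I)).re - ((archFactor (σ₀ + τ * I)).re -
        (archFactor s).re)| ≤ (xiLogDeriv (σ₀ + τ * I)).re + 100 / √(√t) * (1 + √d) := by
      refine (abs_sub _ _).trans ?_
      rw [abs_of_nonneg hn]
      gcongr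
    calc _ ≤ 2 * ((xiLogDeriv (σ₀ + τ * I)).re + 100 / √(√t) * (1 + √d)) *
          (E * (1 / (a ^ 2 + (τ - t) ^ 2))) := by gcongr
      _ = 2 * E * ((xiLogDeriv (σ₀ + τ * I)).re * (1 / (a ^ 2 + (τ - t) ^ 2)) +
          100 / √(√t) * ((1 + √d) * (1 / (a ^ 2 + (τ - t) ^ 2)))) := by ring
      _ ≤ _ := by gcongr)
  refine hB.trans ?_
  rw [integral_const_mul]
  simp only [Pi.add_apply]
  rw [integral_add j1 j4, v1, integral_const_mul, integral_add (j2.const_mul 3) (j3.const_mul 3), integral_const_mul, integral_const_mul,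
    integral_lorentz ha t, integral_sub_right_eq_self (fun u : ℝ => (1 + |u|) ^ (-(3 / 2) : ℝ)) t]
  set J := ∫ u : ℝ, (1 + |u|) ^ (-(3 / 2) : ℝ) with hJ
  have hJ0 : 0 ≤ J := integral_nonneg fun u => by positivity
  have hX : 0 ≤ 100 / √(√t) * (3 * (Real.pi / a) + 3 * J) := by positivity
  calc _ = 2 * (E * ((xiLogDeriv s).re * (Real.pi / a))) +
        2 * E * (100 / √(√t) * (3 * (Real.pi / a) + 3 * J)) := by ring
    _ ≤ 2 * (E * ((xiLogDeriv s).re * (Real.pi / a))) +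
        2 * 2 * (100 / √(√t) * (3 * (Real.pi / a) + 3 * J)) := by gcongr
    _ = _ := by ring

/-- `ζ₁` has a bounded logarithmic derivative to the right of any line in `Re s > 1`. -/
lemma exists_norm_logDeriv_riemannZeta₁_le_const {σ₁ : ℝ} (h : 1 < σ₁) :
    ∃ C : ℝ, 0 < C ∧ ∀ s : ℂ, σ₁ ≤ s.re → ‖logDeriv riemannZeta₁ s‖ ≤ C := by
  obtain ⟨C, hC, hb⟩ := exists_norm_logDeriv_riemannZeta_le h
  refine ⟨C + 1 / (σ₁ - 1), by have : 0 < σ₁ - 1 := by linarith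
                               positivity, fun s hs => ?_⟩
  have hs1 : s ≠ 1 := by rintro rfl; simp at hs; linarith
  rw [logDeriv_riemannZeta₁ hs1 (riemannZeta_ne_zero_of_one_le_re (by linarith))]
  refine (norm_add_le _ _).trans (add_le_add ((hb s hs).trans ?_) ?_)
  · have : (2 : ℝ) ^ (-s.re) ≤ 1 := Real.rpow_le_one_of_one_le_of_nonpos (by norm_num) (by linarith)
    nlinarith
  · rw [norm_div, norm_one]
    have h1 : σ₁ - 1 ≤ ‖s - 1‖ := by
      refine le_trans ?_ (re_le_norm _)
      simp; linarith
    have : 0 < σ₁ - 1 := by linarith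
    gcongr

lemma norm_logDeriv_riemannZeta₁_le_of_re_xiLogDeriv (hRH : RiemannHypothesis) {η : ℝ} (hη : 0 < η) :
    ∃ C : ℝ, 0 < C ∧ ∀ σ₀ a t ℓ : ℝ, 1 / 2 < σ₀ → σ₀ ≤ 1 / 2 + η / 4 → 0 < a →
      a ≤ 1 / 2 + η / 4 → 1 ≤ ℓ → 1 ≤ t →
      ‖logDeriv riemannZeta₁ (σ₀ + a + t * I)‖ ≤
        (Real.exp (-(a * ℓ)) + Real.exp (-(2 * a * ℓ))) / (a * ℓ) *
          (xiLogDeriv (σ₀ + a + t * I)).re +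
        C * (1 + 1 / a) / √(√t) + C * Real.exp (2 * ℓ * (1 / 2 + η)) := by
  obtain ⟨D, hD, hbD⟩ := exists_norm_logDeriv_riemannZeta₁_le_const (σ₁ := 1 + η) (by linarith)
  set J := ∫ u : ℝ, (1 + |u|) ^ (-(3 / 2) : ℝ) with hJ
  have hJ0 : 0 ≤ J := integral_nonneg fun u => by positivity
  refine ⟨600 * (1 + J) + D * (2 / η), by positivity, fun σ₀ a t ℓ h0 h0' ha ha' hℓ ht => ?_⟩
  -- This constant degenerates as σ₀ → 1/2, but it serves only for convergence and contour shifting;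
  -- the final constant does not contain it and is uniform in σ₀.
  obtain ⟨C, hC, hb⟩ := exists_norm_logDeriv_le_sqrt hRH h0
  have hℓ0 : 0 < ℓ := by linarith
  obtain ⟨-, hid⟩ := integral_mul_smoothKernel (f := logDeriv riemannZeta₁) h0
    (fun w hw => (differentiableAt_logDeriv_riemannZeta₁ hRH hw).differentiableWithinAt) hC
    (fun w hw _ => hb w hw) ha hℓ0 (show σ₀ + a < 1 + η by linarith) t
  have h1 := norm_integral_re_logDeriv_mul_smoothKernel_le hRH h0 ha hℓ ht
  rw [← hJ] at h1
  set b := 1 + η - σ₀ - a with hbdef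
  -- b is the distance from the point to the line Re w = 1 + η; it stays at least η/2 because σ₀ and
  -- a each exceed 1/2 by at most η/4.
  have hb0 : η / 2 ≤ b := by linarith
  have hbp : 0 < b := by linarith
  have hb1 : b ≤ 1 / 2 + η := by linarith
  set X := Real.exp (2 * ℓ * (1 / 2 + η)) with hX
  have h2 : ‖∫ τ : ℝ, logDeriv riemannZeta₁ ((1 + η : ℝ) + τ * I) *
      smoothKernel ℓ ((1 + η : ℝ) + τ * I - (σ₀ + a + t * I))‖ ≤
      D * (2 * X) * (Real.pi / b) := by
    rw [← integral_lorentz hbp t, ← integral_const_mul]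
    refine norm_integral_le_of_norm_le ((integrable_lorentz hbp t).const_mul _)
      (Eventually.of_forall fun τ => ?_)
    set z : ℂ := (1 + η : ℝ) + τ * I - (σ₀ + a + t * I) with hz
    have hre : z.re = b := by simp [hz, hbdef]; ring
    have hn : ‖z‖ ^ 2 = b ^ 2 + (τ - t) ^ 2 := by
      rw [← normSq_eq_norm_sq, normSq_apply, hre]; simp [hz]; ring
    have hk := norm_smoothKernel_le_of_re_le hℓ0 hbp.le hre.le
    rw [hn] at hk
    rw [norm_mul, mul_assoc]
    have hk' : ‖smoothKernel ℓ z‖ ≤ 2 * X * (1 / (b ^ 2 + (τ - t) ^ 2)) := by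
      refine hk.trans ?_
      rw [mul_one_div]
      gcongr
      rw [div_le_iff₀ hℓ0]
      have : Real.exp (2 * ℓ * b) ≤ X := by rw [hX]; gcongr
      nlinarith [Real.exp_pos (2 * ℓ * (1 / 2 + η))]
    gcongr
    exact hbD _ (by simp)
  have h3 : 2 * Real.pi * ‖logDeriv riemannZeta₁ (σ₀ + a + t * I)‖ ≤
      D * (2 * X) * (Real.pi / b) +
      (2 * ((Real.exp (-(a * ℓ)) + Real.exp (-(2 * a * ℓ))) / ℓ *
        ((xiLogDeriv (σ₀ + a + t * I)).re * (Real.pi / a))) +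
      1200 * (Real.pi / a + J) / √(√t)) := by
    have e : 2 * Real.pi * ‖logDeriv riemannZeta₁ (σ₀ + a + t * I)‖ =
        ‖2 * Real.pi * logDeriv riemannZeta₁ (σ₀ + a + t * I)‖ := by
      rw [norm_mul, norm_mul, norm_real, Real.norm_eq_abs, abs_of_pos Real.pi_pos]; simp
    rw [e, hid]
    exact (norm_sub_le _ _).trans (add_le_add h2 h1)
  have hpi := Real.pi_gt_three
  have h4 : D * (2 * X) * (Real.pi / b) ≤ 2 * Real.pi * (D * (2 / η) * X) := by
    have : 1 / b ≤ 2 / η := by rw [div_le_div_iff₀ hbp hη]; linarith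
    calc _ = 2 * Real.pi * (D * (1 / b) * X) := by ring
      _ ≤ _ := by gcongr
  have h5 : 1200 * (Real.pi / a + J) / √(√t) ≤
      2 * Real.pi * (600 * (1 + J) * (1 + 1 / a) / √(√t)) := by
    rw [← mul_div_assoc]
    gcongr ?_ / _
    have : 0 ≤ 1 / a := by positivity
    have e : Real.pi / a = Real.pi * (1 / a) := by ring
    rw [e]
    have h6 : Real.pi * (1 / a) + J ≤ Real.pi * ((1 + J) * (1 + 1 / a)) := by
      nlinarith [mul_nonneg hJ0 this, mul_nonneg (mul_nonneg hJ0 this) Real.pi_pos.le,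
        mul_nonneg hJ0 (by linarith : (0:ℝ) ≤ Real.pi - 1)]
    linarith
  have h7 : 2 * ((Real.exp (-(a * ℓ)) + Real.exp (-(2 * a * ℓ))) / ℓ *
        ((xiLogDeriv (σ₀ + a + t * I)).re * (Real.pi / a))) =
      2 * Real.pi * ((Real.exp (-(a * ℓ)) + Real.exp (-(2 * a * ℓ))) / (a * ℓ) *
          (xiLogDeriv (σ₀ + a + t * I)).re) := by
    field_simp
  rw [h7] at h3
  have h8 : ‖logDeriv riemannZeta₁ (σ₀ + a + t * I)‖ ≤ D * (2 / η) * X +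
      ((Real.exp (-(a * ℓ)) + Real.exp (-(2 * a * ℓ))) / (a * ℓ) *
          (xiLogDeriv (σ₀ + a + t * I)).re + 600 * (1 + J) * (1 + 1 / a) / √(√t)) := by
    refine le_of_mul_le_mul_left ?_ (by positivity : 0 < 2 * Real.pi)
    rw [mul_add, mul_add]
    linarith
  refine h8.trans ?_
  have h9 : 600 * (1 + J) * (1 + 1 / a) / √(√t) ≤
      (600 * (1 + J) + D * (2 / η)) * (1 + 1 / a) / √(√t) := by
    gcongr
    linarith [show 0 ≤ D * (2 / η) by positivity]
  have h10 : D * (2 / η) * X ≤ (600 * (1 + J) + D * (2 / η)) * X := by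
    gcongr
    linarith
  linarith

/-! ### Pointwise bounds close to the critical line -/

lemma riemannZeta_ne_zero_of_RH (hRH : RiemannHypothesis) {s : ℂ} (hs : 1 / 2 < s.re)
    (hs1 : s ≠ 1) : riemannZeta s ≠ 0 := by
  rw [← exp_logZeta hRH hs hs1]
  exact exp_ne_zero _

lemma kappa_eq : kappa = Real.exp (-1) + Real.exp (-2) := by
  have e : Real.exp (-2) = Real.exp (-1) * Real.exp (-1) := by rw [← Real.exp_add]; norm_num
  rw [kappa, e, Real.exp_neg]
  ring

/-- This is what allows κ Re ξ'/ξ to be absorbed into the left side. -/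
lemma kappa_lt_one : kappa < 1 := by
  rw [kappa, one_div (Real.exp 1)]
  have h1 : (2.7 : ℝ) < Real.exp 1 := by linarith [Real.exp_one_gt_d9]
  have h2 : (Real.exp 1)⁻¹ < 0.4 := by
    rw [inv_lt_comm₀ (by positivity) (by norm_num)]; norm_num; linarith
  have h3 : 0 < (Real.exp 1)⁻¹ := by positivity
  nlinarith

/-- Ensures 1/(1 - κ) ≥ 2, so that the bound P for Re ξ'/ξ is at least log t. -/
lemma half_le_kappa : 1 / 2 ≤ kappa := by
  rw [kappa, one_div (Real.exp 1)]
  have h1 : Real.exp 1 < 2.72 := by linarith [Real.exp_one_lt_d9]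
  have h2 : 0.367 < (Real.exp 1)⁻¹ := by
    rw [lt_inv_comm₀ (by norm_num) (by positivity)]; norm_num; linarith
  nlinarith

/-- The weight `(e^{-b} + e^{-2b}) / b` is at most `κ` for `b ≥ 1`. -/
lemma weight_le_kappa {b : ℝ} (hb : 1 ≤ b) :
    (Real.exp (-b) + Real.exp (-(2 * b))) / b ≤ kappa := by
  rw [kappa_eq, div_le_iff₀ (by linarith)]
  have h1 : Real.exp (-b) ≤ Real.exp (-1) := by gcongr
  have h2 : Real.exp (-(2 * b)) ≤ Real.exp (-2) := by gcongr; linarith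
  nlinarith [Real.exp_pos (-1), Real.exp_pos (-2)]

lemma log_le_four_mul_sqrt_sqrt {t : ℝ} (ht : 1 ≤ t) : Real.log t ≤ 4 * √(√t) := by
  have h1 : Real.log t = 2 * Real.log (√t) := by rw [Real.log_sqrt (by linarith)]; ring
  have h2 := log_le_two_mul_sqrt (x := √t) (by positivity)
  linarith

/-- Stirling: Re ξ'/ξ is Re ζ'/ζ plus the archimedean contribution, which is (log t)/2 + O(1), and
the pole term 1/(s - 1), which is bounded for t ≥ 1. -/
lemma abs_re_logDeriv_sub_le (hRH : RiemannHypothesis) {s : ℂ} (hs : 1 / 2 < s.re)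
    (hs2 : s.re ≤ 2) (ht : 1 ≤ s.im) :
    |(logDeriv riemannZeta s).re - (xiLogDeriv s).re + Real.log s.im / 2| ≤ 20 := by
  have hs1 : s ≠ 1 := by rintro rfl; norm_num at ht
  have hn : s.im ≤ ‖s‖ := (le_abs_self _).trans (abs_im_le_norm s)
  have hn' : ‖s‖ ≤ 3 * s.im := by
    have := norm_le_abs_re_add_abs_im s
    rw [abs_of_pos (by linarith : 0 < s.re), abs_of_pos (by linarith : 0 < s.im)] at this
    linarith
  have hn1 : 1 ≤ ‖s‖ := ht.trans hn
  have h1 := abs_le.mp (abs_re_archFactor_sub_le_log hs.le)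
  have h2 := logDeriv_riemannZeta₁ hs1 (riemannZeta_ne_zero_of_RH hRH hs hs1)
  have h3 : (xiLogDeriv s).re = (logDeriv riemannZeta s).re + (1 / (s - 1)).re +
      (archFactor s).re := by rw [xiLogDeriv, h2, add_re, add_re]
  have h4 : |(1 / (s - 1)).re| ≤ 1 := by
    refine (abs_re_le_norm _).trans ?_
    rw [norm_div, norm_one, div_le_one₀ (norm_pos_iff.mpr (sub_ne_zero.mpr hs1))]
    refine ht.trans ((le_abs_self _).trans ((le_of_eq ?_).trans (abs_im_le_norm _)))
    simp
  have h5 := Real.log_le_log (by linarith) hn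
  have h6 : Real.log ‖s‖ ≤ 2 + Real.log s.im := by
    have := Real.log_le_log (by linarith) hn'
    rw [Real.log_mul (by norm_num) (by linarith)] at this
    linarith [Real.log_le_sub_one_of_pos (show (0 : ℝ) < 3 by norm_num)]
  have h7 : 11 / ‖s‖ ≤ 11 := div_le_self (by norm_num) hn1
  have h8 : 0 ≤ Real.log (2 * Real.pi) := Real.log_nonneg (by linarith [Real.pi_gt_three])
  have h9 : Real.log (2 * Real.pi) ≤ 7 := by
    have := Real.log_le_sub_one_of_pos (show (0 : ℝ) < 2 * Real.pi by positivity)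
    linarith [Real.pi_lt_four]
  rw [abs_le] at h4
  rw [h3, abs_le]
  constructor <;> linarith

/-- The bounds for `ζ'/ζ` and `Re ξ'/ξ` along the horizontal segment from `σ₀ + it` to the right. -/
structure SegmentBounds (σ₀ t A δ P E : ℝ) : Prop where
  norm_le : ∀ a : ℝ, 0 < a → a ≤ A → a * ‖logDeriv riemannZeta (σ₀ + a + t * I)‖ ≤
    δ * (Real.exp (-(a / δ)) + Real.exp (-(2 * (a / δ)))) * (xiLogDeriv (σ₀ + a + t * I)).re + E
  nonneg : ∀ a : ℝ, 0 < a → 0 ≤ (xiLogDeriv (σ₀ + a + t * I)).re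
  le_of_ge : ∀ a : ℝ, δ ≤ a → a ≤ A → (xiLogDeriv (σ₀ + a + t * I)).re ≤ P
  mul_le_of_le : ∀ a : ℝ, 0 < a → a ≤ δ → a * (xiLogDeriv (σ₀ + a + t * I)).re ≤ δ * P
  re_close : ∀ a : ℝ, 0 < a → a ≤ A → |(logDeriv riemannZeta (σ₀ + a + t * I)).re -
    (xiLogDeriv (σ₀ + a + t * I)).re + Real.log t / 2| ≤ E

/-- The parameter ℓ = (1 - θ) log log t is just small enough that the contribution of the right line
is a smaller power of log t, while δ = 1/ℓ remains of order 1/log log t. -/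
lemma exists_segmentBounds (hRH : RiemannHypothesis) {θ : ℝ} (hθ : 0 < θ) (hθ1 : θ < 1) :
    ∃ C : ℝ, 1 ≤ C ∧ ∀ t σ₀ : ℝ, 1 ≤ t → 2 ≤ (1 - θ) * Real.log (Real.log t) → 1 ≤ Real.log t →
      1 / 2 < σ₀ → σ₀ ≤ 1 / 2 + θ / 16 →
      SegmentBounds σ₀ t (1 / 2 + θ / 16) (1 / ((1 - θ) * Real.log (Real.log t)))
        ((Real.log t / 2 + C * Real.log t ^ (1 - θ / 2)) / (1 - kappa))
        (C * Real.log t ^ (1 - θ / 2)) := by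
  obtain ⟨D, hD, hB⟩ := norm_logDeriv_riemannZeta₁_le_of_re_xiLogDeriv hRH (η := θ / 4)
    (by positivity)
  refine ⟨5 * D + 21, by linarith, fun t σ₀ ht hℓ2 hL h0 h0' => ?_⟩
  set L := Real.log t with hLdef
  set ℓ := (1 - θ) * Real.log L with hℓ
  set Y := L ^ (1 - θ / 2) with hY
  have hℓ0 : 0 < ℓ := by linarith
  have hY1 : 1 ≤ Y := Real.one_le_rpow hL (by linarith)
  -- The exponent of log t is (1 - θ)(1 + θ/2) = 1 - θ/2 - θ²/2.
  have hX : Real.exp (2 * ℓ * (1 / 2 + θ / 4)) ≤ Y := by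
    rw [hY, Real.rpow_def_of_pos (by linarith)]
    apply Real.exp_le_exp.mpr
    have hll : 0 ≤ Real.log L := Real.log_nonneg hL
    rw [hℓ]
    nlinarith [mul_nonneg hll (mul_nonneg hθ.le hθ.le)]
  have htp : 1 ≤ √(√t) := Real.one_le_sqrt.mpr (Real.one_le_sqrt.mpr ht)
  have hre : ∀ a : ℝ, (σ₀ + a + t * I : ℂ).re = σ₀ + a := fun a => by simp
  have him : ∀ a : ℝ, (σ₀ + a + t * I : ℂ).im = t := fun a => by simp
  have hnorm : ∀ a : ℝ, 0 < a → a ≤ 1 / 2 + θ / 16 →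
      ‖logDeriv riemannZeta (σ₀ + a + t * I)‖ ≤
        (Real.exp (-(a * ℓ)) + Real.exp (-(2 * a * ℓ))) / (a * ℓ) *
          (xiLogDeriv (σ₀ + a + t * I)).re + D * (1 + 1 / a) / √(√t) + D * Y + 1 := by
    intro a ha ha'
    have h1 := hB σ₀ a t ℓ h0 (by linarith) ha (by linarith) (by linarith) ht
    have hs1 : (σ₀ + a + t * I : ℂ) ≠ 1 := fun h => by
      have := congrArg Complex.im h; rw [him] at this; norm_num at this; linarith
    have h2 := logDeriv_riemannZeta₁ hs1
      (riemannZeta_ne_zero_of_RH hRH (by rw [hre]; linarith) hs1)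
    have h3 : ‖1 / ((σ₀ + a + t * I : ℂ) - 1)‖ ≤ 1 := by
      rw [norm_div, norm_one, div_le_one₀ (norm_pos_iff.mpr (sub_ne_zero.mpr hs1))]
      refine ht.trans ((le_abs_self _).trans ((le_of_eq ?_).trans (abs_im_le_norm _)))
      simp
    have h4 : ‖logDeriv riemannZeta (σ₀ + a + t * I)‖ ≤
        ‖logDeriv riemannZeta₁ (σ₀ + a + t * I)‖ + 1 := by
      have e : logDeriv riemannZeta (σ₀ + a + t * I) =
          logDeriv riemannZeta₁ (σ₀ + a + t * I) - 1 / ((σ₀ + a + t * I : ℂ) - 1) := by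
        rw [h2]; ring
      rw [e]
      exact (norm_sub_le _ _).trans (by gcongr)
    have h5 : D * Real.exp (2 * ℓ * (1 / 2 + θ / 4)) ≤ D * Y := by gcongr
    linarith
  have hnn : ∀ a : ℝ, 0 < a → 0 ≤ (xiLogDeriv (σ₀ + a + t * I)).re := fun a ha =>
    re_xiLogDeriv_nonneg hRH (by rw [hre]; linarith)
  have hclose : ∀ a : ℝ, 0 < a → a ≤ 1 / 2 + θ / 16 →
      |(logDeriv riemannZeta (σ₀ + a + t * I)).re -
        (xiLogDeriv (σ₀ + a + t * I)).re + L / 2| ≤ 20 := fun a ha ha' => by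
    have := abs_re_logDeriv_sub_le hRH (s := σ₀ + a + t * I) (by rw [hre]; linarith)
      (by rw [hre]; linarith) (by rw [him]; exact ht)
    rwa [him] at this
  have hk := kappa_lt_one
  -- Self-bounding: Re ξ'/ξ - (log t)/2 - O(1) ≤ |ζ'/ζ| ≤ κ Re ξ'/ξ + error, and the inequality is
  -- solved for Re ξ'/ξ.
  have hP : ∀ a : ℝ, 1 / ℓ ≤ a → a ≤ 1 / 2 + θ / 16 → (xiLogDeriv (σ₀ + a + t * I)).re ≤
      (L / 2 + (5 * D + 21) * Y) / (1 - kappa) := by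
    intro a ha ha'
    have hδ : 0 < 1 / ℓ := by positivity
    have ha0 : 0 < a := by linarith
    have hb : 1 ≤ a * ℓ := by rwa [div_le_iff₀ hℓ0] at ha
    have h1 := hnorm a ha0 ha'
    have h2 := weight_le_kappa hb
    rw [show 2 * (a * ℓ) = 2 * a * ℓ by ring] at h2
    -- The factor 1/a is harmless in this range: 1 + 1/a ≤ 1 + ℓ ≤ log t ≤ 4 t^{1/4}.
    have h3 : D * (1 + 1 / a) / √(√t) ≤ 4 * D := by
      rw [div_le_iff₀ (by linarith)]
      have h4 : 1 / a ≤ ℓ := by rw [div_le_iff₀ ha0]; linarith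
      have h5 : ℓ ≤ L - 1 := by
        have := Real.log_le_sub_one_of_pos (show 0 < L by linarith)
        have hll : 0 ≤ Real.log L := Real.log_nonneg hL
        rw [hℓ]; nlinarith
      have h6 := log_le_four_mul_sqrt_sqrt ht
      have : 1 + 1 / a ≤ 4 * √(√t) := by linarith
      nlinarith
    have h7 := (abs_le.mp (hclose a ha0 ha')).1
    have h8 := (le_abs_self _).trans (abs_re_le_norm (logDeriv riemannZeta (σ₀ + a + t * I)))
    have h9 : (Real.exp (-(a * ℓ)) + Real.exp (-(2 * a * ℓ))) / (a * ℓ) *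
          (xiLogDeriv (σ₀ + a + t * I)).re ≤ kappa * (xiLogDeriv (σ₀ + a + t * I)).re :=
      mul_le_mul_of_nonneg_right h2 (hnn a ha0)
    rw [le_div_iff₀ (by linarith)]
    nlinarith
  refine ⟨fun a ha ha' => ?_, hnn, hP, fun a ha ha' => ?_, fun a ha ha' => ?_⟩
  -- For small a the error has size 1/a; multiplying through by a, as in the field `norm_le`, makes
  -- it bounded.
  · have h1 := mul_le_mul_of_nonneg_left (hnorm a ha ha') ha.le
    have e1 : a / (1 / ℓ) = a * ℓ := by field_simp
    have e2 : a * ((Real.exp (-(a * ℓ)) + Real.exp (-(2 * a * ℓ))) / (a * ℓ) *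
          (xiLogDeriv (σ₀ + a + t * I)).re + D * (1 + 1 / a) / √(√t) + D * Y + 1) =
        1 / ℓ * (Real.exp (-(a * ℓ)) + Real.exp (-(2 * a * ℓ))) *
          (xiLogDeriv (σ₀ + a + t * I)).re + (D * (a + 1) / √(√t) + a * (D * Y) + a) := by
      field_simp
      ring
    rw [e1, show 2 * (a * ℓ) = 2 * a * ℓ by ring]
    rw [e2] at h1
    have ha1 : a ≤ 1 := by linarith
    have h3 : D * (a + 1) / √(√t) ≤ 2 * D := by
      rw [div_le_iff₀ (by linarith)]
      nlinarith
    have h4 : a * (D * Y) ≤ 1 * (D * Y) := by gcongr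
    have h5 : D ≤ D * Y := by nlinarith
    linarith
  · have hδA : 1 / ℓ ≤ 1 / 2 + θ / 16 := by
      have : 1 / ℓ ≤ 1 / 2 := by gcongr
      linarith
    have h1 := mul_re_xiLogDeriv_mono hRH h0 ha ha' t
    have h2 := hP (1 / ℓ) le_rfl hδA
    have hδ : 0 < 1 / ℓ := by positivity
    exact h1.trans (mul_le_mul_of_nonneg_left h2 hδ.le)
  · refine (hclose a ha ha').trans ?_
    nlinarith

/-! ### Iterated tail integrals of exponentially decaying functions -/

lemma pow_le_factorial_mul_exp {x : ℝ} (hx : 0 ≤ x) (k : ℕ) :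
    x ^ k ≤ k.factorial * 4 ^ k * Real.exp (x / 4) := by
  have h := Real.pow_div_factorial_le_exp (x / 4) (by positivity) k
  rw [div_pow, div_div, div_le_iff₀ (by positivity)] at h
  linarith

lemma integrableOn_exp_neg_mul {c : ℝ} (hc : 0 < c) (σ : ℝ) :
    IntegrableOn (fun u : ℝ => Real.exp (-(c * u))) (Ioi σ) := by
  have := exp_neg_integrableOn_Ioi σ hc
  simpa using this

lemma integral_exp_neg_mul {c : ℝ} (hc : 0 < c) (σ : ℝ) :
    ∫ u in Ioi σ, Real.exp (-(c * u)) = Real.exp (-(c * σ)) / c := by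
  have := integral_exp_mul_Ioi (a := -c) (by linarith) σ
  simp only [neg_mul, neg_div_neg_eq] at this
  exact this

/-- `φ` is continuous to the right of `σ'` and decays like `e^{-u/2}`, uniformly away from `σ'`. -/
def DecaysOn (φ : ℝ → ℂ) (σ' : ℝ) : Prop :=
  ContinuousOn φ (Ioi σ') ∧
    ∀ σ, σ' < σ → ∃ C, 0 ≤ C ∧ ∀ u, σ ≤ u → ‖φ u‖ ≤ C * Real.exp (-(1 / 2 * u))

lemma DecaysOn.of_eventually {φ : ℝ → ℂ} {σ' x₀ C : ℝ} (hφ : ContinuousOn φ (Ioi σ'))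
    (h : ∀ u, x₀ ≤ u → ‖φ u‖ ≤ C * Real.exp (-(1 / 2 * u))) : DecaysOn φ σ' := by
  refine ⟨hφ, fun σ hσ => ?_⟩
  obtain ⟨M, hM⟩ := (isCompact_Icc (a := σ) (b := x₀)).exists_bound_of_continuousOn
    (hφ.mono fun x hx => hσ.trans_le hx.1)
  refine ⟨max C 0 + max M 0 * Real.exp (1 / 2 * x₀), by positivity, fun u hu => ?_⟩
  rcases le_total x₀ u with hx | hx
  · refine (h u hx).trans ?_
    gcongr
    have : 0 ≤ max M 0 * Real.exp (1 / 2 * x₀) := by positivity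
    linarith [le_max_left C 0]
  · have h1 := hM u ⟨hu, hx⟩
    have h2 : 1 ≤ Real.exp (1 / 2 * x₀) * Real.exp (-(1 / 2 * u)) := by
      rw [← Real.exp_add]; exact Real.one_le_exp (by linarith)
    calc ‖φ u‖ ≤ max M 0 * 1 := by rw [mul_one]; exact h1.trans (le_max_left _ _)
      _ ≤ max M 0 * (Real.exp (1 / 2 * x₀) * Real.exp (-(1 / 2 * u))) := by gcongr
      _ ≤ max C 0 * Real.exp (-(1 / 2 * u)) +
          max M 0 * (Real.exp (1 / 2 * x₀) * Real.exp (-(1 / 2 * u))) :=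
        le_add_of_nonneg_left (by positivity)
      _ = _ := by ring

lemma DecaysOn.exists_pow_mul_le {φ : ℝ → ℂ} {σ' σ : ℝ} (h : DecaysOn φ σ') (hσ : σ' < σ) (k : ℕ) :
    ∃ C, 0 ≤ C ∧ ∀ u, σ ≤ u → ‖((u - σ : ℝ) : ℂ) ^ k * φ u‖ ≤ C * Real.exp (-(1 / 4 * u)) := by
  obtain ⟨C, hC, hb⟩ := h.2 σ hσ
  refine ⟨k.factorial * 4 ^ k * Real.exp (-(σ / 4)) * C, by positivity, fun u hu => ?_⟩
  have h1 := pow_le_factorial_mul_exp (sub_nonneg.mpr hu) k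
  rw [norm_mul, norm_pow, norm_real, Real.norm_eq_abs, abs_of_nonneg (sub_nonneg.mpr hu)]
  calc (u - σ) ^ k * ‖φ u‖ ≤ (k.factorial * 4 ^ k * Real.exp ((u - σ) / 4)) *
        (C * Real.exp (-(1 / 2 * u))) := by gcongr; exact hb u hu
    _ = k.factorial * 4 ^ k * C * (Real.exp ((u - σ) / 4) * Real.exp (-(1 / 2 * u))) := by ring
    _ = k.factorial * 4 ^ k * C * (Real.exp (-(σ / 4)) * Real.exp (-(1 / 4 * u))) := by
      rw [← Real.exp_add, ← Real.exp_add]; ring_nf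
    _ = _ := by ring

lemma DecaysOn.integrableOn_pow_mul {φ : ℝ → ℂ} {σ' σ : ℝ} (h : DecaysOn φ σ') (hσ : σ' < σ)
    (k : ℕ) : IntegrableOn (fun u => ((u - σ : ℝ) : ℂ) ^ k * φ u) (Ioi σ) := by
  obtain ⟨C, hC, hb⟩ := h.exists_pow_mul_le hσ k
  refine Integrable.mono' ((integrableOn_exp_neg_mul (c := 1 / 4) (by norm_num) σ).const_mul C) ?_ ?_
  · refine ContinuousOn.aestronglyMeasurable ?_ measurableSet_Ioi
    exact ContinuousOn.mul (by fun_prop) (h.1.mono (Ioi_subset_Ioi hσ.le))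
  · exact (ae_restrict_mem measurableSet_Ioi).mono fun u hu => hb u (le_of_lt hu)

lemma DecaysOn.integrableOn {φ : ℝ → ℂ} {σ' σ : ℝ} (h : DecaysOn φ σ') (hσ : σ' < σ) :
    IntegrableOn φ (Ioi σ) := by
  simpa using h.integrableOn_pow_mul hσ 0

lemma DecaysOn.hasDerivAt_tail {φ : ℝ → ℂ} {σ' : ℝ} (h : DecaysOn φ σ') {x : ℝ} (hx : σ' < x) :
    HasDerivAt (fun x => ∫ u in Ioi x, φ u) (-φ x) x := by
  obtain ⟨y, hy, hyx⟩ := exists_between hx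
  have hint := h.integrableOn hy
  have e : (fun x => (∫ u in Ioi y, φ u) - ∫ u in y..x, φ u) =ᶠ[𝓝 x]
      fun x => ∫ u in Ioi x, φ u := by
    filter_upwards [Ioi_mem_nhds hyx] with z hz
    rw [← intervalIntegral.integral_Ioi_sub_Ioi hint (le_of_lt hz)]
    ring
  refine HasDerivAt.congr_of_eventuallyEq ?_ e.symm
  have hc : ContinuousAt φ x := h.1.continuousAt (Ioi_mem_nhds hx)
  have := intervalIntegral.integral_hasDerivAt_right (f := φ) (a := y) (b := x)
    (by rw [intervalIntegrable_iff_integrableOn_Ioc_of_le hyx.le]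
        exact hint.mono_set Ioc_subset_Ioi_self)
    (h.1.stronglyMeasurableAtFilter isOpen_Ioi x hx) hc
  simpa using this.const_sub (∫ u in Ioi y, φ u)

lemma DecaysOn.tail {φ : ℝ → ℂ} {σ' : ℝ} (h : DecaysOn φ σ') :
    DecaysOn (fun x => ∫ u in Ioi x, φ u) σ' := by
  refine ⟨fun x hx => (h.hasDerivAt_tail hx).continuousAt.continuousWithinAt, fun σ hσ => ?_⟩
  obtain ⟨C, hC, hb⟩ := h.2 σ hσ
  refine ⟨C * 2, by positivity, fun x hx => ?_⟩
  refine (norm_integral_le_of_norm_le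
    ((integrableOn_exp_neg_mul (c := 1 / 2) (by norm_num) x).const_mul C)
    ((ae_restrict_mem measurableSet_Ioi).mono fun u hu => hb u (hx.trans (le_of_lt hu)))).trans ?_
  rw [integral_const_mul, integral_exp_neg_mul (by norm_num)]
  apply le_of_eq; ring

lemma tendsto_exp_neg_mul {c : ℝ} (hc : 0 < c) :
    Tendsto (fun u : ℝ => Real.exp (-(c * u))) atTop (𝓝 0) :=
  Real.tendsto_exp_neg_atTop_nhds_zero.comp (tendsto_id.const_mul_atTop hc)

/-- Integration by parts: the power k + 1 kills the boundary term at σ and the exponential decay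
kills the one at infinity. -/
lemma DecaysOn.integral_pow_mul {φ ψ : ℝ → ℂ} {σ' σ : ℝ} (hφ : DecaysOn φ σ') (hψ : DecaysOn ψ σ')
    (hd : ∀ x, σ' < x → HasDerivAt φ (-ψ x) x) (hσ : σ' < σ) (k : ℕ) :
    (k + 1) * ∫ u in Ioi σ, ((u - σ : ℝ) : ℂ) ^ k * φ u =
      ∫ u in Ioi σ, ((u - σ : ℝ) : ℂ) ^ (k + 1) * ψ u := by
  have i1 := hφ.integrableOn_pow_mul hσ k
  have i2 := hψ.integrableOn_pow_mul hσ (k + 1)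
  have hder : ∀ x ∈ Ioi σ, HasDerivAt (fun u : ℝ => ((u - σ : ℝ) : ℂ) ^ (k + 1) * φ u)
      ((k + 1) * (((x - σ : ℝ) : ℂ) ^ k * φ x) - ((x - σ : ℝ) : ℂ) ^ (k + 1) * ψ x) x := by
    intro x hx
    have h1 : HasDerivAt (fun u : ℝ => ((u - σ : ℝ) : ℂ)) 1 x := by
      have := ((hasDerivAt_id x).sub_const σ).ofReal_comp
      simpa using this
    have h2 := (h1.pow (k + 1)).mul (hd x (hσ.trans hx))
    refine h2.congr_deriv ?_
    simp only [Pi.pow_apply, Nat.add_sub_cancel]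
    push_cast
    ring
  have hcont : ContinuousWithinAt (fun u : ℝ => ((u - σ : ℝ) : ℂ) ^ (k + 1) * φ u) (Ici σ) σ := by
    refine ContinuousWithinAt.mul (by fun_prop) ?_
    exact (hφ.1.continuousAt (Ioi_mem_nhds hσ)).continuousWithinAt
  have hlim : Tendsto (fun u : ℝ => ((u - σ : ℝ) : ℂ) ^ (k + 1) * φ u) atTop (𝓝 0) := by
    obtain ⟨C, hC, hb⟩ := hφ.exists_pow_mul_le hσ (k + 1)
    refine squeeze_zero_norm' (a := fun u => C * Real.exp (-(1 / 4 * u))) ?_ ?_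
    · filter_upwards [eventually_ge_atTop σ] with u hu using hb u hu
    · simpa using (tendsto_exp_neg_mul (c := 1 / 4) (by norm_num)).const_mul C
  have := integral_Ioi_of_hasDerivAt_of_tendsto hcont hder ((i1.const_mul _).sub i2) hlim
  rw [integral_sub (i1.const_mul _) i2, integral_const_mul] at this
  simp only [sub_self, ofReal_zero, ne_eq, Nat.add_eq_zero_iff, one_ne_zero, and_false,
    not_false_eq_true, zero_pow, zero_mul] at this
  linear_combination this

/-! ### The iterated integrals of `log ζ` along horizontal lines -/

/-- `iterLogZeta (m+1) s = ∫_{u > Re s} iterLogZeta m (u + i Im s) du`, starting from `log ζ`. -/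
noncomputable def iterLogZeta : ℕ → ℂ → ℂ
  | 0 => logZeta
  | m + 1 => fun s => ∫ u in Ioi s.re, iterLogZeta m (u + s.im * I)

lemma iterLogZeta_succ (m : ℕ) (x t : ℝ) :
    iterLogZeta (m + 1) (x + t * I) = ∫ u in Ioi x, iterLogZeta m (u + t * I) := by
  simp [iterLogZeta]

lemma hasDerivAt_logZeta (hRH : RiemannHypothesis) {s : ℂ} (hs : 1 / 2 < s.re) (ht : 0 < s.im) :
    HasDerivAt logZeta (logDeriv riemannZeta s) s := by
  have hs1 : s ≠ 1 := by rintro rfl; norm_num at ht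
  have e : (fun z => logZetaOne z - Complex.log (z - 1)) =ᶠ[𝓝 s] logZeta := by
    filter_upwards [isOpen_rightHalf.mem_nhds hs] with z hz
    rw [logZeta_eq hz]
  refine HasDerivAt.congr_of_eventuallyEq ?_ e.symm
  have h2 := logDeriv_riemannZeta₁ hs1 (riemannZeta_ne_zero_of_RH hRH hs hs1)
  have h3 : HasDerivAt (fun z : ℂ => Complex.log (z - 1)) (1 / (s - 1)) s := by
    refine ((hasDerivAt_id s).sub_const 1).clog (Or.inr ?_)
    simp; linarith
  refine ((hasDerivAt_logZetaOne hRH hs).sub h3).congr_deriv ?_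
  rw [h2]; ring

lemma two_rpow_neg_le_exp {u : ℝ} (hu : 0 ≤ u) : (2 : ℝ) ^ (-u) ≤ Real.exp (-(1 / 2 * u)) := by
  rw [Real.rpow_def_of_pos (by norm_num)]
  apply Real.exp_le_exp.mpr
  nlinarith [Real.log_two_gt_d9]

lemma hasDerivAt_horizontal {f : ℂ → ℂ} {f' : ℂ} {u t : ℝ} (h : HasDerivAt f f' (u + t * I)) :
    HasDerivAt (fun u : ℝ => f (u + t * I)) f' u := by
  have h1 : HasDerivAt (fun u : ℝ => (u : ℂ) + t * I) 1 u := by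
    simpa using (hasDerivAt_id u).ofReal_comp.add_const (t * I)
  exact (HasDerivAt.comp u h h1).congr_deriv (mul_one _)

lemma decaysOn_logZeta (hRH : RiemannHypothesis) {t : ℝ} (ht : 0 < t) :
    DecaysOn (fun u : ℝ => logZeta (u + t * I)) (1 / 2) := by
  refine DecaysOn.of_eventually (x₀ := 2) (C := 6) (fun u hu => ?_) fun u hu => ?_
  · exact (hasDerivAt_horizontal (hasDerivAt_logZeta hRH (by simpa using hu)
      (by simpa using ht))).continuousAt.continuousWithinAt
  · refine (norm_logZeta_le hRH (by simpa using hu)).trans ?_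
    have : ((u : ℂ) + t * I).re = u := by simp
    rw [this]
    gcongr
    exact two_rpow_neg_le_exp (by linarith)

lemma decaysOn_logDeriv (hRH : RiemannHypothesis) {t : ℝ} (ht : 0 < t) :
    DecaysOn (fun u : ℝ => -logDeriv riemannZeta (u + t * I)) (1 / 2) := by
  obtain ⟨C, hC, hb⟩ := exists_norm_logDeriv_riemannZeta_le (σ₁ := 2) (by norm_num)
  refine DecaysOn.of_eventually (x₀ := 2) (C := C) (fun u hu => ?_) fun u hu => ?_
  · have hre : 1 / 2 < ((u : ℂ) + t * I).re := by simpa using hu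
    have hs1 : (u + t * I : ℂ) ≠ 1 := fun h => by
      have := congrArg Complex.im h; simp at this; linarith
    have hd : DifferentiableAt ℂ (logDeriv riemannZeta) (u + t * I) := by
      have e : (fun z => logDeriv riemannZeta₁ z - 1 / (z - 1)) =ᶠ[𝓝 (u + t * I : ℂ)]
          logDeriv riemannZeta := by
        filter_upwards [isOpen_rightHalf.mem_nhds hre, isOpen_compl_singleton.mem_nhds hs1]
          with z hz hz1
        rw [logDeriv_riemannZeta₁ hz1 (riemannZeta_ne_zero_of_RH hRH hz hz1)]; ring
      refine DifferentiableAt.congr_of_eventuallyEq ?_ e.symm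
      refine (differentiableAt_logDeriv_riemannZeta₁ hRH hre).sub
        (DifferentiableAt.div (by fun_prop) (by fun_prop) (sub_ne_zero.mpr hs1))
    exact (hasDerivAt_horizontal hd.hasDerivAt).neg.continuousAt.continuousWithinAt
  · rw [norm_neg]
    refine (hb _ (by simpa using hu)).trans ?_
    have : ((u : ℂ) + t * I).re = u := by simp
    rw [this]
    gcongr
    exact two_rpow_neg_le_exp (by linarith)

lemma decaysOn_iterLogZeta (hRH : RiemannHypothesis) {t : ℝ} (ht : 0 < t) (m : ℕ) :
    DecaysOn (fun u : ℝ => iterLogZeta m (u + t * I)) (1 / 2) := by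
  induction m with
  | zero => exact decaysOn_logZeta hRH ht
  | succ m ih =>
    simp_rw [iterLogZeta_succ]
    exact ih.tail

/-- Each level of iterated integration is traded for one more power of u - σ. The exponent k is left
general so that the induction on m can raise it; only k = 0 is used afterwards. -/
lemma integral_pow_mul_iterLogZeta (hRH : RiemannHypothesis) {t σ : ℝ} (ht : 0 < t)
    (hσ : 1 / 2 < σ) (m k : ℕ) :
    ((k + m + 1).factorial : ℂ) *
        ∫ u in Ioi σ, ((u - σ : ℝ) : ℂ) ^ k * iterLogZeta m (u + t * I) =
      k.factorial * ∫ u in Ioi σ, ((u - σ : ℝ) : ℂ) ^ (k + m + 1) *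
        -logDeriv riemannZeta (u + t * I) := by
  induction m generalizing k with
  | zero =>
    have h := (decaysOn_logZeta hRH ht).integral_pow_mul (decaysOn_logDeriv hRH ht)
      (fun x hx => by
        rw [neg_neg]
        exact hasDerivAt_horizontal (hasDerivAt_logZeta hRH (by simpa using hx)
          (by simpa using ht))) hσ k
    rw [add_zero, Nat.factorial_succ, ← h]
    push_cast
    simp only [iterLogZeta]
    ring
  | succ m ih =>
    have h := (decaysOn_iterLogZeta hRH ht (m + 1)).integral_pow_mul
      (decaysOn_iterLogZeta hRH ht m)
      (fun x hx => by
        simp_rw [iterLogZeta_succ]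
        exact (decaysOn_iterLogZeta hRH ht m).hasDerivAt_tail hx) hσ k
    have h2 := ih (k + 1)
    rw [← h, Nat.factorial_succ k] at h2
    rw [show k + (m + 1) + 1 = k + 1 + m + 1 by ring]
    have hk : (k + 1 : ℂ) ≠ 0 := by exact_mod_cast k.succ_ne_zero
    apply mul_left_cancel₀ hk
    rw [Nat.cast_mul, Nat.cast_succ] at h2
    linear_combination h2

/-- The iterated integral as a single weighted integral of `ζ'/ζ`. -/
lemma iterLogZeta_eq (hRH : RiemannHypothesis) {t σ : ℝ} (ht : 0 < t) (hσ : 1 / 2 < σ) (m : ℕ) :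
    IntegrableOn (fun a : ℝ => (a : ℂ) ^ (m + 1) * logDeriv riemannZeta (σ + a + t * I)) (Ioi 0) ∧
    ((m + 1).factorial : ℂ) * iterLogZeta (m + 1) (σ + t * I) =
      -∫ a in Ioi (0 : ℝ), (a : ℂ) ^ (m + 1) * logDeriv riemannZeta (σ + a + t * I) := by
  have h := integral_pow_mul_iterLogZeta hRH ht hσ m 0
  have hi := (decaysOn_logDeriv hRH ht).integrableOn_pow_mul hσ (m + 1)
  simp only [zero_add, pow_zero, one_mul, Nat.factorial_zero, Nat.cast_one] at h
  set f : ℝ → ℂ := fun a => (a : ℂ) ^ (m + 1) * logDeriv riemannZeta (σ + a + t * I) with hf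
  have e : (fun u : ℝ => ((u - σ : ℝ) : ℂ) ^ (m + 1) * -logDeriv riemannZeta (u + t * I)) =
      fun u : ℝ => -f (u - σ) := by
    ext u
    simp only [hf]
    push_cast
    rw [show (σ : ℂ) + (u - σ) = u by ring]
    ring
  rw [e] at h hi
  have hmp : MeasurePreserving (fun u : ℝ => u - σ) volume volume := measurePreserving_sub_right _ σ
  have hme : MeasurableEmbedding (fun u : ℝ => u - σ) := measurableEmbedding_subRight σ
  have hpre : (fun u : ℝ => u - σ) ⁻¹' (Ioi 0) = Ioi σ := by ext; simp
  constructor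
  · have := (hmp.integrableOn_comp_preimage hme (f := f) (s := Ioi 0))
    rw [hpre] at this
    refine this.mp ?_
    have := hi.neg
    simpa [Function.comp_def] using this
  · rw [iterLogZeta_succ, h, integral_neg]
    congr 1
    have := hmp.setIntegral_preimage_emb hme f (Ioi 0)
    rwa [hpre] at this

/-! ### Incomplete Gamma integrals -/

/-- Integration by parts gives c I_{n+1} = e^{-c} + (n + 1) I_n, which matches peeling off the term
j = 0 of the sum. -/
lemma integral_pow_mul_exp_neg {c : ℝ} (hc : 0 < c) (n : ℕ) :
    IntegrableOn (fun b : ℝ => b ^ n * Real.exp (-(c * b))) (Ioi 1) ∧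
    ∫ b in Ioi (1 : ℝ), b ^ n * Real.exp (-(c * b)) =
      Real.exp (-c) * ∑ j ∈ Finset.range (n + 1),
        (n.factorial : ℝ) / ((n - j).factorial : ℝ) / c ^ (j + 1) := by
  have hint : ∀ n : ℕ, IntegrableOn (fun b : ℝ => b ^ n * Real.exp (-(c * b))) (Ioi 1) := by
    intro n
    have := integrableOn_rpow_mul_exp_neg_mul_rpow (s := n) (p := 1) (b := c)
      (by linarith [n.cast_nonneg (α := ℝ)]) one_pos hc
    refine (this.mono_set (Ioi_subset_Ioi zero_le_one)).congr_fun (fun b _ => ?_) measurableSet_Ioi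
    simp
  refine ⟨hint n, ?_⟩
  induction n with
  | zero => simp [integral_exp_neg_mul hc]; ring
  | succ n ih =>
    have hder : ∀ x ∈ Ioi (1 : ℝ), HasDerivAt (fun b : ℝ => b ^ (n + 1) * Real.exp (-(c * b)))
        ((n + 1) * (x ^ n * Real.exp (-(c * x))) - c * (x ^ (n + 1) * Real.exp (-(c * x)))) x := by
      intro x _
      have h1 : HasDerivAt (fun b : ℝ => Real.exp (-(c * b))) (Real.exp (-(c * x)) * (-c)) x := by
        have := ((hasDerivAt_id x).const_mul c).neg.exp
        simpa using this
      refine ((hasDerivAt_pow (n + 1) x).mul h1).congr_deriv ?_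
      simp only [Nat.add_sub_cancel]
      push_cast
      ring
    have hlim : Tendsto (fun b : ℝ => b ^ (n + 1) * Real.exp (-(c * b))) atTop (𝓝 0) := by
      have := Real.tendsto_pow_mul_exp_neg_atTop_nhds_zero (n + 1)
      have h2 := (this.comp (tendsto_id.const_mul_atTop hc)).const_mul ((c ^ (n + 1))⁻¹)
      rw [mul_zero] at h2
      refine h2.congr fun b => ?_
      simp only [Function.comp, id, mul_pow]
      field_simp
    have h := integral_Ioi_of_hasDerivAt_of_tendsto (by fun_prop) hder
      (((hint n).const_mul _).sub ((hint (n + 1)).const_mul _)) hlim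
    rw [integral_sub ((hint n).const_mul _) ((hint (n + 1)).const_mul _), integral_const_mul,
      integral_const_mul, ih] at h
    rw [Finset.sum_range_succ']
    have e : ∑ j ∈ Finset.range (n + 1), ((n + 1).factorial : ℝ) /
        ((n + 1 - (j + 1)).factorial : ℝ) / c ^ (j + 1 + 1) =
        (n + 1) / c * ∑ j ∈ Finset.range (n + 1),
          (n.factorial : ℝ) / ((n - j).factorial : ℝ) / c ^ (j + 1) := by
      rw [Finset.mul_sum]
      refine Finset.sum_congr rfl fun j _ => ?_
      rw [Nat.add_sub_add_right, Nat.factorial_succ, pow_succ c (j + 1)]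
      push_cast
      field_simp
    rw [e]
    have hf : ((n + 1).factorial : ℝ) ≠ 0 := by positivity
    simp only [Nat.sub_zero, div_self hf, zero_add, pow_one, one_pow, one_mul, mul_one] at h ⊢
    field_simp
    field_simp at h
    linarith

/-! ### Bounds for weighted integrals of the logarithmic derivative -/

/-- The value of `∫_1^∞ b^n (e^{-b} + e^{-2b}) db`. -/
noncomputable def gammaSum (n : ℕ) : ℝ :=
  ∑ j ∈ Finset.range (n + 1), (n.factorial : ℝ) / ((n - j).factorial : ℝ) *
    (1 / Real.exp 1 + 1 / (2 ^ (j + 1) * Real.exp 1 ^ 2))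

lemma gammaSum_pos (n : ℕ) : 0 < gammaSum n :=
  Finset.sum_pos (fun j _ => by positivity) ⟨0, by simp⟩

/-- The strict inequality is the slack that later absorbs the loss from θ and all error terms. -/
lemma gammaSum_lt_succ (n : ℕ) : gammaSum n < gammaSum (n + 1) := by
  unfold gammaSum
  rw [Finset.sum_range_succ _ (n + 1)]
  refine lt_add_of_le_of_pos (Finset.sum_le_sum fun j hj => ?_) (by positivity)
  have hj' : j ≤ n := Nat.lt_succ_iff.mp (Finset.mem_range.mp hj)
  gcongr ?_ * _
  rw [div_le_div_iff₀ (by positivity) (by positivity), Nat.succ_sub hj', Nat.factorial_succ,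
    Nat.factorial_succ]
  push_cast
  have h1 : ((n - j : ℕ) : ℝ) ≤ n := by exact_mod_cast Nat.sub_le n j
  have h2 : (0 : ℝ) ≤ (n.factorial : ℝ) * ((n - j).factorial : ℝ) := by positivity
  nlinarith

lemma integral_pow_mul_weight (n : ℕ) :
    IntegrableOn (fun b : ℝ => b ^ n * (Real.exp (-b) + Real.exp (-(2 * b)))) (Ioi 1) ∧
    ∫ b in Ioi (1 : ℝ), b ^ n * (Real.exp (-b) + Real.exp (-(2 * b))) = gammaSum n := by
  obtain ⟨i1, v1⟩ := integral_pow_mul_exp_neg one_pos n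
  obtain ⟨i2, v2⟩ := integral_pow_mul_exp_neg two_pos n
  simp only [one_mul] at i1 v1
  simp only [mul_add]
  refine ⟨i1.add i2, ?_⟩
  rw [integral_add i1 i2, v1, v2, gammaSum, Finset.mul_sum, Finset.mul_sum,
    ← Finset.sum_add_distrib]
  refine Finset.sum_congr rfl fun j _ => ?_
  have e : Real.exp (-2) = 1 / Real.exp 1 ^ 2 := by
    rw [Real.exp_neg, ← Real.exp_nat_mul, one_div]; norm_num
  rw [e, Real.exp_neg]
  field_simp
  ring

section

variable {σ₀ t A δ P E : ℝ}

/-- One power of a is spent on `norm_le`, so after the substitution a = δb the weight is integrated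
against b^n, not b^{n+1}: this is why the Gamma sum of the smaller index appears. -/
lemma SegmentBounds.norm_setIntegral_far_le (H : SegmentBounds σ₀ t A δ P E) (hδ : 0 < δ)
    (hδA : δ ≤ A) (hA : A ≤ 1) (hP : 0 ≤ P) (hE : 0 ≤ E) (n : ℕ) :
    ‖∫ a in Ioc δ A, (a : ℂ) ^ (n + 1) * logDeriv riemannZeta (σ₀ + a + t * I)‖ ≤
      P * δ ^ (n + 2) * gammaSum n + E := by
  obtain ⟨iw, vw⟩ := integral_pow_mul_weight n
  set g : ℝ → ℝ := fun b => b ^ n * (Real.exp (-b) + Real.exp (-(2 * b))) with hg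
  have hinv : 0 < δ⁻¹ := by positivity
  have ig : IntegrableOn (fun a => g (δ⁻¹ * a)) (Ioi δ) := by
    rw [integrableOn_Ioi_comp_mul_left_iff g δ hinv, inv_mul_cancel₀ hδ.ne']
    exact iw
  have vg : ∫ a in Ioi δ, g (δ⁻¹ * a) = δ * gammaSum n := by
    rw [integral_comp_mul_left_Ioi g δ hinv, inv_mul_cancel₀ hδ.ne', vw, inv_inv, smul_eq_mul]
  have ig' := ig.mono_set (t := Ioi δ) (s := Ioc δ A) Ioc_subset_Ioi_self
  have iE : IntegrableOn (fun _ : ℝ => E) (Ioc δ A) := by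
    exact integrableOn_const (by simp)
  have hB := norm_integral_le_of_norm_le (μ := volume.restrict (Ioc δ A))
    (f := fun a : ℝ => (a : ℂ) ^ (n + 1) * logDeriv riemannZeta (σ₀ + a + t * I))
    (((ig'.const_mul (P * δ ^ (n + 1))).add iE))
    ((ae_restrict_mem measurableSet_Ioc).mono fun a ha => by
      have ha0 : 0 < a := hδ.trans ha.1
      have h1 := H.norm_le a ha0 ha.2
      have h2 := H.le_of_ge a ha.1.le ha.2
      simp only [Pi.add_apply, hg]
      rw [norm_mul, norm_pow, norm_real, Real.norm_eq_abs, abs_of_pos ha0]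
      have e : δ⁻¹ * a = a / δ := by field_simp
      rw [e]
      set w := Real.exp (-(a / δ)) + Real.exp (-(2 * (a / δ))) with hw
      have hw0 : 0 ≤ w := by positivity
      calc a ^ (n + 1) * ‖logDeriv riemannZeta (σ₀ + a + t * I)‖
          = a ^ n * (a * ‖logDeriv riemannZeta (σ₀ + a + t * I)‖) := by ring
        _ ≤ a ^ n * (δ * w * (xiLogDeriv (σ₀ + a + t * I)).re + E) := by gcongr
        _ ≤ a ^ n * (δ * w * P + E) := by gcongr
        _ = P * δ ^ (n + 1) * ((a / δ) ^ n * w) + a ^ n * E := by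
          rw [div_pow]; field_simp; ring
        _ ≤ P * δ ^ (n + 1) * ((a / δ) ^ n * w) + 1 * E := by
          gcongr
          exact pow_le_one₀ ha0.le (ha.2.trans hA)
        _ = _ := by rw [one_mul])
  refine hB.trans ?_
  simp only [Pi.add_apply]
  rw [integral_add (ig'.const_mul _) iE, integral_const_mul]
  have h3 : ∫ a in Ioc δ A, g (δ⁻¹ * a) ≤ δ * gammaSum n := by
    rw [← vg]
    refine setIntegral_mono_set ig ?_ Ioc_subset_Ioi_self.eventuallyLE
    refine (ae_restrict_mem measurableSet_Ioi).mono fun a ha => ?_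
    have : 0 ≤ a := (hδ.trans ha).le
    simp only [hg, Pi.zero_apply]; positivity
  have h4 : ∫ _ in Ioc δ A, E ≤ E := by
    rw [setIntegral_const, Real.volume_real_Ioc_of_le hδA, smul_eq_mul]
    nlinarith
  calc _ ≤ P * δ ^ (n + 1) * (δ * gammaSum n) + E := by gcongr
    _ = _ := by ring

/-- The exact value is about 1.06; any bound below π/2 would serve. -/
lemma integral_weight_unit_le :
    ∫ b in (0 : ℝ)..1, (Real.exp (-b) + Real.exp (-(2 * b))) ≤ 1.1 := by
  have h : ∀ x ∈ uIcc (0 : ℝ) 1, HasDerivAt (fun b : ℝ => -Real.exp (-b) - Real.exp (-(2 * b)) / 2)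
      (Real.exp (-x) + Real.exp (-(2 * x))) x := by
    intro x _
    have h1 : HasDerivAt (fun b : ℝ => Real.exp (-b)) (Real.exp (-x) * (-1)) x :=
      (hasDerivAt_neg x).exp
    have h2 : HasDerivAt (fun b : ℝ => Real.exp (-(2 * b))) (Real.exp (-(2 * x)) * (-2)) x := by
      have := ((hasDerivAt_id x).const_mul 2).neg.exp
      simpa using this
    refine (h1.neg.sub (h2.div_const 2)).congr_deriv ?_
    ring
  rw [intervalIntegral.integral_eq_sub_of_hasDerivAt h
    (Continuous.intervalIntegrable (by fun_prop) _ _)]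
  have h1 : Real.exp (-1) = (Real.exp 1)⁻¹ := Real.exp_neg 1
  have h2 : Real.exp (-(2 * 1)) = (Real.exp 1)⁻¹ * (Real.exp 1)⁻¹ := by
    rw [← h1, ← Real.exp_add]; norm_num
  have h3 : 0.367 < (Real.exp 1)⁻¹ := by
    rw [lt_inv_comm₀ (by norm_num) (by positivity)]
    norm_num
    linarith [Real.exp_one_lt_d9]
  rw [h1, h2]
  norm_num
  nlinarith

/-- Two powers of a are consumed, one by `norm_le` and one by `mul_le_of_le`. Hence the exponent n +
2, which restricts the use of this bound to m ≥ 2. -/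
lemma SegmentBounds.norm_setIntegral_near_le (H : SegmentBounds σ₀ t A δ P E) (hδ : 0 < δ)
    (hδA : δ ≤ A) (hA : A ≤ 1) (hP : 0 ≤ P) (hE : 0 ≤ E) (n : ℕ) :
    ‖∫ a in Ioc 0 δ, (a : ℂ) ^ (n + 2) * logDeriv riemannZeta (σ₀ + a + t * I)‖ ≤
      P * δ ^ (n + 3) * 1.1 + E := by
  set w : ℝ → ℝ := fun b => Real.exp (-b) + Real.exp (-(2 * b)) with hw
  have ic : Continuous (fun a : ℝ => P * δ ^ (n + 2) * w (a / δ) + E) := by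
    simp only [hw]; fun_prop
  have hB := norm_integral_le_of_norm_le (μ := volume.restrict (Ioc 0 δ))
    (f := fun a : ℝ => (a : ℂ) ^ (n + 2) * logDeriv riemannZeta (σ₀ + a + t * I))
    (ic.integrableOn_Ioc)
    ((ae_restrict_mem measurableSet_Ioc).mono fun a ha => by
      have ha0 : 0 < a := ha.1
      have h1 := H.norm_le a ha0 (ha.2.trans hδA)
      have h2 := H.mul_le_of_le a ha0 ha.2
      rw [norm_mul, norm_pow, norm_real, Real.norm_eq_abs, abs_of_pos ha0]
      have hw' : Real.exp (-(a / δ)) + Real.exp (-(2 * (a / δ))) = w (a / δ) := rfl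
      rw [hw'] at h1
      have hw0 : 0 ≤ w (a / δ) := by simp only [hw]; positivity
      calc a ^ (n + 2) * ‖logDeriv riemannZeta (σ₀ + a + t * I)‖
          = a ^ (n + 1) * (a * ‖logDeriv riemannZeta (σ₀ + a + t * I)‖) := by ring
        _ ≤ a ^ (n + 1) * (δ * w (a / δ) * (xiLogDeriv (σ₀ + a + t * I)).re + E) := by gcongr
        _ = a ^ n * (δ * w (a / δ)) * (a * (xiLogDeriv (σ₀ + a + t * I)).re) +
            a ^ (n + 1) * E := by ring
        _ ≤ δ ^ n * (δ * w (a / δ)) * (δ * P) + 1 * E := by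
          have h3 : a ^ n ≤ δ ^ n := pow_le_pow_left₀ ha0.le ha.2 n
          have h4 : a ^ (n + 1) ≤ 1 := pow_le_one₀ ha0.le (by linarith [ha.2])
          have h5 := mul_nonneg ha0.le (H.nonneg a ha0)
          gcongr
        _ = _ := by ring)
  refine hB.trans ?_
  rw [← intervalIntegral.integral_of_le hδ.le, intervalIntegral.integral_add
    (Continuous.intervalIntegrable (by simp only [hw]; fun_prop) _ _)
    (Continuous.intervalIntegrable (by fun_prop) _ _), intervalIntegral.integral_const_mul,
    intervalIntegral.integral_comp_div w hδ.ne', zero_div, div_self hδ.ne',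
    intervalIntegral.integral_const]
  have h1 : ∫ b in (0 : ℝ)..1, w b ≤ 1.1 := integral_weight_unit_le
  simp only [smul_eq_mul, sub_zero]
  have h2 : δ * E ≤ 1 * E := by gcongr; linarith
  calc P * δ ^ (n + 2) * (δ * ∫ b in (0 : ℝ)..1, w b) + δ * E
      ≤ P * δ ^ (n + 2) * (δ * 1.1) + 1 * E := by gcongr
    _ = _ := by ring

/-- For the real part only one power of a is consumed, so m = 1 is covered, and the term -(log t)/2
in Re ζ'/ζ helps in the upper bound. The lower bound comes from Re ξ'/ξ ≥ 0 and is no larger in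
absolute value because log t ≤ P. -/
lemma SegmentBounds.abs_setIntegral_re_near_le (H : SegmentBounds σ₀ t A δ P E) (hδ : 0 < δ)
    (hδA : δ ≤ A) (hA : A ≤ 1) (hE : 0 ≤ E) (hL : 0 ≤ Real.log t) (hLP : Real.log t ≤ P) (n : ℕ)
    (hint : IntegrableOn (fun a : ℝ => (a : ℂ) ^ (n + 1) * logDeriv riemannZeta (σ₀ + a + t * I))
      (Ioc 0 δ)) :
    |(∫ a in Ioc 0 δ, (a : ℂ) ^ (n + 1) * logDeriv riemannZeta (σ₀ + a + t * I)).re| ≤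
      δ ^ (n + 2) * (P / (n + 1) - Real.log t / 2 / (n + 2)) + E := by
  set L := Real.log t with hLdef
  set r : ℝ → ℝ := fun a => a ^ (n + 1) * (logDeriv riemannZeta (σ₀ + a + t * I)).re with hr
  have hrint : IntegrableOn r (Ioc 0 δ) := by
    refine hint.re.congr (Eventually.of_forall fun a => ?_)
    simp only [hr]
    rw [← ofReal_pow]
    exact re_ofReal_mul _ _
  have hre : (∫ a in Ioc 0 δ, (a : ℂ) ^ (n + 1) * logDeriv riemannZeta (σ₀ + a + t * I)).re =
      ∫ a in Ioc 0 δ, r a := by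
    have := reCLM.integral_comp_comm hint
    simp only [reCLM_apply] at this
    rw [← this]
    congr 1
    ext a
    simp only [hr]
    rw [← ofReal_pow, re_ofReal_mul]
  rw [hre]
  have hpow : ∀ k : ℕ, ∫ a in Ioc 0 δ, a ^ k = δ ^ (k + 1) / (k + 1) := fun k => by
    rw [← intervalIntegral.integral_of_le hδ.le, integral_pow]; simp
  have ip : ∀ k : ℕ, IntegrableOn (fun a : ℝ => a ^ k) (Ioc 0 δ) := fun k =>
    (by fun_prop : Continuous fun a : ℝ => a ^ k).integrableOn_Ioc
  have hEpow : E * (δ ^ (n + 2) / (n + 2)) ≤ E := by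
    have h1 : δ ^ (n + 2) ≤ 1 := pow_le_one₀ hδ.le (hδA.trans hA)
    have h2 : δ ^ (n + 2) / ((n : ℝ) + 2) ≤ 1 := by
      rw [div_le_one₀ (by positivity)]
      linarith [n.cast_nonneg (α := ℝ)]
    nlinarith
  have hup : ∫ a in Ioc 0 δ, r a ≤
      δ * P * (δ ^ (n + 1) / (n + 1)) + (E - L / 2) * (δ ^ (n + 2) / (n + 2)) := by
    have h2 := hpow (n + 1)
    have h3 := hpow n
    push_cast at h2
    rw [show (n : ℝ) + 1 + 1 = n + 2 by ring, show n + 1 + 1 = n + 2 by ring] at h2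
    rw [← h2, ← h3, ← integral_const_mul, ← integral_const_mul,
      ← integral_add ((ip n).const_mul _) ((ip (n + 1)).const_mul _)]
    refine setIntegral_mono_on hrint (((ip n).const_mul _).add ((ip (n + 1)).const_mul _))
      measurableSet_Ioc fun a ha => ?_
    have h4 := (abs_le.mp (H.re_close a ha.1 (ha.2.trans hδA))).2
    have h5 := H.mul_le_of_le a ha.1 ha.2
    have h6 : 0 ≤ a ^ n := pow_nonneg ha.1.le n
    have h7 : 0 ≤ a ^ (n + 1) := pow_nonneg ha.1.le _
    simp only [hr]
    calc a ^ (n + 1) * (logDeriv riemannZeta (σ₀ + a + t * I)).re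
        ≤ a ^ (n + 1) * ((xiLogDeriv (σ₀ + a + t * I)).re + (E - L / 2)) := by
          gcongr; linarith
      _ = a ^ n * (a * (xiLogDeriv (σ₀ + a + t * I)).re) + (E - L / 2) * a ^ (n + 1) := by ring
      _ ≤ a ^ n * (δ * P) + (E - L / 2) * a ^ (n + 1) := by gcongr
      _ = _ := by ring
  have hlo : -(E + L / 2) * (δ ^ (n + 2) / (n + 2)) ≤ ∫ a in Ioc 0 δ, r a := by
    have h2 := hpow (n + 1)
    push_cast at h2
    rw [show (n : ℝ) + 1 + 1 = n + 2 by ring, show n + 1 + 1 = n + 2 by ring] at h2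
    rw [← h2, ← integral_const_mul]
    refine setIntegral_mono_on ((ip (n + 1)).const_mul _) hrint measurableSet_Ioc fun a ha => ?_
    have h4 := (abs_le.mp (H.re_close a ha.1 (ha.2.trans hδA))).1
    have h5 := H.nonneg a ha.1
    have h7 : 0 ≤ a ^ (n + 1) := pow_nonneg ha.1.le _
    simp only [hr]
    rw [mul_comm]
    gcongr
    linarith
  have e1 : δ * P * (δ ^ (n + 1) / (n + 1)) + (E - L / 2) * (δ ^ (n + 2) / (n + 2)) =
      δ ^ (n + 2) * (P / (n + 1) - L / 2 / (n + 2)) + E * (δ ^ (n + 2) / (n + 2)) := by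
    field_simp; ring
  have e2 : -(E + L / 2) * (δ ^ (n + 2) / (n + 2)) =
      -(δ ^ (n + 2) * (L / 2 / (n + 2))) - E * (δ ^ (n + 2) / (n + 2)) := by
    field_simp; ring
  have h8 : δ ^ (n + 2) * (L / 2 / (n + 2)) ≤
      δ ^ (n + 2) * (P / (n + 1) - L / 2 / (n + 2)) := by
    gcongr
    have h9 : L / (n + 2) ≤ P / (n + 1) := by gcongr <;> linarith
    have h10 : L / 2 / ((n : ℝ) + 2) + L / 2 / (n + 2) = L / (n + 2) := by field_simp; ring
    linarith
  rw [abs_le]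
  constructor <;> linarith

/-- Here σ₀ + a stays beyond a fixed abscissa larger than 1, so ζ'/ζ decays exponentially, uniformly
in t. -/
lemma exists_norm_setIntegral_tail_le {A : ℝ} (hA : 1 / 2 < A) (m : ℕ) :
    ∃ C : ℝ, 0 ≤ C ∧ ∀ σ₀ t : ℝ, 1 / 2 < σ₀ →
      ‖∫ a in Ioi A, (a : ℂ) ^ m * logDeriv riemannZeta (σ₀ + a + t * I)‖ ≤ C := by
  obtain ⟨C, hC, hb⟩ := exists_norm_logDeriv_riemannZeta_le (σ₁ := 1 / 2 + A) (by linarith)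
  refine ⟨∫ a in Ioi A, C * (m.factorial * 4 ^ m) * Real.exp (-(1 / 4 * a)),
    integral_nonneg fun a => by positivity, fun σ₀ t h0 => ?_⟩
  refine norm_integral_le_of_norm_le
    ((integrableOn_exp_neg_mul (c := 1 / 4) (by norm_num) A).const_mul _)
    ((ae_restrict_mem measurableSet_Ioi).mono fun a ha => ?_)
  have ha' : A < a := ha
  have ha0 : 0 < a := by linarith
  have hre : (σ₀ + a + t * I : ℂ).re = σ₀ + a := by simp
  have h1 := hb (σ₀ + a + t * I) (by rw [hre]; linarith)
  rw [hre] at h1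
  have h2 : (2 : ℝ) ^ (-(σ₀ + a)) ≤ Real.exp (-(1 / 2 * a)) :=
    (two_rpow_neg_le_exp (by linarith)).trans (Real.exp_le_exp.mpr (by linarith))
  have h3 := pow_le_factorial_mul_exp ha0.le m
  rw [norm_mul, norm_pow, norm_real, Real.norm_eq_abs, abs_of_pos ha0]
  calc a ^ m * ‖logDeriv riemannZeta (σ₀ + a + t * I)‖
      ≤ (m.factorial * 4 ^ m * Real.exp (a / 4)) * (C * Real.exp (-(1 / 2 * a))) := by
        gcongr; exact h1.trans (by gcongr)
    _ = C * (m.factorial * 4 ^ m) * (Real.exp (a / 4) * Real.exp (-(1 / 2 * a))) := by ring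
    _ = _ := by rw [← Real.exp_add]; ring_nf

/-! ### Bounds for the iterated integrals -/

lemma setIntegral_Ioi_split {f : ℝ → ℂ} (hδ : 0 ≤ δ) (hδA : δ ≤ A) (hf : IntegrableOn f (Ioi 0)) :
    ∫ a in Ioi 0, f a = (∫ a in Ioc 0 δ, f a) + (∫ a in Ioc δ A, f a) + ∫ a in Ioi A, f a := by
  have h1 : Ioi (0 : ℝ) = Ioc 0 δ ∪ Ioi δ := (Ioc_union_Ioi_eq_Ioi hδ).symm
  have h2 : Ioi δ = Ioc δ A ∪ Ioi A := (Ioc_union_Ioi_eq_Ioi hδA).symm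
  rw [h1, setIntegral_union (by simp [disjoint_left]) measurableSet_Ioi
    (hf.mono_set Ioc_subset_Ioi_self) (hf.mono_set (Ioi_subset_Ioi hδ)), h2,
    setIntegral_union (by simp [disjoint_left]) measurableSet_Ioi
    (hf.mono_set fun x hx => hδ.trans_lt hx.1)
    (hf.mono_set (Ioi_subset_Ioi (hδ.trans hδA))), add_assoc]

end

lemma exists_iterLogZeta_le (hRH : RiemannHypothesis) {θ : ℝ} (hθ : 0 < θ) (hθ1 : θ < 1) (n : ℕ) :
    ∃ C : ℝ, ∀ t σ₀ : ℝ, 1 ≤ t → 2 ≤ (1 - θ) * Real.log (Real.log t) → 1 ≤ Real.log t →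
      1 / 2 < σ₀ → σ₀ ≤ 1 / 2 + θ / 16 →
      (n + 1).factorial * |(iterLogZeta (n + 1) (σ₀ + t * I)).re| ≤
        Real.log t / 2 * (1 / ((1 - θ) * Real.log (Real.log t))) ^ (n + 2) *
          (1 / (1 - kappa) * (gammaSum n + 1 / (n + 1)) - 1 / (n + 2)) +
          C * Real.log t ^ (1 - θ / 2) ∧
      (1 ≤ n → (n + 1).factorial * |(iterLogZeta (n + 1) (σ₀ + t * I)).im| ≤
        Real.log t / 2 * (1 / ((1 - θ) * Real.log (Real.log t))) ^ (n + 2) *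
          (1 / (1 - kappa) * (gammaSum n + 1.1)) +
          C * Real.log t ^ (1 - θ / 2)) := by
  obtain ⟨D, hD, hS⟩ := exists_segmentBounds hRH hθ hθ1
  obtain ⟨T, hT, htail⟩ := exists_norm_setIntegral_tail_le (A := 1 / 2 + θ / 16) (by linarith) (n + 1)
  have hk := kappa_lt_one
  have hk' := half_le_kappa
  refine ⟨D / (1 - kappa) * (gammaSum n + 1.1) + 2 * D + T, fun t σ₀ ht hℓ hL h0 h0' => ?_⟩
  have H := hS t σ₀ ht hℓ hL h0 h0'
  have ht0 : 0 < t := by linarith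
  obtain ⟨hint, hval⟩ := iterLogZeta_eq hRH ht0 h0 n
  set L := Real.log t with hLdef
  set δ := 1 / ((1 - θ) * Real.log L) with hδ
  set Y := L ^ (1 - θ / 2) with hY
  set E := D * Y with hE
  set P := (L / 2 + E) / (1 - kappa) with hP
  have hY1 : 1 ≤ Y := Real.one_le_rpow hL (by linarith)
  have hE0 : 0 ≤ E := by positivity
  have hκ : 0 < 1 - kappa := by linarith
  have hP0 : 0 ≤ P := by positivity
  have hδ0 : 0 < δ := by positivity
  have hδh : δ ≤ 1 / 2 := by rw [hδ]; gcongr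
  have hδA : δ ≤ 1 / 2 + θ / 16 := by linarith
  have hA1 : 1 / 2 + θ / 16 ≤ 1 := by linarith
  -- Uses 1 - κ ≤ 1/2.
  have hLP : L ≤ P := by
    rw [hP, le_div_iff₀ hκ]; nlinarith
  have hg := gammaSum_pos n
  rw [setIntegral_Ioi_split hδ0.le hδA hint] at hval
  have hfar := H.norm_setIntegral_far_le hδ0 hδA hA1 hP0 hE0 n
  have htl := htail σ₀ t h0
  set X1 := ∫ a in Ioc 0 δ, (a : ℂ) ^ (n + 1) * logDeriv riemannZeta (σ₀ + a + t * I)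
  set X2 := ∫ a in Ioc δ (1 / 2 + θ / 16),
    (a : ℂ) ^ (n + 1) * logDeriv riemannZeta (σ₀ + a + t * I)
  set X3 := ∫ a in Ioi (1 / 2 + θ / 16), (a : ℂ) ^ (n + 1) * logDeriv riemannZeta (σ₀ + a + t * I)
  have hδp : δ ^ (n + 2) ≤ 1 := pow_le_one₀ hδ0.le (by linarith)
  have hPe : P = L / 2 * (1 / (1 - kappa)) + D / (1 - kappa) * Y := by
    rw [hP, hE]; field_simp
  have hfacre : ((n + 1).factorial : ℝ) * (iterLogZeta (n + 1) (σ₀ + t * I)).re =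
      -(X1.re + X2.re + X3.re) := by
    have := congrArg Complex.re hval
    rw [← ofReal_natCast, re_ofReal_mul] at this
    rw [this]; simp
  have hfacim : ((n + 1).factorial : ℝ) * (iterLogZeta (n + 1) (σ₀ + t * I)).im =
      -(X1.im + X2.im + X3.im) := by
    have := congrArg Complex.im hval
    rw [← ofReal_natCast, im_ofReal_mul] at this
    rw [this]; simp
  have hfp : (0 : ℝ) < (n + 1).factorial := by positivity
  have hTY : T ≤ T * Y := by nlinarith
  have hDY : 0 ≤ D / (1 - kappa) * Y := by positivity
  constructor
  · have hnear := H.abs_setIntegral_re_near_le hδ0 hδA hA1 hE0 (by linarith) hLP n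
      (hint.mono_set Ioc_subset_Ioi_self)
    have h1 : |((n + 1).factorial : ℝ) * (iterLogZeta (n + 1) (σ₀ + t * I)).re| ≤
        (δ ^ (n + 2) * (P / (n + 1) - L / 2 / (n + 2)) + E) +
        (P * δ ^ (n + 2) * gammaSum n + E) + T := by
      rw [hfacre, abs_neg]
      exact (abs_add_three _ _ _).trans (add_le_add (add_le_add hnear
        ((abs_re_le_norm _).trans hfar)) ((abs_re_le_norm _).trans htl))
    rw [abs_mul, abs_of_pos hfp] at h1
    refine h1.trans ?_
    have e : (δ ^ (n + 2) * (P / (n + 1) - L / 2 / (n + 2)) + E) +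
        (P * δ ^ (n + 2) * gammaSum n + E) + T =
        L / 2 * δ ^ (n + 2) * (1 / (1 - kappa) * (gammaSum n + 1 / (n + 1)) - 1 / (n + 2)) +
        (D / (1 - kappa) * Y * (gammaSum n + 1 / (n + 1)) * δ ^ (n + 2) + 2 * D * Y + T) := by
      rw [hPe, hE]; ring
    rw [e]
    have h2 : D / (1 - kappa) * Y * (gammaSum n + 1 / (n + 1)) * δ ^ (n + 2) ≤
        D / (1 - kappa) * Y * (gammaSum n + 1.1) * 1 := by
      gcongr
      have : 1 / ((n : ℝ) + 1) ≤ 1 := by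
        rw [div_le_one₀ (by positivity)]; linarith [n.cast_nonneg (α := ℝ)]
      linarith
    have e3 : (D / (1 - kappa) * (gammaSum n + 1.1) + 2 * D + T) * Y =
        D / (1 - kappa) * Y * (gammaSum n + 1.1) * 1 + 2 * D * Y + T * Y := by ring
    rw [e3]
    linarith
  · intro hn
    -- The weight a^{n+1} must contain two spare powers of a, so n ≥ 1.
    obtain ⟨k, rfl⟩ : ∃ k, n = k + 1 := ⟨n - 1, by omega⟩
    have hnear := H.norm_setIntegral_near_le hδ0 hδA hA1 hP0 hE0 k
    have h1 : |((k + 1 + 1).factorial : ℝ) * (iterLogZeta (k + 1 + 1) (σ₀ + t * I)).im| ≤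
        (P * δ ^ (k + 3) * 1.1 + E) + (P * δ ^ (k + 1 + 2) * gammaSum (k + 1) + E) + T := by
      rw [hfacim, abs_neg]
      exact (abs_add_three _ _ _).trans (add_le_add (add_le_add ((abs_im_le_norm _).trans hnear)
        ((abs_im_le_norm _).trans hfar)) ((abs_im_le_norm _).trans htl))
    rw [abs_mul, abs_of_pos hfp] at h1
    refine h1.trans ?_
    have e : (P * δ ^ (k + 3) * 1.1 + E) + (P * δ ^ (k + 1 + 2) * gammaSum (k + 1) + E) + T =
        L / 2 * δ ^ (k + 1 + 2) * (1 / (1 - kappa) * (gammaSum (k + 1) + 1.1)) +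
        (D / (1 - kappa) * Y * (gammaSum (k + 1) + 1.1) * δ ^ (k + 1 + 2) + 2 * D * Y + T) := by
      rw [hPe, hE]; ring
    rw [e]
    have h2 : D / (1 - kappa) * Y * (gammaSum (k + 1) + 1.1) * δ ^ (k + 1 + 2) ≤
        D / (1 - kappa) * Y * (gammaSum (k + 1) + 1.1) * 1 := by
      gcongr
    have e3 : (D / (1 - kappa) * (gammaSum (k + 1) + 1.1) + 2 * D + T) * Y =
        D / (1 - kappa) * Y * (gammaSum (k + 1) + 1.1) * 1 + 2 * D * Y + T * Y := by ring
    rw [e3]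
    linarith

lemma exists_div_one_sub_pow_lt {c₁ c₂ : ℝ} (h : c₁ < c₂) (k : ℕ) :
    ∃ θ : ℝ, 0 < θ ∧ θ < 1 ∧ c₁ / (1 - θ) ^ k < c₂ := by
  have hc : ContinuousAt (fun θ : ℝ => c₁ / (1 - θ) ^ k) 0 := by
    refine ContinuousAt.div (by fun_prop) (by fun_prop) (by simp)
  have h1 : ∀ᶠ θ in 𝓝 (0 : ℝ), c₁ / (1 - θ) ^ k < c₂ :=
    hc.eventually_lt continuousAt_const (by simpa using h)
  have h2 : ∀ᶠ θ in 𝓝[>] (0 : ℝ), θ ∈ Ioo (0 : ℝ) 1 := Ioo_mem_nhdsGT one_pos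
  obtain ⟨θ, h3, h4⟩ := ((h1.filter_mono nhdsWithin_le_nhds).and h2).exists
  exact ⟨θ, h4.1, h4.2, h3⟩

/-- With x = log t: the error x^{1 - θ/2} is smaller than x/(log x)^k by a power of x, so any
positive gap between the constants eventually covers it. -/
lemma eventually_main_add_error_le {θ c₁ c₂ : ℝ} (hθ : 0 < θ) (C : ℝ) (k : ℕ)
    (h : c₁ / (1 - θ) ^ k < c₂) :
    ∀ᶠ x : ℝ in atTop, x / 2 * (1 / ((1 - θ) * Real.log x)) ^ k * c₁ + C * x ^ (1 - θ / 2) ≤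
      x / Real.log x ^ k * (1 / 2) * c₂ := by
  set ε := c₂ - c₁ / (1 - θ) ^ k with hε
  have hε0 : 0 < ε := by linarith
  have ho := isLittleO_log_rpow_rpow_atTop (k : ℝ) (s := θ / 2) (by positivity)
  have hb := ho.bound (c := ε / (2 * (|C| + 1))) (by positivity)
  filter_upwards [hb, eventually_gt_atTop 1] with x hx hx1
  have hx0 : 0 < x := by linarith
  have hl : 0 < Real.log x := Real.log_pos hx1
  rw [Real.rpow_natCast, Real.norm_of_nonneg (by positivity), Real.norm_of_nonneg (by positivity)]
    at hx
  have e1 : x / 2 * (1 / ((1 - θ) * Real.log x)) ^ k * c₁ =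
      x / Real.log x ^ k * (1 / 2) * (c₁ / (1 - θ) ^ k) := by
    rw [div_pow, mul_pow, one_pow]
    ring
  have e2 : x ^ (1 - θ / 2) * x ^ (θ / 2) = x := by
    rw [← Real.rpow_add hx0]; simp
  have h3 : C * x ^ (1 - θ / 2) ≤ x / Real.log x ^ k * (1 / 2) * ε := by
    have hxp : 0 < x ^ (1 - θ / 2) := by positivity
    have h4 : C * x ^ (1 - θ / 2) ≤ (|C| + 1) * x ^ (1 - θ / 2) := by
      gcongr; linarith [le_abs_self C]
    refine h4.trans ?_
    rw [div_mul_eq_mul_div, div_mul_eq_mul_div, le_div_iff₀ (by positivity)]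
    calc (|C| + 1) * x ^ (1 - θ / 2) * Real.log x ^ k
        ≤ (|C| + 1) * x ^ (1 - θ / 2) * (ε / (2 * (|C| + 1)) * x ^ (θ / 2)) := by gcongr
      _ = (|C| + 1) * (ε / (2 * (|C| + 1))) * (x ^ (1 - θ / 2) * x ^ (θ / 2)) := by ring
      _ = x * (1 / 2) * ε := by rw [e2]; field_simp
  rw [e1]
  have e3 : x / Real.log x ^ k * (1 / 2) * c₂ = x / Real.log x ^ k * (1 / 2) * (c₁ / (1 - θ) ^ k) +
      x / Real.log x ^ k * (1 / 2) * ε := by rw [hε]; ring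
  linarith

/-- Enlarging the constant from c₁ to c₂ makes it possible to fix θ first, paying for (1 - θ)^{-k},
and then to drop the error for large t. -/
lemma exists_eventually_bound {V : ℝ → ℝ → ℝ} {c₁ c₂ : ℝ} (hc : c₁ < c₂) (k : ℕ)
    (h : ∀ θ : ℝ, 0 < θ → θ < 1 → ∃ C : ℝ, ∀ t σ₀ : ℝ, 1 ≤ t →
      2 ≤ (1 - θ) * Real.log (Real.log t) → 1 ≤ Real.log t → 1 / 2 < σ₀ → σ₀ ≤ 1 / 2 + θ / 16 →
      V σ₀ t ≤ Real.log t / 2 * (1 / ((1 - θ) * Real.log (Real.log t))) ^ k * c₁ +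
        C * Real.log t ^ (1 - θ / 2)) :
    ∃ η : ℝ, 0 < η ∧ ∀ᶠ t : ℝ in atTop, ∀ σ₀ : ℝ, 1 / 2 < σ₀ → σ₀ ≤ 1 / 2 + η →
      V σ₀ t ≤ Real.log t / Real.log (Real.log t) ^ k * (1 / 2) * c₂ := by
  obtain ⟨θ, hθ, hθ1, hlt⟩ := exists_div_one_sub_pow_lt hc k
  obtain ⟨C, hC⟩ := h θ hθ hθ1
  refine ⟨θ / 16, by positivity, ?_⟩
  have hll : Tendsto (fun t : ℝ => (1 - θ) * Real.log (Real.log t)) atTop atTop :=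
    (Real.tendsto_log_atTop.comp Real.tendsto_log_atTop).const_mul_atTop (by linarith)
  filter_upwards [Real.tendsto_log_atTop.eventually (eventually_main_add_error_le hθ C k hlt),
    hll.eventually_ge_atTop 2, Real.tendsto_log_atTop.eventually_ge_atTop 1,
    eventually_ge_atTop 1] with t h1 h2 h3 h4 σ₀ h5 h6
  exact (hC t σ₀ h4 h2 h3 h5 h6).trans h1

/-- The bound for the real part, relevant for odd `m = n + 1`. -/
lemma exists_eventually_re_iterLogZeta_le (hRH : RiemannHypothesis) (n : ℕ) :
    ∃ η : ℝ, 0 < η ∧ ∀ᶠ t : ℝ in atTop, ∀ σ₀ : ℝ, 1 / 2 < σ₀ → σ₀ ≤ 1 / 2 + η →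
      (n + 1).factorial * |(iterLogZeta (n + 1) (σ₀ + t * I)).re| ≤
        Real.log t / Real.log (Real.log t) ^ (n + 2) * (1 / 2) *
          (1 / (1 - kappa) * (gammaSum (n + 1) + 1 / (n + 1)) - 1 / (n + 2)) := by
  refine exists_eventually_bound
    (c₁ := 1 / (1 - kappa) * (gammaSum n + 1 / (n + 1)) - 1 / (n + 2)) ?_ (n + 2)
    fun θ hθ hθ1 => ?_
  · have : 0 < 1 - kappa := by linarith [kappa_lt_one]
    gcongr
    exact gammaSum_lt_succ n
  · obtain ⟨C, hC⟩ := exists_iterLogZeta_le hRH hθ hθ1 n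
    exact ⟨C, fun t σ₀ h1 h2 h3 h4 h5 => (hC t σ₀ h1 h2 h3 h4 h5).1⟩

/-- The bound for the imaginary part, relevant for even `m = n + 1`. -/
lemma exists_eventually_im_iterLogZeta_le (hRH : RiemannHypothesis) {n : ℕ} (hn : 1 ≤ n) :
    ∃ η : ℝ, 0 < η ∧ ∀ᶠ t : ℝ in atTop, ∀ σ₀ : ℝ, 1 / 2 < σ₀ → σ₀ ≤ 1 / 2 + η →
      (n + 1).factorial * |(iterLogZeta (n + 1) (σ₀ + t * I)).im| ≤
        Real.log t / Real.log (Real.log t) ^ (n + 2) * (1 / 2) *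
          (1 / (1 - kappa) * (gammaSum (n + 1) + Real.pi / 2)) := by
  refine exists_eventually_bound
    (c₁ := 1 / (1 - kappa) * (gammaSum n + 1.1)) ?_ (n + 2) fun θ hθ hθ1 => ?_
  · have : 0 < 1 - kappa := by linarith [kappa_lt_one]
    have h1 := gammaSum_lt_succ n
    -- Here 1.1 is compared with π/2; the classical constant is larger than what the argument
    -- yields.
    have h2 := Real.pi_gt_three
    gcongr
    linarith
  · obtain ⟨C, hC⟩ := exists_iterLogZeta_le hRH hθ hθ1 n
    exact ⟨C, fun t σ₀ h1 h2 h3 h4 h5 => (hC t σ₀ h1 h2 h3 h4 h5).2 hn⟩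

/-! ### The argument of `ζ` by continuous variation -/

lemma argContinuation_of_log {f : ℂ → ℂ} {a b : ℂ} {lam : ℝ → ℂ} (hc : ContinuousOn lam (Icc 0 1))
    (h : ∀ u ∈ Icc (0 : ℝ) 1, exp (lam u) = f (AffineMap.lineMap a b u)) :
    ArgContinuation f a b (lam 0).im (lam 1).im := by
  refine ⟨fun u => (lam u).im, continuous_im.comp_continuousOn hc, rfl, rfl, fun u hu => ?_⟩
  rw [← h u hu, norm_exp, ofReal_exp, ← exp_add, re_add_im]

/-- Combined with Re `lam`, a continuous argument becomes a second continuous logarithm; the two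
differ by a constant, which the initial value makes zero. -/
lemma eq_im_of_argument {f : ℂ → ℂ} {a b : ℂ} {φ : ℝ → ℝ} {lam : ℝ → ℂ} {U : Set ℝ}
    (hU : IsPreconnected U) (h0 : (0 : ℝ) ∈ U) (hφ : ContinuousOn φ U) (hlam : ContinuousOn lam U)
    (h : ∀ u ∈ U, f (AffineMap.lineMap a b u) =
      (‖f (AffineMap.lineMap a b u)‖ : ℂ) * exp ((φ u : ℂ) * I))
    (he : ∀ u ∈ U, exp (lam u) = f (AffineMap.lineMap a b u)) (hst : φ 0 = (lam 0).im)
    {u : ℝ} (hu : u ∈ U) : φ u = (lam u).im := by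
  have hc : ContinuousOn (fun u => (((lam u).re : ℝ) : ℂ) + (φ u : ℂ) * I) U :=
    (continuous_ofReal.comp_continuousOn (continuous_re.comp_continuousOn hlam)).add
      ((continuous_ofReal.comp_continuousOn hφ).mul continuousOn_const)
  have key := sub_eq_sub_of_exp_eq hU hc hlam (fun v hv => by
    rw [he v hv, h v hv, ← he v hv, norm_exp, ofReal_exp, ← exp_add]) hu h0
  have := congrArg Complex.im key
  simp only [sub_im, add_im, ofReal_im, mul_im, ofReal_re, I_im, mul_one, I_re, mul_zero, add_zero,
    zero_add, hst, sub_self] at this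
  linarith

lemma lineMap_vertical (T u : ℝ) :
    AffineMap.lineMap (2 : ℂ) (2 + T * I) u = 2 + (u * T : ℝ) * I := by
  rw [AffineMap.lineMap_apply]
  simp
  ring

lemma lineMap_horizontal (T u : ℝ) :
    AffineMap.lineMap (2 + T * I : ℂ) (1 / 2 + T * I) u = ((2 - 3 / 2 * u : ℝ) : ℂ) + T * I := by
  rw [AffineMap.lineMap_apply]
  simp
  ring

lemma continuous_logZeta_vertical (hRH : RiemannHypothesis) (T : ℝ) :
    Continuous fun u : ℝ => logZeta (2 + (u * T : ℝ) * I) := by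
  have e : (fun u : ℝ => logZeta (2 + (u * T : ℝ) * I)) =
      fun u : ℝ => Complex.log (riemannZeta (2 + (u * T : ℝ) * I)) := by
    ext u; exact logZeta_eq_log hRH (by simp)
  rw [e, continuous_iff_continuousAt]
  intro u
  have h1 : (2 + (u * T : ℝ) * I : ℂ) ≠ 1 := fun h => by
    have := congrArg Complex.re h; simp at this
  refine ContinuousAt.clog ?_ (riemannZeta_mem_slitPlane (by simp))
  exact ContinuousAt.comp (f := fun u : ℝ => (2 + (u * T : ℝ) * I : ℂ))
    (differentiableAt_riemannZeta h1).continuousAt (by fun_prop)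

lemma im_logZeta_two (hRH : RiemannHypothesis) : (logZeta 2).im = 0 := by
  rw [logZeta_eq_log hRH (by simp), log_im, riemannZeta_two,
    show ((Real.pi : ℂ) ^ 2 / 6) = ((Real.pi ^ 2 / 6 : ℝ) : ℂ) by push_cast; rfl]
  exact arg_ofReal_of_nonneg (by positivity)

lemma ne_one_of_im {σ T : ℝ} (hT : 0 < T) : (σ + T * I : ℂ) ≠ 1 := fun h => by
  have := congrArg Complex.im h; simp at this; linarith

lemma continuousOn_logZeta_horizontal (hRH : RiemannHypothesis) {T : ℝ} (hT : 0 < T) :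
    ContinuousOn (fun σ : ℝ => logZeta (σ + T * I)) (Ioi (1 / 2)) :=
  (decaysOn_logZeta hRH hT).1

/-- The continuous argument agrees with Im log ζ along the path from 2 as long as Re s > 1/2, and
its continuity at the endpoint supplies the limit. -/
lemma isArgZeta_tendsto (hRH : RiemannHypothesis) {T θ : ℝ} (hT : 0 < T) (h : IsArgZeta T θ) :
    Tendsto (fun σ : ℝ => (logZeta (σ + T * I)).im) (𝓝[>] (1 / 2)) (𝓝 θ) := by
  obtain ⟨β, ⟨φ, hφ, hφ0, hφ1, hφe⟩, ψ, hψ, hψ0, hψ1, hψe⟩ := h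
  have h1 : φ 1 = (logZeta (2 + (1 * T : ℝ) * I)).im :=
    eq_im_of_argument isPreconnected_Icc ⟨le_rfl, zero_le_one⟩ hφ
      (continuous_logZeta_vertical hRH T).continuousOn hφe (fun u _ => by
        rw [lineMap_vertical]
        refine exp_logZeta hRH (by simp; norm_num) fun h => ?_
        have := congrArg Complex.re h; simp at this)
      (by simp [hφ0, im_logZeta_two hRH]) ⟨zero_le_one, le_rfl⟩
  -- The endpoint u = 1 is excluded because `logZeta` carries only the default value 0 on the
  -- critical line.
  have h2 : ∀ u ∈ Ico (0 : ℝ) 1, ψ u = (logZeta (((2 - 3 / 2 * u : ℝ) : ℂ) + T * I)).im := by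
    intro u hu
    refine eq_im_of_argument (lam := fun u : ℝ => logZeta (((2 - 3 / 2 * u : ℝ) : ℂ) + T * I))
      isPreconnected_Ico ⟨le_rfl, zero_lt_one⟩
      (hψ.mono Ico_subset_Icc_self) ?_ (fun u hu => hψe u (Ico_subset_Icc_self hu)) ?_ ?_ hu
    · refine (continuousOn_logZeta_horizontal hRH hT).comp (f := fun u : ℝ => 2 - 3 / 2 * u)
        (by fun_prop) fun u hu => ?_
      rw [mem_Ioi]; linarith [hu.2]
    · intro u hu
      rw [lineMap_horizontal]
      exact exp_logZeta hRH (by simp only [add_re, ofReal_re, mul_re, I_re, mul_zero, ofReal_im,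
        I_im, mul_one, sub_self, add_zero]; linarith [hu.2]) (ne_one_of_im hT)
    · rw [hψ0, ← hφ1, h1]; simp
  have hlim : Tendsto (fun σ : ℝ => ψ ((2 - σ) / (3 / 2))) (𝓝[>] (1 / 2)) (𝓝 θ) := by
    rw [← hψ1]
    have hc : ContinuousWithinAt ψ (Icc 0 1) 1 := hψ 1 ⟨zero_le_one, le_rfl⟩
    refine hc.tendsto.comp (tendsto_nhdsWithin_iff.mpr ⟨?_, ?_⟩)
    · have : ContinuousAt (fun σ : ℝ => (2 - σ) / (3 / 2)) (1 / 2) := by fun_prop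
      have h3 := this.tendsto
      norm_num at h3
      norm_num
      exact h3.mono_left nhdsWithin_le_nhds
    · filter_upwards [Ioo_mem_nhdsGT (show (1 / 2 : ℝ) < 2 by norm_num)] with σ hσ
      constructor
      · have := hσ.2
        exact div_nonneg (by linarith) (by norm_num)
      · rw [div_le_one₀ (by norm_num)]; linarith [hσ.1]
  refine hlim.congr' ?_
  filter_upwards [Ioo_mem_nhdsGT (show (1 / 2 : ℝ) < 2 by norm_num)] with σ hσ
  rw [h2 _ ⟨div_nonneg (by linarith [hσ.2]) (by norm_num),
    by rw [div_lt_one₀ (by norm_num)]; linarith [hσ.1]⟩]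
  congr 4
  ring

/-- If T is not an ordinate, ζ has no zero on the whole line Im s = T and has a continuous logarithm
there, which a constant adjusts to `logZeta` at 2 + iT. -/
lemma exists_isArgZeta (hRH : RiemannHypothesis) {T : ℝ} (hT : 0 < T) (h : ¬IsZetaOrdinate T) :
    ∃ θ, IsArgZeta T θ := by
  have hc : Continuous fun σ : ℝ => riemannZeta (σ + T * I) := by
    rw [continuous_iff_continuousAt]
    intro σ
    exact ContinuousAt.comp (f := fun σ : ℝ => (σ + T * I : ℂ))
      (differentiableAt_riemannZeta (ne_one_of_im hT)).continuousAt (by fun_prop)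
  obtain ⟨lam, hlam, hexp⟩ := exists_continuousOn_eqOn_exp_comp
    ((convex_univ (E := ℝ) (𝕜 := ℝ)).isSimplyConnected ⟨0, mem_univ _⟩) isOpen_univ hc.continuousOn
    (by rintro ⟨σ, -, h0⟩; exact h ⟨σ, h0⟩)
  rw [continuousOn_univ] at hlam
  have hexp' : ∀ σ : ℝ, exp (lam σ) = riemannZeta (σ + T * I) := fun σ => hexp (mem_univ σ)
  have h1 := argContinuation_of_log (f := riemannZeta) (a := 2) (b := 2 + T * I)
    (continuous_logZeta_vertical hRH T).continuousOn (fun u _ => by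
        rw [lineMap_vertical]
        refine exp_logZeta hRH (by simp; norm_num) fun h => ?_
        have := congrArg Complex.re h; simp at this)
  have h2 := argContinuation_of_log (f := riemannZeta) (a := 2 + T * I) (b := 1 / 2 + T * I)
    (lam := fun u => lam (2 - 3 / 2 * u) + (logZeta (2 + T * I) - lam 2))
    (by fun_prop) (fun u _ => by
      rw [lineMap_horizontal, exp_add, exp_sub, hexp', hexp',
        exp_logZeta hRH (by simp; norm_num) (by exact_mod_cast ne_one_of_im (σ := 2) hT)]
      push_cast
      have hne : riemannZeta (2 + T * I) ≠ 0 := riemannZeta_ne_zero_of_one_le_re (by simp)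
      rw [div_self hne, mul_one])
  have e0 : (logZeta (2 + (0 * T : ℝ) * I)).im = 0 := by simp [im_logZeta_two hRH]
  rw [e0] at h1
  have e1 : (lam (2 - 3 / 2 * 0) + (logZeta (2 + T * I) - lam 2)).im =
      (logZeta (2 + (1 * T : ℝ) * I)).im := by simp
  rw [e1] at h2
  exact ⟨_, _, h1, h2⟩

lemma tendsto_im_logZeta (hRH : RiemannHypothesis) {T : ℝ} (hT : 0 < T) (h : ¬IsZetaOrdinate T) :
    Tendsto (fun σ : ℝ => (logZeta (σ + T * I)).im) (𝓝[>] (1 / 2)) (𝓝 (argZeta T)) := by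
  have hex := exists_isArgZeta hRH hT h
  rw [argZeta, dif_pos hex]
  exact isArgZeta_tendsto hRH hT hex.choose_spec

lemma countable_zetaOrdinates : {T : ℝ | IsZetaOrdinate T}.Countable := by
  have hz : riemannZetaZeros.Countable := by
    have : riemannZetaZeros = ⋃ n : ℕ, Metric.closedBall (0 : ℂ) n ∩ riemannZetaZeros := by
      rw [← iUnion_inter, Metric.iUnion_closedBall_nat, univ_inter]
    rw [this]
    exact countable_iUnion fun n =>
      ((isCompact_closedBall _ _).inter_riemannZetaZeros_finite).countable
  refine (hz.image Complex.im).mono ?_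
  rintro T ⟨σ, hσ⟩
  exact ⟨_, hσ, by simp⟩

/-! ### Size of `log ζ₁` close to the critical line -/

lemma not_eventually_riemannZeta₁_eq_zero (hRH : RiemannHypothesis) {z₀ : ℂ} (hz : 1 / 2 ≤ z₀.re) :
    ¬∀ᶠ z in 𝓝 z₀, riemannZeta₁ z = 0 := by
  intro h
  have hc : Tendsto (fun ε : ℝ => z₀ + ε) (𝓝[>] 0) (𝓝 z₀) := by
    have : ContinuousAt (fun ε : ℝ => z₀ + (ε : ℂ)) 0 := by fun_prop
    have h2 := this.tendsto
    simp only [ofReal_zero, add_zero] at h2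
    exact h2.mono_left nhdsWithin_le_nhds
  obtain ⟨ε, h1, h2⟩ := ((hc.eventually h).and self_mem_nhdsWithin).exists
  have h2' : 0 < ε := h2
  exact riemannZeta₁_ne_zero hRH (s := z₀ + ε) (by simp; linarith) h1

lemma norm_log_le_of_norm_sub_one_lt {z : ℂ} (hz : ‖z - 1‖ < 1 / 2) :
    ‖Complex.log z‖ ≤ 1 + Real.pi := by
  refine norm_log_le.trans ?_
  have h1 : 1 / 2 < ‖z‖ := by
    have := norm_sub_norm_le (1 : ℂ) z
    rw [norm_one, norm_sub_rev] at this; linarith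
  have h2 : ‖z‖ < 3 / 2 := by
    have := norm_sub_norm_le z 1
    rw [norm_one] at this; linarith
  have h3 : |Real.log ‖z‖| ≤ 1 := by
    rw [abs_le]
    constructor
    · have h4 := Real.one_sub_inv_le_log_of_pos (show 0 < ‖z‖ by linarith)
      have h5 : ‖z‖⁻¹ ≤ 2 := by rw [inv_le_comm₀ (by linarith) (by norm_num)]; linarith
      linarith
    · linarith [Real.log_le_sub_one_of_pos (show 0 < ‖z‖ by linarith)]
  linarith

/-- The only difficulty is at a point of the critical line. There ζ₁ = (s - z₀)^n v with v(z₀) ≠ 0,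
and s - z₀ lies in the right half-plane, so its principal argument is bounded while the modulus of
its logarithm grows at most like |log(Re s - 1/2)|. -/
lemma exists_nhds_logZetaOne_bound (hRH : RiemannHypothesis) {z₀ : ℂ} (hz : 1 / 2 ≤ z₀.re) :
    ∃ U ∈ 𝓝 z₀, ∃ C : ℝ, 0 ≤ C ∧ ∀ s ∈ U, 1 / 2 < s.re →
      |(logZetaOne s).im| ≤ C ∧ ‖logZetaOne s‖ ≤ C * (1 + |Real.log (s.re - 1 / 2)|) := by
  obtain ⟨hgc, hge, -⟩ := logZetaOne_spec hRH
  rcases hz.lt_or_eq with hz | hz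
  · have hc : ContinuousAt logZetaOne z₀ := hgc.continuousAt (isOpen_rightHalf.mem_nhds hz)
    have h1 : ∀ᶠ s in 𝓝 z₀, ‖logZetaOne s‖ < ‖logZetaOne z₀‖ + 1 :=
      hc.norm.eventually_lt continuousAt_const (by linarith)
    refine ⟨_, h1, ‖logZetaOne z₀‖ + 1, by positivity, fun s hs _ => ?_⟩
    have hs' : ‖logZetaOne s‖ < ‖logZetaOne z₀‖ + 1 := hs
    refine ⟨(abs_im_le_norm _).trans hs'.le, ?_⟩
    have : 0 ≤ |Real.log (s.re - 1 / 2)| := abs_nonneg _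
    nlinarith [norm_nonneg (logZetaOne z₀)]
  · obtain ⟨n, v, hv, hv0, hfac⟩ :=
      (differentiable_riemannZeta₁.analyticAt z₀).exists_eventuallyEq_pow_smul_nonzero_iff.mpr
        (not_eventually_riemannZeta₁_eq_zero hRH hz.le)
    have hnear : ∀ᶠ s in 𝓝 z₀, ‖v s / v z₀ - 1‖ < 1 / 2 := by
      have hc : ContinuousAt (fun s => ‖v s / v z₀ - 1‖) z₀ :=
        ((hv.continuousAt.div_const _).sub continuousAt_const).norm
      refine hc.eventually_lt continuousAt_const ?_
      simp [div_self hv0]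
    obtain ⟨r₀, hr₀, hball⟩ := Metric.eventually_nhds_iff_ball.mp
      ((hfac.and hnear).and hv.eventually_analyticAt)
    set r := min r₀ 1 with hr
    have hr0 : 0 < r := by positivity
    have hB : ∀ s ∈ Metric.ball z₀ r, s ∈ Metric.ball z₀ r₀ := fun s hs =>
      Metric.ball_subset_ball (min_le_left _ _) hs
    set U := Metric.ball z₀ r with hU
    have hconv : Convex ℝ (U ∩ rightHalf) := (convex_ball _ _).inter convex_rightHalf
    set ω : ℂ → ℂ := fun s =>
      n * Complex.log (s - z₀) + (Complex.log (v s / v z₀) + Complex.log (v z₀)) with hω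
    have hslit : ∀ s ∈ U ∩ rightHalf, s - z₀ ∈ slitPlane := fun s hs => by
      left
      have : (1 / 2 : ℝ) < s.re := hs.2
      rw [sub_re, ← hz]; linarith
    have hωc : ContinuousOn ω (U ∩ rightHalf) := fun s hs => by
      have h1 := hball s (hB s hs.1)
      refine ContinuousAt.continuousWithinAt ?_
      refine ContinuousAt.add (continuousAt_const.mul
        (ContinuousAt.clog (by fun_prop) (hslit s hs))) (ContinuousAt.add ?_ continuousAt_const)
      refine ContinuousAt.clog (h1.2.continuousAt.div_const _) ?_
      have h2 := mem_slitPlane_of_norm_lt_one (h1.1.2.trans (by norm_num))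
      rwa [add_sub_cancel] at h2
    have hωe : ∀ s ∈ U ∩ rightHalf, exp (logZetaOne s) = exp (ω s) := fun s hs => by
      have h1 := hball s (hB s hs.1)
      have hne : v s / v z₀ ≠ 0 := fun h0 => by
        have := h1.1.2; rw [h0] at this; norm_num at this
      rw [hge s hs.2, h1.1.1, hω]
      simp only
      rw [exp_add, exp_add, exp_nat_mul, exp_log (slitPlane_ne_zero (hslit s hs)), exp_log hne,
        exp_log hv0, div_mul_cancel₀ _ hv0, smul_eq_mul]
    have hs1 : z₀ + (r / 2 : ℝ) ∈ U ∩ rightHalf := by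
      constructor
      · rw [hU, mem_ball_iff_norm, add_sub_cancel_left, norm_real, Real.norm_eq_abs,
          abs_of_pos (by positivity)]
        linarith
      · change 1 / 2 < (z₀ + ((r / 2 : ℝ) : ℂ)).re
        rw [add_re, ofReal_re, ← hz]; linarith
    set c := logZetaOne (z₀ + (r / 2 : ℝ)) - ω (z₀ + (r / 2 : ℝ)) with hcdef
    set M := (1 + Real.pi) + ‖Complex.log (v z₀)‖ + ‖c‖ with hM
    have hpi := Real.pi_pos
    refine ⟨U, Metric.ball_mem_nhds _ hr0, n * (1 + Real.pi) + M, by positivity,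
      fun s hsU hs => ?_⟩
    have hsm : s ∈ U ∩ rightHalf := ⟨hsU, hs⟩
    have hdiff : logZetaOne s = n * Complex.log (s - z₀) +
        (Complex.log (v s / v z₀) + Complex.log (v z₀) + c) := by
      have := sub_eq_sub_of_exp_eq hconv.isPreconnected (hgc.mono inter_subset_right) hωc hωe hsm hs1
      rw [← hcdef] at this
      simp only [hω] at this
      linear_combination this
    have hrest : ‖Complex.log (v s / v z₀) + Complex.log (v z₀) + c‖ ≤ M := by
      refine (norm_add₃_le).trans ?_
      have := norm_log_le_of_norm_sub_one_lt (hball s (hB s hsU)).1.2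
      rw [hM]; linarith
    have hn0 : (0 : ℝ) ≤ n := n.cast_nonneg
    constructor
    · rw [hdiff, add_im, ← ofReal_natCast, im_ofReal_mul, log_im]
      refine (abs_add_le _ _).trans (add_le_add ?_ ((abs_im_le_norm _).trans hrest))
      rw [abs_mul, abs_of_nonneg hn0]
      gcongr
      linarith [abs_arg_le_pi (s - z₀)]
    · have hd0 : 0 < s.re - 1 / 2 := by linarith
      have hd1 : s.re - 1 / 2 ≤ ‖s - z₀‖ := by
        have := re_le_norm (s - z₀)
        rw [sub_re, ← hz] at this; exact this
      have hd2 : ‖s - z₀‖ < 1 := by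
        rw [← mem_ball_iff_norm]; exact Metric.ball_subset_ball (min_le_right _ _) hsU
      have hlog : |Real.log ‖s - z₀‖| ≤ |Real.log (s.re - 1 / 2)| := by
        rw [abs_of_nonpos (Real.log_nonpos (norm_nonneg _) hd2.le),
          abs_of_nonpos (Real.log_nonpos hd0.le (by linarith))]
        linarith [Real.log_le_log hd0 hd1]
      set B := |Real.log (s.re - 1 / 2)| with hBdef
      have hB0 : 0 ≤ B := abs_nonneg _
      rw [hdiff]
      refine (norm_add_le _ _).trans ?_
      rw [norm_mul, Complex.norm_natCast]
      have h3 : ‖Complex.log (s - z₀)‖ ≤ B + Real.pi := norm_log_le.trans (by linarith)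
      have h4 : (n : ℝ) * ‖Complex.log (s - z₀)‖ ≤ n * ((1 + Real.pi) * (1 + B)) := by
        gcongr
        nlinarith
      have hM0 : 0 ≤ M := by positivity
      nlinarith

/-- Compactness of the closed rectangle, including its edge on the critical line, makes the local
bounds uniform. -/
lemma exists_logZetaOne_bound (hRH : RiemannHypothesis) (T : ℝ) :
    ∃ C : ℝ, 0 ≤ C ∧ ∀ s : ℂ, 1 / 2 < s.re → s.re ≤ 3 → |s.im| ≤ T →
      |(logZetaOne s).im| ≤ C ∧ ‖logZetaOne s‖ ≤ C * (1 + |Real.log (s.re - 1 / 2)|) := by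
  have hK : IsCompact (Icc (1 / 2 : ℝ) 3 ×ℂ Icc (-T) T) := isCompact_Icc.reProdIm isCompact_Icc
  have key : ∃ C : ℝ, 0 ≤ C ∧ ∀ s ∈ Icc (1 / 2 : ℝ) 3 ×ℂ Icc (-T) T, 1 / 2 < s.re →
      |(logZetaOne s).im| ≤ C ∧ ‖logZetaOne s‖ ≤ C * (1 + |Real.log (s.re - 1 / 2)|) := by
    refine hK.induction_on (p := fun S => ∃ C : ℝ, 0 ≤ C ∧ ∀ s ∈ S, 1 / 2 < s.re →
      |(logZetaOne s).im| ≤ C ∧ ‖logZetaOne s‖ ≤ C * (1 + |Real.log (s.re - 1 / 2)|))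
      ⟨0, le_rfl, by simp⟩ ?_ ?_ ?_
    · rintro S S' hSS' ⟨C, hC, h⟩
      exact ⟨C, hC, fun s hs => h s (hSS' hs)⟩
    · rintro S S' ⟨C, hC, h⟩ ⟨C', hC', h'⟩
      refine ⟨max C C', le_max_of_le_left hC, fun s hs hs2 => ?_⟩
      rcases hs with hs | hs
      · obtain ⟨h1, h2⟩ := h s hs hs2
        exact ⟨h1.trans (le_max_left _ _), h2.trans (by gcongr; exact le_max_left _ _)⟩
      · obtain ⟨h1, h2⟩ := h' s hs hs2
        exact ⟨h1.trans (le_max_right _ _), h2.trans (by gcongr; exact le_max_right _ _)⟩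
    · intro z hz
      obtain ⟨U, hU, C, hC, h⟩ := exists_nhds_logZetaOne_bound hRH (z₀ := z) hz.1.1
      exact ⟨U, mem_nhdsWithin_of_mem_nhds hU, C, hC, h⟩
  obtain ⟨C, hC, h⟩ := key
  exact ⟨C, hC, fun s h1 h2 h3 => h s ⟨⟨h1.le, h2⟩, abs_le.mp h3⟩ h1⟩

/-! ### Measurability and domination of the iterated integrals -/

lemma measurable_logZeta (hRH : RiemannHypothesis) : Measurable logZeta := by
  classical
  have h1 : Measurable (rightHalf.piecewise logZetaOne 0) :=
    (logZetaOne_spec hRH).1.measurable_piecewise continuousOn_const isOpen_rightHalf.measurableSet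
  have h2 : Measurable (rightHalf.indicator fun s => Complex.log (s - 1)) :=
    (measurable_log.comp (measurable_id.sub_const 1)).indicator isOpen_rightHalf.measurableSet
  have e : logZeta = fun s => rightHalf.piecewise logZetaOne 0 s -
      rightHalf.indicator (fun s => Complex.log (s - 1)) s := by
    ext s
    by_cases hs : s ∈ rightHalf
    · rw [piecewise_eq_of_mem _ _ _ hs, indicator_of_mem hs, logZeta_eq hs]
    · rw [piecewise_eq_of_notMem _ _ _ hs, indicator_of_notMem hs, Pi.zero_apply, sub_zero]
      exact if_neg hs
  rw [e]
  exact h1.sub h2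

lemma measurable_iterLogZeta (hRH : RiemannHypothesis) (m : ℕ) : Measurable (iterLogZeta m) := by
  induction m with
  | zero => exact measurable_logZeta hRH
  | succ m ih =>
    have e : iterLogZeta (m + 1) = fun s => ∫ u : ℝ,
        {p : ℂ × ℝ | p.1.re < p.2}.indicator (fun p => iterLogZeta m (p.2 + p.1.im * I)) (s, u) := by
      ext s
      simp only [iterLogZeta]
      rw [← integral_indicator measurableSet_Ioi]
      rfl
    rw [e]
    refine (StronglyMeasurable.integral_prod_right (f := fun s u =>
      {p : ℂ × ℝ | p.1.re < p.2}.indicator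
        (fun p => iterLogZeta m (p.2 + p.1.im * I)) (s, u)) ?_).measurable
    refine Measurable.stronglyMeasurable (Measurable.indicator ?_
      (measurableSet_lt (by fun_prop) (by fun_prop)))
    exact ih.comp (by fun_prop)

lemma integrableOn_abs_log_sub (c a b : ℝ) (hab : a ≤ b) :
    IntegrableOn (fun u : ℝ => |Real.log (u - c)|) (Ioc a b) := by
  have h : IntervalIntegrable (fun u : ℝ => Real.log (u - c)) volume a b := by
    have := (intervalIntegral.intervalIntegrable_log' (a := a - c) (b := b - c)).comp_sub_right c
    simpa using this
  exact ((intervalIntegrable_iff_integrableOn_Ioc_of_le hab).mp h).abs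

/-- `D` dominates `‖f (u + it)‖` for `|t| ≤ T` and almost all `u > 1/2`. -/
structure Dominates (D : ℝ → ℝ) (f : ℂ → ℂ) (T : ℝ) : Prop where
  integrableOn : IntegrableOn D (Ioi (1 / 2))
  nonneg : ∀ u, 0 ≤ D u
  norm_le : ∀ u t : ℝ, 1 / 2 < u → u ≠ 1 → |t| ≤ T → ‖f (u + t * I)‖ ≤ D u

lemma abs_log_le_add {x y R : ℝ} (hx : 0 < x) (hxy : x ≤ y) (hyR : y ≤ R) (hR : 1 ≤ R) :
    |Real.log y| ≤ |Real.log x| + Real.log R := by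
  have h1 := Real.log_le_log hx hxy
  have h2 := Real.log_le_log (hx.trans_le hxy) hyR
  have h3 := Real.log_nonneg hR
  rw [abs_le]
  constructor <;> linarith [neg_abs_le (Real.log x), abs_nonneg (Real.log x)]

/-- Two integrable logarithmic singularities occur: at u = 1/2 from possible zeros of ζ and at u = 1
from the pole. Beyond u = 3 the majorant is purely exponential, which the next integrations exploit.
-/
lemma exists_dominates_logZeta (hRH : RiemannHypothesis) {T : ℝ} (hT : 0 ≤ T) :
    ∃ D : ℝ → ℝ, Dominates D logZeta T ∧ ∀ u, 3 < u → D u = 6 * Real.exp (-(1 / 2 * u)) := by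
  obtain ⟨C, hC, hb⟩ := exists_logZetaOne_bound hRH T
  set D₁ : ℝ → ℝ := fun u => C * (1 + |Real.log (u - 1 / 2)|) +
    (|Real.log (u - 1)| + Real.log (2 + T) + Real.pi) with hD₁
  have hlogT : 0 ≤ Real.log (2 + T) := Real.log_nonneg (by linarith)
  have hpi := Real.pi_pos
  have hD₁0 : ∀ u, 0 ≤ D₁ u := fun u => by simp only [hD₁]; positivity
  have hconst : ∀ c : ℝ, IntegrableOn (fun _ : ℝ => c) (Ioc (1 / 2 : ℝ) 3) := fun c =>
    integrableOn_const (by simp)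
  have hi₁ : IntegrableOn D₁ (Ioc (1 / 2) 3) :=
    (((hconst 1).add (integrableOn_abs_log_sub (1 / 2) (1 / 2) 3 (by norm_num))).const_mul C).add
      (((integrableOn_abs_log_sub 1 (1 / 2) 3 (by norm_num)).add (hconst _)).add (hconst _))
  refine ⟨fun u => (Ioc (1 / 2) 3).indicator D₁ u + 6 * Real.exp (-(1 / 2 * u)),
    ⟨?_, ?_, ?_⟩, ?_⟩
  · refine IntegrableOn.add ?_ ((integrableOn_exp_neg_mul (c := 1 / 2) (by norm_num) _).const_mul 6)
    exact ((integrable_indicator_iff measurableSet_Ioc).mpr hi₁).integrableOn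
  · intro u
    have : 0 ≤ (Ioc (1 / 2) 3).indicator D₁ u := indicator_nonneg (fun u _ => hD₁0 u) u
    positivity
  · intro u t hu hu1 ht
    have hre : (u + t * I : ℂ).re = u := by simp
    have him : (u + t * I : ℂ).im = t := by simp
    rcases le_or_gt u 3 with h3 | h3
    · rw [indicator_of_mem (show u ∈ Ioc (1 / 2 : ℝ) 3 from ⟨hu, h3⟩)]
      have h1 := (hb (u + t * I) (by rw [hre]; exact hu) (by rw [hre]; exact h3)
        (by rw [him]; exact ht)).2
      rw [hre] at h1
      have h2 : ‖Complex.log (u + t * I - 1)‖ ≤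
          |Real.log (u - 1)| + Real.log (2 + T) + Real.pi := by
        refine norm_log_le.trans ?_
        gcongr
        rw [← Real.log_abs (u - 1)]
        refine abs_log_le_add (abs_pos.mpr (sub_ne_zero.mpr hu1)) ?_ ?_ (by linarith)
        · have := abs_re_le_norm (u + t * I - 1 : ℂ)
          rwa [sub_re, hre, one_re] at this
        · have := norm_le_abs_re_add_abs_im (u + t * I - 1 : ℂ)
          rw [sub_re, hre, one_re, sub_im, him, one_im, sub_zero] at this
          have h4 : |u - 1| ≤ 2 := abs_le.mpr ⟨by linarith, by linarith⟩
          linarith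
      rw [logZeta_eq (by rw [hre]; exact hu)]
      have h5 : 0 ≤ 6 * Real.exp (-(1 / 2 * u)) := by positivity
      refine (norm_sub_le _ _).trans ?_
      simp only [hD₁]
      linarith
    · have h1 := norm_logZeta_le hRH (s := u + t * I) (by rw [hre]; linarith)
      rw [hre] at h1
      have h2 : (Ioc (1 / 2) 3).indicator D₁ u = 0 :=
        indicator_of_notMem (fun h => by linarith [h.2]) _
      rw [h2, zero_add]
      refine h1.trans ?_
      gcongr
      exact two_rpow_neg_le_exp (by linarith)
  · intro u hu
    simp only
    rw [indicator_of_notMem (fun h => by linarith [h.2]), zero_add]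

lemma Dominates.ae {D : ℝ → ℝ} {f : ℂ → ℂ} {T t σ : ℝ} (h : Dominates D f T) (ht : |t| ≤ T)
    (hσ : 1 / 2 ≤ σ) : ∀ᵐ u : ℝ ∂(volume.restrict (Ioi σ)), ‖f (u + t * I)‖ ≤ D u := by
  have h1 : ∀ᵐ u : ℝ ∂(volume.restrict (Ioi σ)), u ≠ 1 :=
    ae_restrict_of_ae (Measure.ae_ne volume 1)
  filter_upwards [h1, ae_restrict_mem measurableSet_Ioi] with u hu1 hu
  exact h.norm_le u t (hσ.trans_lt hu) hu1 ht

lemma Dominates.integrable {D : ℝ → ℝ} {f : ℂ → ℂ} {T t : ℝ} (h : Dominates D f T)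
    (hf : Measurable f) (ht : |t| ≤ T) :
    IntegrableOn (fun u : ℝ => f (u + t * I)) (Ioi (1 / 2)) :=
  Integrable.mono' h.integrableOn
    (hf.comp (by fun_prop : Measurable fun u : ℝ => (u + t * I : ℂ))).aestronglyMeasurable
    (h.ae ht le_rfl)

lemma exists_norm_iterLogZeta_succ_le (hRH : RiemannHypothesis) {T : ℝ} (hT : 0 ≤ T) (m : ℕ) :
    ∃ C : ℝ, 0 ≤ C ∧ ∀ u t : ℝ, 1 / 2 < u → |t| ≤ T →
      ‖iterLogZeta (m + 1) (u + t * I)‖ ≤ C * Real.exp (-(1 / 2 * u)) := by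
  induction m with
  | zero =>
    obtain ⟨D, hD, hD3⟩ := exists_dominates_logZeta hRH hT
    set M := ∫ u in Ioi (1 / 2 : ℝ), D u with hM
    have hM0 : 0 ≤ M := integral_nonneg hD.nonneg
    refine ⟨M * Real.exp (3 / 2) + 12, by positivity, fun u t hu ht => ?_⟩
    rw [iterLogZeta_succ]
    have h1 := norm_integral_le_of_norm_le (hD.integrableOn.mono_set (Ioi_subset_Ioi hu.le))
      (hD.ae ht hu.le)
    refine h1.trans ?_
    rcases le_or_gt u 3 with h3 | h3
    · have h2 : ∫ v in Ioi u, D v ≤ M :=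
        setIntegral_mono_set hD.integrableOn (Eventually.of_forall hD.nonneg)
          (Ioi_subset_Ioi hu.le).eventuallyLE
      have h4 : 1 ≤ Real.exp (3 / 2) * Real.exp (-(1 / 2 * u)) := by
        rw [← Real.exp_add]; exact Real.one_le_exp (by linarith)
      have h5 : 0 ≤ 12 * Real.exp (-(1 / 2 * u)) := by positivity
      nlinarith
    · have h2 : ∫ v in Ioi u, D v = ∫ v in Ioi u, 6 * Real.exp (-(1 / 2 * v)) :=
        setIntegral_congr_fun measurableSet_Ioi fun v hv => hD3 v (h3.trans hv)
      rw [h2, integral_const_mul, integral_exp_neg_mul (by norm_num)]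
      have h5 : 0 ≤ M * Real.exp (3 / 2) * Real.exp (-(1 / 2 * u)) := by positivity
      rw [add_mul]
      have e : 6 * (Real.exp (-(1 / 2 * u)) / (1 / 2)) = 12 * Real.exp (-(1 / 2 * u)) := by ring
      linarith
  | succ m ih =>
    obtain ⟨C, hC, hb⟩ := ih
    refine ⟨C * 2, by positivity, fun u t hu ht => ?_⟩
    rw [iterLogZeta_succ]
    refine (norm_integral_le_of_norm_le
      ((integrableOn_exp_neg_mul (c := 1 / 2) (by norm_num) u).const_mul C)
      ((ae_restrict_mem measurableSet_Ioi).mono fun v hv => hb v t (hu.trans hv) ht)).trans ?_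
    rw [integral_const_mul, integral_exp_neg_mul (by norm_num)]
    apply le_of_eq; ring

lemma exists_dominates (hRH : RiemannHypothesis) {T : ℝ} (hT : 0 ≤ T) (m : ℕ) :
    ∃ D : ℝ → ℝ, Dominates D (iterLogZeta m) T := by
  cases m with
  | zero =>
    obtain ⟨D, hD, -⟩ := exists_dominates_logZeta hRH hT
    exact ⟨D, hD⟩
  | succ m =>
    obtain ⟨C, hC, hb⟩ := exists_norm_iterLogZeta_succ_le hRH hT m
    exact ⟨fun u => C * Real.exp (-(1 / 2 * u)),
      (integrableOn_exp_neg_mul (by norm_num) _).const_mul C, fun u => by positivity,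
      fun u t hu _ ht => hb u t hu ht⟩

lemma integrableOn_iterLogZeta (hRH : RiemannHypothesis) (m : ℕ) (t : ℝ) :
    IntegrableOn (fun u : ℝ => iterLogZeta m (u + t * I)) (Ioi (1 / 2)) := by
  obtain ⟨D, hD⟩ := exists_dominates hRH (abs_nonneg t) m
  exact hD.integrable (measurable_iterLogZeta hRH m) le_rfl

lemma intervalIntegrable_iterLogZeta (hRH : RiemannHypothesis) (m : ℕ) {σ T : ℝ} (hσ : 1 / 2 < σ)
    (hσ1 : σ ≠ 1) (hT : 0 ≤ T) :
    IntervalIntegrable (fun t : ℝ => iterLogZeta m (σ + t * I)) volume 0 T := by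
  obtain ⟨D, hD⟩ := exists_dominates hRH hT m
  rw [intervalIntegrable_iff_integrableOn_Ioc_of_le hT]
  refine Integrable.mono' (g := fun _ => D σ) (integrableOn_const (by simp))
    ((measurable_iterLogZeta hRH m).comp
      (by fun_prop : Measurable fun t : ℝ => (σ + t * I : ℂ))).aestronglyMeasurable ?_
  filter_upwards [ae_restrict_mem measurableSet_Ioc] with t ht
  exact hD.norm_le σ t hσ hσ1 (abs_le.mpr ⟨by linarith [ht.1], ht.2⟩)

/-! ### Vertical increments of the iterated integrals -/

/-- Cauchy's theorem on [σ, R] × [ε, T] with R → ∞. Keeping ε > 0 avoids the cut of log ζ along the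
real axis. -/
lemma iterLogZeta_one_sub_of_pos (hRH : RiemannHypothesis) {σ ε T : ℝ} (hσ : 1 / 2 < σ)
    (hε : 0 < ε) (hεT : ε ≤ T) :
    iterLogZeta 1 (σ + T * I) - iterLogZeta 1 (σ + ε * I) =
      -I * ∫ t in ε..T, logZeta (σ + t * I) := by
  have hrect : ∀ R : ℝ, σ ≤ R → (∫ x in σ..R, logZeta (x + ε * I)) -
      (∫ x in σ..R, logZeta (x + T * I)) + I * (∫ y in ε..T, logZeta (R + y * I)) -
      I * (∫ y in ε..T, logZeta (σ + y * I)) = 0 := by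
    intro R hR
    have h := integral_boundary_rect_eq_zero_of_differentiableOn logZeta (σ + ε * I) (R + T * I)
      (fun s hs => by
        simp only [add_re, ofReal_re, mul_re, I_re, mul_zero, ofReal_im, I_im, mul_one, sub_self,
          add_zero, add_im, mul_im, zero_add, uIcc_of_le hR, uIcc_of_le hεT] at hs
        exact (hasDerivAt_logZeta hRH (hσ.trans_le hs.1.1)
          (hε.trans_le hs.2.1)).differentiableAt.differentiableWithinAt)
    simpa using h
  have hint : ∀ t : ℝ, IntegrableOn (fun u : ℝ => logZeta (u + t * I)) (Ioi σ) := fun t =>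
    (integrableOn_iterLogZeta hRH 0 t).mono_set (Ioi_subset_Ioi hσ.le)
  have hlim : ∀ t : ℝ, Tendsto (fun R : ℝ => ∫ x in σ..R, logZeta (x + t * I)) atTop
      (𝓝 (iterLogZeta 1 (σ + t * I))) := fun t => by
    rw [iterLogZeta_succ]
    exact intervalIntegral_tendsto_integral_Ioi σ (hint t) tendsto_id
  have hright : Tendsto (fun R : ℝ => ∫ y in ε..T, logZeta (R + y * I)) atTop (𝓝 0) := by
    refine squeeze_zero_norm' (a := fun R => 6 * Real.exp (-(1 / 2 * R)) * |T - ε|) ?_ ?_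
    · filter_upwards [eventually_ge_atTop 2] with R hR
      refine intervalIntegral.norm_integral_le_of_norm_le_const fun y _ => ?_
      have h := norm_logZeta_le hRH (s := R + y * I) (by simpa using hR)
      refine h.trans ?_
      have hre : (R + y * I : ℂ).re = R := by simp
      rw [hre]
      gcongr
      exact two_rpow_neg_le_exp (by linarith)
    · simpa using ((tendsto_exp_neg_mul (c := 1 / 2) (by norm_num)).const_mul 6).mul_const |T - ε|
  have h1 := (((hlim ε).sub (hlim T)).add (hright.const_mul I)).sub_const
    (I * ∫ y in ε..T, logZeta (σ + y * I))
  have h2 := tendsto_nhds_unique h1 (tendsto_const_nhds.congr' (by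
    filter_upwards [eventually_ge_atTop σ] with R hR
    exact (hrect R hR).symm))
  linear_combination -h2

/-- On the negative axis the principal logarithm is continuous from above, which is the side
approached here. -/
lemma tendsto_logZeta_nhdsGT_zero (hRH : RiemannHypothesis) {u : ℝ} (hu : 1 / 2 < u) (hu1 : u ≠ 1) :
    Tendsto (fun ε : ℝ => logZeta (u + ε * I)) (𝓝[>] 0) (𝓝 (logZeta (u + (0 : ℝ) * I))) := by
  have hre : ∀ ε : ℝ, (u + ε * I : ℂ).re = u := fun ε => by simp
  have e : ∀ ε : ℝ, logZeta (u + ε * I) = logZetaOne (u + ε * I) - Complex.log (u + ε * I - 1) :=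
    fun ε => logZeta_eq (by rw [hre]; exact hu)
  simp_rw [e]
  have hcur : Tendsto (fun ε : ℝ => (u + ε * I : ℂ)) (𝓝[>] 0) (𝓝 (u + (0 : ℝ) * I)) :=
    (by fun_prop : Continuous fun ε : ℝ => (u + ε * I : ℂ)).continuousAt.tendsto.mono_left
      nhdsWithin_le_nhds
  have hcur' : Tendsto (fun ε : ℝ => (u + ε * I - 1 : ℂ)) (𝓝[>] 0) (𝓝 (u + (0 : ℝ) * I - 1)) :=
    hcur.sub_const 1
  refine Tendsto.sub ?_ ?_
  · exact ((logZetaOne_spec hRH).1.continuousAt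
      (isOpen_rightHalf.mem_nhds (by rw [rightHalf, mem_ofPred_eq, hre]; exact hu))).tendsto.comp hcur
  · rcases lt_or_gt_of_ne hu1 with h | h
    · have hc := continuousWithinAt_log_of_re_neg_of_im_zero (z := u + (0 : ℝ) * I - 1)
        (by simp; linarith) (by simp)
      refine hc.tendsto.comp (tendsto_nhdsWithin_iff.mpr ⟨hcur', ?_⟩)
      filter_upwards [self_mem_nhdsWithin] with ε hε
      have : 0 < ε := hε
      simp [this.le]
    · refine (continuousAt_clog ?_).tendsto.comp hcur'
      left; simp; linarith

lemma iterLogZeta_one_sub (hRH : RiemannHypothesis) {σ T : ℝ} (hσ : 1 / 2 < σ) (hσ1 : σ ≠ 1)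
    (hT : 0 < T) :
    iterLogZeta 1 (σ + T * I) - iterLogZeta 1 (σ + (0 : ℝ) * I) =
      -I * ∫ t in (0 : ℝ)..T, logZeta (σ + t * I) := by
  have hint : IntervalIntegrable (fun t : ℝ => logZeta (σ + t * I)) volume 0 T :=
    intervalIntegrable_iterLogZeta hRH 0 hσ hσ1 hT.le
  have h1 : Tendsto (fun ε : ℝ => iterLogZeta 1 (σ + ε * I)) (𝓝[>] 0)
      (𝓝 (iterLogZeta 1 (σ + (0 : ℝ) * I))) := by
    simp_rw [iterLogZeta_succ]
    obtain ⟨D, hD⟩ := exists_dominates hRH hT.le 0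
    refine tendsto_integral_filter_of_dominated_convergence D
      (Eventually.of_forall fun ε => ((measurable_iterLogZeta hRH 0).comp
        (by fun_prop : Measurable fun u : ℝ => (u + ε * I : ℂ))).aestronglyMeasurable) ?_
      (hD.integrableOn.mono_set (Ioi_subset_Ioi hσ.le)) ?_
    · filter_upwards [Ioo_mem_nhdsGT hT] with ε hε
      exact hD.ae (abs_le.mpr ⟨by linarith [hε.1], hε.2.le⟩) hσ.le
    · have hne : ∀ᵐ u : ℝ ∂(volume.restrict (Ioi σ)), u ≠ 1 :=
        ae_restrict_of_ae (Measure.ae_ne volume 1)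
      filter_upwards [hne, ae_restrict_mem measurableSet_Ioi] with u hu1 hu
      exact tendsto_logZeta_nhdsGT_zero hRH (hσ.trans hu) hu1
  have h2 : Tendsto (fun ε : ℝ => ∫ t in ε..T, logZeta (σ + t * I)) (𝓝[>] 0)
      (𝓝 (∫ t in (0 : ℝ)..T, logZeta (σ + t * I))) := by
    have hc := (intervalIntegral.continuousOn_primitive_interval' hint right_mem_uIcc) 0
      left_mem_uIcc
    have h3 : Tendsto (fun ε : ℝ => ∫ t in T..ε, logZeta (σ + t * I)) (𝓝[>] 0)
        (𝓝 (∫ t in T..(0 : ℝ), logZeta (σ + t * I))) := by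
      refine hc.tendsto.mono_left ?_
      rw [uIcc_of_le hT.le]
      refine (nhdsWithin_le_iff).mpr ?_
      exact mem_of_superset (Ioo_mem_nhdsGT hT) Ioo_subset_Icc_self
    rw [intervalIntegral.integral_symm]
    refine h3.neg.congr fun ε => ?_
    rw [← intervalIntegral.integral_symm]
  refine tendsto_nhds_unique (tendsto_const_nhds.sub h1) ((h2.const_mul (-I)).congr' ?_)
  filter_upwards [Ioo_mem_nhdsGT hT] with ε hε
  exact (iterLogZeta_one_sub_of_pos hRH hσ hε.1 hε.2.le).symm

/-- For higher m the identity is integrated over u > σ and the order of integration exchanged; the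
majorant independent of t justifies Fubini. -/
lemma iterLogZeta_sub (hRH : RiemannHypothesis) (m : ℕ) {σ T : ℝ} (hσ : 1 / 2 < σ) (hσ1 : σ ≠ 1)
    (hT : 0 < T) :
    iterLogZeta (m + 1) (σ + T * I) - iterLogZeta (m + 1) (σ + (0 : ℝ) * I) =
      -I * ∫ t in (0 : ℝ)..T, iterLogZeta m (σ + t * I) := by
  induction m generalizing σ with
  | zero => exact iterLogZeta_one_sub hRH hσ hσ1 hT
  | succ m ih =>
    have hint : ∀ t : ℝ, IntegrableOn (fun u : ℝ => iterLogZeta (m + 1) (u + t * I)) (Ioi σ) :=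
      fun t => (integrableOn_iterLogZeta hRH (m + 1) t).mono_set (Ioi_subset_Ioi hσ.le)
    have hne : ∀ᵐ u : ℝ ∂(volume.restrict (Ioi σ)), u ≠ 1 :=
      ae_restrict_of_ae (Measure.ae_ne volume 1)
    rw [iterLogZeta_succ, iterLogZeta_succ, ← integral_sub (hint T) (hint 0)]
    have e : ∫ u in Ioi σ, (iterLogZeta (m + 1) (u + T * I) -
        iterLogZeta (m + 1) (u + (0 : ℝ) * I)) =
        ∫ u in Ioi σ, -I * ∫ t in (0 : ℝ)..T, iterLogZeta m (u + t * I) := by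
      refine integral_congr_ae ?_
      filter_upwards [hne, ae_restrict_mem measurableSet_Ioi] with u hu1 hu
      exact ih (hσ.trans hu) hu1
    rw [e, integral_const_mul]
    congr 1
    simp_rw [iterLogZeta_succ, intervalIntegral.integral_of_le hT.le]
    refine integral_integral_swap ?_
    obtain ⟨D, hD⟩ := exists_dominates hRH hT.le m
    have hDi : Integrable D (volume.restrict (Ioi σ)) :=
      hD.integrableOn.mono_set (Ioi_subset_Ioi hσ.le)
    refine Integrable.mono' (hDi.comp_fst (volume.restrict (Ioc 0 T)))
      ((measurable_iterLogZeta hRH m).comp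
        (by fun_prop : Measurable fun p : ℝ × ℝ => (p.1 + p.2 * I : ℂ))).aestronglyMeasurable ?_
    filter_upwards [Measure.quasiMeasurePreserving_fst.ae hne,
      Measure.quasiMeasurePreserving_fst.ae (ae_restrict_mem (μ := volume) measurableSet_Ioi),
      Measure.quasiMeasurePreserving_snd.ae (ae_restrict_mem (μ := volume) measurableSet_Ioc)]
      with p h1 h2 h3
    exact hD.norm_le p.1 p.2 (hσ.trans h2) h1 (abs_le.mpr ⟨by linarith [h3.1], h3.2⟩)

/-! ### Values on the real axis -/

lemma conj_riemannZeta₁_ofReal (u : ℝ) :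
    (starRingEnd ℂ) (riemannZeta₁ u) = riemannZeta₁ u := by
  rcases eq_or_ne (u : ℂ) 1 with h | h
  · rw [h]; simp
  · have h2 := riemannZeta_conj (u : ℂ)
    rw [conj_ofReal] at h2
    rw [riemannZeta₁_eq_mul h, map_mul, ← h2, map_sub, conj_ofReal, map_one]

/-- ζ₁ is real on the real axis, so the logarithm and its conjugate differ by a constant, which is
zero at 2. -/
lemma im_logZetaOne_ofReal (hRH : RiemannHypothesis) {u : ℝ} (hu : 1 / 2 < u) :
    (logZetaOne u).im = 0 := by
  obtain ⟨hc, he, h2⟩ := logZetaOne_spec hRH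
  have hmem : ∀ v ∈ Ioi (1 / 2 : ℝ), (v : ℂ) ∈ rightHalf := fun v hv => by
    rw [rightHalf, mem_ofPred_eq, ofReal_re]; exact hv
  have hc' : ContinuousOn (fun v : ℝ => logZetaOne v) (Ioi (1 / 2)) :=
    hc.comp continuous_ofReal.continuousOn hmem
  have key := sub_eq_sub_of_exp_eq (isPreconnected_Ioi (a := (1 / 2 : ℝ))) hc'
    (continuous_conj.comp_continuousOn hc') (fun v hv => by
      simp only [Function.comp]
      rw [exp_conj, he _ (hmem v hv), conj_riemannZeta₁_ofReal]) hu
    (show (2 : ℝ) ∈ Ioi (1 / 2 : ℝ) by rw [mem_Ioi]; norm_num)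
  have h3 : (logZetaOne 2).im = 0 := by
    have e : riemannZeta₁ 2 = ((Real.pi ^ 2 / 6 : ℝ) : ℂ) := by
      rw [riemannZeta₁_eq_mul (by norm_num), riemannZeta_two]; push_cast; ring
    rw [h2, e, log_im]
    exact arg_ofReal_of_nonneg (by positivity)
  have := congrArg Complex.im key
  simp only [Function.comp, sub_im, conj_im, ofReal_ofNat, h3] at this
  linarith

/-- `-π (1 - u)_+^m / m!`. -/
noncomputable def realAxisArg (m : ℕ) (u : ℝ) : ℝ :=
  if u < 1 then -Real.pi * ((1 - u) ^ m / m.factorial) else 0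

lemma im_logZeta_ofReal (hRH : RiemannHypothesis) {u : ℝ} (hu : 1 / 2 < u) :
    (logZeta (u + (0 : ℝ) * I)).im = realAxisArg 0 u := by
  have e : (u + (0 : ℝ) * I : ℂ) = u := by simp
  rw [e, logZeta_eq (by simpa using hu), sub_im, im_logZetaOne_ofReal hRH hu, log_im, realAxisArg,
    show (u : ℂ) - 1 = ((u - 1 : ℝ) : ℂ) by push_cast; rfl]
  split_ifs with h
  · rw [arg_ofReal_of_neg (by linarith)]; simp
  · rw [arg_ofReal_of_nonneg (by linarith)]; simp

lemma re_logZeta_ofReal (hRH : RiemannHypothesis) {u : ℝ} (hu : 1 / 2 < u) (hu1 : u ≠ 1) :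
    (logZeta (u + (0 : ℝ) * I)).re = logZetaTail 0 u := by
  have e : (u + (0 : ℝ) * I : ℂ) = u := by simp
  rw [e, logZetaTail, ← exp_logZeta hRH (s := u) (by simpa using hu) (by exact_mod_cast hu1),
    norm_exp, Real.log_exp]

lemma ae_ne_one_and_gt {σ : ℝ} : ∀ᵐ u : ℝ ∂(volume.restrict (Ioi σ)), u ≠ 1 ∧ σ < u := by
  have hne : ∀ᵐ u : ℝ ∂(volume.restrict (Ioi σ)), u ≠ 1 :=
    ae_restrict_of_ae (Measure.ae_ne volume 1)
  filter_upwards [hne, ae_restrict_mem measurableSet_Ioi] with u h1 h2 using ⟨h1, h2⟩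

lemma re_iterLogZeta_succ (hRH : RiemannHypothesis) (m : ℕ) {σ : ℝ} (hσ : 1 / 2 ≤ σ) :
    (iterLogZeta (m + 1) (σ + (0 : ℝ) * I)).re =
      ∫ u in Ioi σ, (iterLogZeta m (u + (0 : ℝ) * I)).re := by
  rw [iterLogZeta_succ]
  have := reCLM.integral_comp_comm
    ((integrableOn_iterLogZeta hRH m 0).mono_set (Ioi_subset_Ioi hσ))
  simp only [reCLM_apply] at this
  exact this.symm

lemma im_iterLogZeta_succ (hRH : RiemannHypothesis) (m : ℕ) {σ : ℝ} (hσ : 1 / 2 ≤ σ) :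
    (iterLogZeta (m + 1) (σ + (0 : ℝ) * I)).im =
      ∫ u in Ioi σ, (iterLogZeta m (u + (0 : ℝ) * I)).im := by
  rw [iterLogZeta_succ]
  have := imCLM.integral_comp_comm
    ((integrableOn_iterLogZeta hRH m 0).mono_set (Ioi_subset_Ioi hσ))
  simp only [imCLM_apply] at this
  exact this.symm

lemma re_iterLogZeta_ofReal (hRH : RiemannHypothesis) (m : ℕ) {σ : ℝ} (hσ : 1 / 2 ≤ σ) :
    (iterLogZeta (m + 1) (σ + (0 : ℝ) * I)).re = logZetaTail (m + 1) σ := by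
  induction m generalizing σ with
  | zero =>
    rw [re_iterLogZeta_succ hRH 0 hσ, logZetaTail]
    refine integral_congr_ae ?_
    filter_upwards [ae_ne_one_and_gt] with u hu
    exact re_logZeta_ofReal hRH (hσ.trans_lt hu.2) hu.1
  | succ m ih =>
    rw [re_iterLogZeta_succ hRH (m + 1) hσ, logZetaTail]
    exact setIntegral_congr_fun measurableSet_Ioi fun u hu => ih (hσ.trans (le_of_lt hu))

lemma integral_realAxisArg (m : ℕ) (σ : ℝ) :
    ∫ u in Ioi σ, realAxisArg m u = realAxisArg (m + 1) σ := by
  rcases lt_or_ge σ 1 with h | h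
  · have e : realAxisArg m = (Iio 1).indicator
        fun u => -Real.pi / m.factorial * (1 - u) ^ m := by
      ext u
      by_cases hu : u < 1
      · rw [indicator_of_mem (show u ∈ Iio (1 : ℝ) from hu), realAxisArg, if_pos hu]; ring
      · rw [indicator_of_notMem (show u ∉ Iio (1 : ℝ) from hu), realAxisArg, if_neg hu]
    rw [e, setIntegral_indicator measurableSet_Iio, Ioi_inter_Iio, ← integral_Ioc_eq_integral_Ioo,
      ← intervalIntegral.integral_of_le h.le, intervalIntegral.integral_const_mul,
      intervalIntegral.integral_comp_sub_left (fun x : ℝ => x ^ m) 1, integral_pow, realAxisArg,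
      if_pos h, Nat.factorial_succ]
    push_cast
    simp
    field_simp
  · rw [realAxisArg, if_neg (not_lt.mpr h)]
    refine setIntegral_eq_zero_of_forall_eq_zero fun u hu => ?_
    have : σ < u := hu
    rw [realAxisArg, if_neg (by linarith)]

lemma im_iterLogZeta_ofReal (hRH : RiemannHypothesis) (m : ℕ) {σ : ℝ} (hσ : 1 / 2 ≤ σ) :
    (iterLogZeta (m + 1) (σ + (0 : ℝ) * I)).im = realAxisArg (m + 1) σ := by
  induction m generalizing σ with
  | zero =>
    rw [im_iterLogZeta_succ hRH 0 hσ, ← integral_realAxisArg]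
    refine integral_congr_ae ?_
    filter_upwards [ae_ne_one_and_gt] with u hu
    exact im_logZeta_ofReal hRH (hσ.trans_lt hu.2)
  | succ m ih =>
    rw [im_iterLogZeta_succ hRH (m + 1) hσ, ← integral_realAxisArg]
    exact setIntegral_congr_fun measurableSet_Ioi fun u hu => ih (hσ.trans (le_of_lt hu))

lemma tendsto_iterLogZeta_ofReal (hRH : RiemannHypothesis) (m : ℕ) :
    Tendsto (fun σ : ℝ => iterLogZeta (m + 1) (σ + (0 : ℝ) * I)) (𝓝[>] (1 / 2))
      (𝓝 (iterLogZeta (m + 1) ((1 / 2 : ℝ) + (0 : ℝ) * I))) := by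
  have hint := integrableOn_iterLogZeta hRH m 0
  simp_rw [iterLogZeta_succ]
  set f : ℝ → ℂ := fun u => iterLogZeta m (u + (0 : ℝ) * I) with hf
  have hii : IntervalIntegrable f volume (1 / 2) 1 := by
    rw [intervalIntegrable_iff_integrableOn_Ioc_of_le (by norm_num)]
    exact hint.mono_set Ioc_subset_Ioi_self
  have hc := (intervalIntegral.continuousOn_primitive_interval' hii left_mem_uIcc) (1 / 2)
    left_mem_uIcc
  have h1 : Tendsto (fun σ : ℝ => ∫ u in (1 / 2 : ℝ)..σ, f u) (𝓝[>] (1 / 2)) (𝓝 0) := by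
    have h2 := hc.tendsto
    rw [intervalIntegral.integral_same] at h2
    refine h2.mono_left ?_
    rw [uIcc_of_le (by norm_num)]
    exact nhdsWithin_le_iff.mpr
      (mem_of_superset (Ioo_mem_nhdsGT (by norm_num)) Ioo_subset_Icc_self)
  have h3 := (tendsto_const_nhds (x := ∫ u in Ioi (1 / 2 : ℝ), f u)).sub h1
  rw [sub_zero] at h3
  refine h3.congr' ?_
  filter_upwards [self_mem_nhdsWithin] with σ hσ
  rw [← intervalIntegral.integral_Ioi_sub_Ioi hint (le_of_lt hσ)]
  ring

lemma im_I_pow_mul_of_odd (k : ℕ) (z : ℂ) : (I ^ (2 * k + 1) * z).im = (-1) ^ k * z.re := by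
  have e : (I : ℂ) ^ (2 * k + 1) = (((-1) ^ k : ℝ) : ℂ) * I := by
    rw [pow_succ, pow_mul, I_sq]; push_cast; rfl
  rw [e, mul_assoc, im_ofReal_mul]
  simp

lemma im_I_pow_mul_of_even (k : ℕ) (z : ℂ) : (I ^ (2 * k) * z).im = (-1) ^ k * z.im := by
  have e : (I : ℂ) ^ (2 * k) = (((-1) ^ k : ℝ) : ℂ) := by
    rw [pow_mul, I_sq]; push_cast; rfl
  rw [e, im_ofReal_mul]

/-- This explains the form of C_m: for odd m it comes from the iterated integral of log |ζ|, for
even m from the argument -π of ζ(u + i0) on u < 1, whose m-fold integral from 1/2 is -π/(m! 2^m). -/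
lemma tendsto_integrationConst (hRH : RiemannHypothesis) (m : ℕ) :
    Tendsto (fun σ : ℝ => (I ^ (m + 1) * iterLogZeta (m + 1) (σ + (0 : ℝ) * I)).im)
      (𝓝[>] (1 / 2)) (𝓝 (Real.pi * integrationConst (m + 1))) := by
  have h := (continuous_im.tendsto _).comp
    ((tendsto_iterLogZeta_ofReal hRH m).const_mul (I ^ (m + 1)))
  suffices e : (I ^ (m + 1) * iterLogZeta (m + 1) ((1 / 2 : ℝ) + (0 : ℝ) * I)).im =
      Real.pi * integrationConst (m + 1) by
    rw [← e]; exact h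
  unfold integrationConst
  split_ifs with hodd
  · obtain ⟨k, hk⟩ := hodd
    rw [hk, im_I_pow_mul_of_odd, ← hk, re_iterLogZeta_ofReal hRH m le_rfl,
      show m + 1 - 1 = 2 * k by omega, Nat.mul_div_cancel_left _ two_pos]
    field_simp
  · rw [Nat.not_odd_iff_even] at hodd
    obtain ⟨k, hk⟩ := hodd
    obtain ⟨j, rfl⟩ : ∃ j, k = j + 1 := ⟨k - 1, by omega⟩
    have hk' : m + 1 = 2 * (j + 1) := by omega
    rw [hk', im_I_pow_mul_of_even, ← hk', im_iterLogZeta_ofReal hRH m le_rfl, realAxisArg,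
      if_pos (by norm_num), show (m + 1 - 1) / 2 = j by omega]
    rw [pow_succ, show (1 : ℝ) - 1 / 2 = 1 / 2 by norm_num, div_pow, one_pow]
    field_simp

/-! ### `S_m` as a boundary value -/

lemma averageAtOrdinates_eq {f : ℝ → ℝ} {T : ℝ} (h : ContinuousAt f T) :
    averageAtOrdinates f T = f T := by
  rw [averageAtOrdinates]
  split_ifs
  · rw [h.continuousWithinAt.rightLim_eq, h.continuousWithinAt.leftLim_eq]; ring
  · rfl

lemma im_iterLogZeta_sub (hRH : RiemannHypothesis) (m : ℕ) {σ T : ℝ} (hσ : 1 / 2 < σ)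
    (hσ1 : σ ≠ 1) (hT : 0 < T) :
    (I ^ (m + 1) * iterLogZeta (m + 1) (σ + T * I)).im =
      (I ^ (m + 1) * iterLogZeta (m + 1) (σ + (0 : ℝ) * I)).im +
        ∫ t in (0 : ℝ)..T, (I ^ m * iterLogZeta m (σ + t * I)).im := by
  have h := iterLogZeta_sub hRH m hσ hσ1 hT
  have hi := (intervalIntegrable_iterLogZeta hRH m hσ hσ1 hT.le).const_mul (I ^ m)
  have h2 := imCLM.intervalIntegral_comp_comm hi
  simp only [imCLM_apply] at h2
  rw [h2, intervalIntegral.integral_const_mul, ← add_im]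
  congr 1
  have e : (I : ℂ) ^ (m + 1) * -I = I ^ m := by rw [pow_succ]; linear_combination -I ^ m * I_mul_I
  rw [← sub_eq_iff_eq_add', ← mul_sub, h, ← mul_assoc, e]

/-- For m = 0 the real part of log ζ is unbounded near zeros, but only the argument enters and it
stays bounded. After one integration even the modulus is bounded. -/
lemma exists_abs_im_iterLogZeta_le (hRH : RiemannHypothesis) (m : ℕ) {T : ℝ} (hT : 0 ≤ T) :
    ∃ C : ℝ, ∀ σ t : ℝ, 1 / 2 < σ → σ ≤ 3 → |t| ≤ T →
      |(I ^ m * iterLogZeta m (σ + t * I)).im| ≤ C := by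
  cases m with
  | zero =>
    obtain ⟨C, hC, hb⟩ := exists_logZetaOne_bound hRH T
    refine ⟨C + Real.pi, fun σ t h1 h2 h3 => ?_⟩
    rw [pow_zero, one_mul, iterLogZeta, logZeta_eq (by simpa using h1), sub_im, log_im]
    refine (abs_sub _ _).trans (add_le_add ?_ (abs_arg_le_pi _))
    exact (hb _ (by simpa using h1) (by simpa using h2) (by simpa using h3)).1
  | succ m =>
    obtain ⟨C, hC, hb⟩ := exists_norm_iterLogZeta_succ_le hRH hT m
    refine ⟨C, fun σ t h1 _ h3 => (abs_im_le_norm _).trans ?_⟩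
    rw [norm_mul, norm_pow, norm_I, one_pow, one_mul]
    refine (hb σ t h1 h3).trans (mul_le_of_le_one_right hC ?_)
    exact Real.exp_le_one_iff.mpr (by linarith)

/-- `S_m(t)` is the boundary value of `π⁻¹ Im(i^m F_m)`, where `F_m` is the iterated integral. -/
def IsBoundaryValue (m : ℕ) (t : ℝ) : Prop :=
  Tendsto (fun σ : ℝ => (I ^ m * iterLogZeta m (σ + t * I)).im) (𝓝[>] (1 / 2))
    (𝓝 (Real.pi * zetaS m t))

lemma eventually_nhdsGT_half : ∀ᶠ σ : ℝ in 𝓝[>] (1 / 2), 1 / 2 < σ ∧ σ < 1 :=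
  Ioo_mem_nhdsGT (by norm_num)

section

variable {m : ℕ}

/-- Pointwise convergence off the countable set of ordinates and the uniform bound allow σ → 1/2
under the integral in t. -/
lemma intervalIntegrable_zetaS (hRH : RiemannHypothesis)
    (h : ∀ t, 0 < t → ¬IsZetaOrdinate t → IsBoundaryValue m t) {T : ℝ} (hT : 0 ≤ T) :
    IntervalIntegrable (zetaS m) volume 0 T ∧
    Tendsto (fun σ : ℝ => ∫ t in (0 : ℝ)..T, (I ^ m * iterLogZeta m (σ + t * I)).im)
      (𝓝[>] (1 / 2)) (𝓝 (∫ t in (0 : ℝ)..T, Real.pi * zetaS m t)) := by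
  obtain ⟨C, hC⟩ := exists_abs_im_iterLogZeta_le hRH m hT
  have hmeas : ∀ σ : ℝ, AEStronglyMeasurable
      (fun t : ℝ => (I ^ m * iterLogZeta m (σ + t * I)).im) (volume.restrict (Ioc 0 T)) := fun σ =>
    (measurable_im.comp (((measurable_iterLogZeta hRH m).comp
      (by fun_prop : Measurable fun t : ℝ => (σ + t * I : ℂ))).const_mul
        (I ^ m))).aestronglyMeasurable
  have hlim : ∀ᵐ t : ℝ ∂(volume.restrict (Ioc 0 T)), IsBoundaryValue m t := by
    have hord : ∀ᵐ t : ℝ ∂(volume.restrict (Ioc 0 T)), ¬IsZetaOrdinate t :=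
      ae_restrict_of_ae (countable_zetaOrdinates.ae_notMem volume)
    filter_upwards [hord, ae_restrict_mem measurableSet_Ioc] with t h1 h2 using h t h2.1 h1
  have hbound : ∀ᶠ σ : ℝ in 𝓝[>] (1 / 2), ∀ᵐ t : ℝ ∂(volume.restrict (Ioc 0 T)),
      ‖(I ^ m * iterLogZeta m (σ + t * I)).im‖ ≤ C := by
    filter_upwards [eventually_nhdsGT_half] with σ hσ
    filter_upwards [ae_restrict_mem measurableSet_Ioc] with t ht
    exact hC σ t hσ.1 (by linarith [hσ.2]) (abs_le.mpr ⟨by linarith [ht.1], ht.2⟩)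
  have hconst : Integrable (fun _ : ℝ => C) (volume.restrict (Ioc 0 T)) :=
    integrableOn_const (by simp)
  constructor
  · have hmπ : AEStronglyMeasurable (fun t => Real.pi * zetaS m t) (volume.restrict (Ioc 0 T)) :=
      aestronglyMeasurable_of_tendsto_ae (𝓝[>] (1 / 2 : ℝ)) hmeas hlim
    have hiπ : Integrable (fun t => Real.pi * zetaS m t) (volume.restrict (Ioc 0 T)) := by
      refine Integrable.mono' hconst hmπ ?_
      filter_upwards [hlim, ae_restrict_mem measurableSet_Ioc] with t h1 h2
      refine le_of_tendsto h1.norm ?_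
      filter_upwards [eventually_nhdsGT_half] with σ hσ
      exact hC σ t hσ.1 (by linarith [hσ.2]) (abs_le.mpr ⟨by linarith [h2.1], h2.2⟩)
    rw [intervalIntegrable_iff_integrableOn_Ioc_of_le hT]
    have := hiπ.const_mul Real.pi⁻¹
    refine this.congr (Eventually.of_forall fun t => ?_)
    field_simp
  · simp_rw [intervalIntegral.integral_of_le hT]
    exact tendsto_integral_filter_of_dominated_convergence (fun _ => C)
      (Eventually.of_forall hmeas) hbound hconst hlim

/-- The primitive is continuous, so averaging the one-sided limits at ordinates has no effect. -/
lemma zetaS_succ_eq (hRH : RiemannHypothesis)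
    (h : ∀ t, 0 < t → ¬IsZetaOrdinate t → IsBoundaryValue m t) {T : ℝ} (hT : 0 < T) :
    zetaS (m + 1) T = (∫ t in (0 : ℝ)..T, zetaS m t) + integrationConst (m + 1) := by
  rw [zetaS]
  refine averageAtOrdinates_eq (ContinuousAt.add ?_ continuousAt_const)
  have hi := (intervalIntegrable_zetaS hRH h (show 0 ≤ T + 1 by linarith)).1
  have hc := intervalIntegral.continuousOn_primitive_interval' hi left_mem_uIcc
  rw [uIcc_of_le (by linarith)] at hc
  exact hc.continuousAt (Icc_mem_nhds hT (by linarith))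

lemma isBoundaryValue_succ (hRH : RiemannHypothesis)
    (h : ∀ t, 0 < t → ¬IsZetaOrdinate t → IsBoundaryValue m t) {T : ℝ} (hT : 0 < T) :
    IsBoundaryValue (m + 1) T := by
  rw [IsBoundaryValue, zetaS_succ_eq hRH h hT, mul_add, ← intervalIntegral.integral_const_mul,
    add_comm (∫ _ in _.._, _)]
  refine ((tendsto_integrationConst hRH m).add (intervalIntegrable_zetaS hRH h hT.le).2).congr' ?_
  filter_upwards [eventually_nhdsGT_half] with σ hσ
  exact (im_iterLogZeta_sub hRH m hσ.1 hσ.2.ne hT).symm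

end

lemma isBoundaryValue_zero (hRH : RiemannHypothesis) {t : ℝ} (ht : 0 < t)
    (h : ¬IsZetaOrdinate t) : IsBoundaryValue 0 t := by
  have := tendsto_im_logZeta hRH ht h
  rw [IsBoundaryValue, zetaS, averageAtOrdinates, if_neg h, ← mul_assoc,
    mul_one_div_cancel Real.pi_ne_zero, one_mul]
  simpa [iterLogZeta] using this

lemma isBoundaryValue (hRH : RiemannHypothesis) (n : ℕ) {t : ℝ} (ht : 0 < t) :
    IsBoundaryValue (n + 1) t := by
  induction n generalizing t with
  | zero => exact isBoundaryValue_succ hRH (fun t ht h => isBoundaryValue_zero hRH ht h) ht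
  | succ n ih => exact isBoundaryValue_succ hRH (fun t ht _ => ih ht) ht

/-! ### Passage of the bounds to the critical line -/

lemma abs_zetaS_le_of_eventually (hRH : RiemannHypothesis) (n : ℕ) {t B : ℝ} (ht : 0 < t)
    (h : ∀ᶠ σ : ℝ in 𝓝[>] (1 / 2),
      ((n + 1).factorial : ℝ) * |(I ^ (n + 1) * iterLogZeta (n + 1) (σ + t * I)).im| ≤ B) :
    ((n + 1).factorial : ℝ) * (Real.pi * |zetaS (n + 1) t|) ≤ B := by
  have h1 := ((isBoundaryValue hRH n ht).abs).const_mul ((n + 1).factorial : ℝ)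
  have h2 := le_of_tendsto h1 h
  rwa [abs_mul, abs_of_pos Real.pi_pos] at h2

lemma eventually_nhdsGT_half_le {η : ℝ} (hη : 0 < η) :
    ∀ᶠ σ : ℝ in 𝓝[>] (1 / 2), 1 / 2 < σ ∧ σ ≤ 1 / 2 + η :=
  mem_of_superset (Ioo_mem_nhdsGT (by linarith)) fun _ h => ⟨h.1, h.2.le⟩

lemma eventually_abs_zetaS_le_of_odd (hRH : RiemannHypothesis) {n : ℕ} (hn : Odd (n + 1)) :
    ∀ᶠ t : ℝ in atTop, ((n + 1).factorial : ℝ) * (Real.pi * |zetaS (n + 1) t|) ≤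
      Real.log t / Real.log (Real.log t) ^ (n + 2) * (1 / 2) *
          (1 / (1 - kappa) * (gammaSum (n + 1) + 1 / (n + 1)) - 1 / (n + 2)) := by
  obtain ⟨η, hη, h⟩ := exists_eventually_re_iterLogZeta_le hRH n
  filter_upwards [h, eventually_gt_atTop 0] with t h1 ht
  refine abs_zetaS_le_of_eventually hRH n ht ?_
  filter_upwards [eventually_nhdsGT_half_le hη] with σ hσ
  refine le_trans (le_of_eq ?_) (h1 σ hσ.1 hσ.2)
  obtain ⟨k, hk⟩ := hn
  rw [hk, im_I_pow_mul_of_odd, abs_mul, abs_pow, abs_neg, abs_one, one_pow, one_mul]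

lemma eventually_abs_zetaS_le_of_even (hRH : RiemannHypothesis) {n : ℕ} (hn : Even (n + 1)) :
    ∀ᶠ t : ℝ in atTop, ((n + 1).factorial : ℝ) * (Real.pi * |zetaS (n + 1) t|) ≤
      Real.log t / Real.log (Real.log t) ^ (n + 2) * (1 / 2) *
          (1 / (1 - kappa) * (gammaSum (n + 1) + Real.pi / 2)) := by
  -- An even m is at least 2, which provides the second spare power of a.
  have hn1 : 1 ≤ n := by
    rcases Nat.eq_zero_or_pos n with rfl | h
    · simp at hn
    · exact h
  obtain ⟨η, hη, h⟩ := exists_eventually_im_iterLogZeta_le hRH hn1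
  filter_upwards [h, eventually_gt_atTop 0] with t h1 ht
  refine abs_zetaS_le_of_eventually hRH n ht ?_
  filter_upwards [eventually_nhdsGT_half_le hη] with σ hσ
  refine le_trans (le_of_eq ?_) (h1 σ hσ.1 hσ.2)
  obtain ⟨k, hk⟩ := hn
  rw [hk, ← two_mul, im_I_pow_mul_of_even, abs_mul, abs_pow, abs_neg, abs_one, one_pow, one_mul]

end

end ZetaArg

theorem theorem1 (hRH : RiemannHypothesis) (m : ℕ) (hm : 1 ≤ m) :
    (Odd m → ∃ E : ℝ → ℝ,
      E =O[Filter.atTop]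
        (fun t : ℝ => Real.log t / Real.log (Real.log t) ^ (m + 2)) ∧
      ∀ᶠ t : ℝ in Filter.atTop,
        |zetaS m t| ≤
          Real.log t / Real.log (Real.log t) ^ (m + 1) * (1 / (2 * Real.pi * (m.factorial : ℝ))) *
            (1 / (1 - kappa) *
                ∑ j ∈ Finset.range (m + 1), (m.factorial : ℝ) / ((m - j).factorial : ℝ) *
                  (1 / Real.exp 1 + 1 / (2 ^ (j + 1) * Real.exp 1 ^ 2))
              + 1 / ((m : ℝ) + 1) * (kappa / (1 - kappa))
              + 1 / ((m : ℝ) * ((m : ℝ) + 1)) * (1 / (1 - kappa)))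
          + E t) ∧
    (Even m → ∃ E : ℝ → ℝ,
      E =O[Filter.atTop]
        (fun t : ℝ => Real.log t / Real.log (Real.log t) ^ (m + 2)) ∧
      ∀ᶠ t : ℝ in Filter.atTop,
        |zetaS m t| ≤
          Real.log t / Real.log (Real.log t) ^ (m + 1) * (1 / (2 * Real.pi * (m.factorial : ℝ))) *
            (1 / (1 - kappa) *
                ∑ j ∈ Finset.range (m + 1), (m.factorial : ℝ) / ((m - j).factorial : ℝ) *
                  (1 / Real.exp 1 + 1 / (2 ^ (j + 1) * Real.exp 1 ^ 2))
              + 1 / ((m : ℝ) + 1) * (kappa / (1 - kappa))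
              + Real.pi / 2 * (1 / (1 - kappa)))
          + E t) := by
  obtain ⟨n, rfl⟩ : ∃ n, m = n + 1 := ⟨m - 1, by omega⟩
  have hk : (0 : ℝ) < 1 - kappa := by linarith [ZetaArg.kappa_lt_one]
  have hfac : (0 : ℝ) < ((n + 1).factorial : ℝ) := by positivity
  have hpi := Real.pi_pos
  have hS : ∑ j ∈ Finset.range (n + 1 + 1), ((n + 1).factorial : ℝ) / ((n + 1 - j).factorial : ℝ) *
      (1 / Real.exp 1 + 1 / (2 ^ (j + 1) * Real.exp 1 ^ 2)) = ZetaArg.gammaSum (n + 1) := rfl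
  -- The error term can be taken to be zero, since the bounds already hold for large t with the
  -- stated main constants.
  refine ⟨fun hodd => ⟨fun _ => 0, Asymptotics.isBigO_zero _ _, ?_⟩,
    fun heven => ⟨fun _ => 0, Asymptotics.isBigO_zero _ _, ?_⟩⟩
  · filter_upwards [ZetaArg.eventually_abs_zetaS_le_of_odd hRH hodd] with t ht
    rw [add_zero]
    refine le_of_mul_le_mul_left ?_ (mul_pos hfac hpi)
    rw [mul_assoc]
    refine ht.trans (le_of_eq ?_)
    rw [hS]
    generalize Real.log t / Real.log (Real.log t) ^ (n + 2) = Q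
    push_cast
    field_simp
    -- With m = n + 1 this is an exact identity: 1/m = 1/(m + 1) + 1/(m(m + 1)), and -1/(m + 1)
    -- combines with 1/((m + 1)(1 - κ)) into κ/((m + 1)(1 - κ)).
    ring
  · filter_upwards [ZetaArg.eventually_abs_zetaS_le_of_even hRH heven,
      Real.tendsto_log_atTop.eventually_ge_atTop 1] with t ht hL
    have hll : 0 ≤ Real.log (Real.log t) := Real.log_nonneg hL
    have hkap : 0 < kappa := by linarith [ZetaArg.half_le_kappa]
    rw [add_zero]
    refine le_of_mul_le_mul_left ?_ (mul_pos hfac hpi)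
    rw [mul_assoc]
    refine ht.trans ?_
    -- For even m the term with κ/(1 - κ) is not produced by the argument; being nonnegative, it is
    -- simply added.
    have hextra : 0 ≤ Real.log t / Real.log (Real.log t) ^ (n + 2) * (1 / 2) *
        (1 / ((n : ℝ) + 2) * (kappa / (1 - kappa))) := by positivity
    refine (le_add_of_nonneg_right hextra).trans (le_of_eq ?_)
    rw [hS]
    generalize Real.log t / Real.log (Real.log t) ^ (n + 2) = Q
    push_cast
    field_simp
    ring
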